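/- Let $q\ge 1$. For a finite simple graph $G$ the homomorphism polynomial of order $q$ is $$\mathcal P_q(G)=\sum_{\varphi:V(G)\to\{1,\dots,q\}}\ \prod_{v\in V(G)}x_{\varphi(v)}\prod_{uv\in E(G)}y_{\varphi(u)\varphi(v)},$$ with formal variables $x_i$ ($1\le i\le q$) and $y_{ij}=y_{ji}$ ($1\le i\le j\le q$); that is, the sum of the weights of all homomorphisms from $G$ to the complete graph on $q$ vertices with a loop at every vertex, where vertex $i$ has weight $x_i$ and edge $ij$ has weight $y_{ij}$. A tree decomposition of $G$ is a finite tree with a set of vertices of $G$ (a bag) at each node, such that every edge of $G$ is contained in some bag and, for each vertex $v$ of $G$, the nodes whose bags contain $v$ induce a non-empty connected subtree; its width is the largest size of a bag minus one (and $0$ if all bags are empty), and the tree width of $G$ is the least width of a tree decomposition of $G$. To compute $\mathcal P_q(G)$ means to output the list of all its monomials (as exponent vectors) with their non-zero coefficients, numbers being written in binary. Graphs are given by adjacency matrices, bags by characteristic vectors, and running time is the number of steps of a while-program on binary trees in which each elementary operation (constant nil, copying a pointer, forming a pair, taking a component of a pair, testing for nil) and each control operation costs one step. **Theorem (computing $\mathcal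 P_q$ for bounded tree width).** There is an absolute constant $C$ such that the following hold for every fixed $q\ge1$. 1. There are an exponent $k$ and an algorithm, depending only on $q$, which, given any graph $G$ on $n$ vertices together with a tree decomposition of $G$ with $N$ nodes and of width at most $t$ (for any $t\ge 0$), computes $\mathcal P_q(G)$ in at most $C\,q^{t}\,(n+N+1)^{k}$ steps. 2. For every fixed $t\ge 0$ there are an exponent $k$ and an algorithm, depending only on $q$ and $t$, which, given any graph $G$ on $n$ vertices of tree width at most $t$ (without a tree decomposition), computes $\mathcal P_q(G)$ in at most $C\,q^{t}\,(n+2)^{k}$ steps. In particular, for fixed $q$ and $t$ the running time is polynomial in $n$, with a multiplicative constant of the form $O(q^t)$. -/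

import Mathlib

namespace HomPoly

/-! ### The homomorphism polynomial -/

/-- The formal variables: a vertex weight `x i` for each `i : Fin q`, and an edge weight `y s(i, j)`
for each unordered pair of (possibly equal) elements of `Fin q`. -/
abbrev Var (q : ℕ) : Type := Fin q ⊕ Sym2 (Fin q)

open Classical in
/-- The homomorphism polynomial of order `q` of `G`. The target graph is the complete graph on
`Fin q` with a loop at every vertex, so every map `φ : V → Fin q` is a homomorphism; its weight is
the product of the weights of the images of the vertices and of the edges of `G`. -/
noncomputable def homPoly (q : ℕ) {V : Type*} [Fintype V] (G : SimpleGraph V) :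
    MvPolynomial (Var q) ℕ :=
  ∑ φ : V → Fin q,
    (∏ v : V, MvPolynomial.X (Sum.inl (φ v))) *
      ∏ e ∈ G.edgeFinset, MvPolynomial.X (Sum.inr (e.map φ))

/-! ### Tree decompositions and tree width -/

/-- A tree decomposition of `G` whose tree has `N` nodes: every edge of `G` lies in some bag, and for
every vertex `v` the nodes whose bags contain `v` induce a connected (in particular non-empty)
subgraph of the tree. -/
structure TreeDecomposition {V : Type*} (G : SimpleGraph V) (N : ℕ) where
  tree : SimpleGraph (Fin N)
  isTree : tree.IsTree
  bag : Fin N → Finset V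
  edge_mem : ∀ u v : V, G.Adj u v → ∃ i, u ∈ bag i ∧ v ∈ bag i
  connected : ∀ v : V, (tree.induce {i | v ∈ bag i}).Connected

/-- The width: the largest size of a bag, minus one. -/
def TreeDecomposition.width {V : Type*} {G : SimpleGraph V} {N : ℕ}
    (D : TreeDecomposition G N) : ℕ :=
  (Finset.univ.sup fun i => (D.bag i).card) - 1

/-- The tree width: the least width of a tree decomposition. -/
noncomputable def treeWidth {V : Type*} (G : SimpleGraph V) : ℕ :=
  sInf {w | ∃ (N : ℕ) (D : TreeDecomposition G N), D.width = w}

/-! ### The machine model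

While-programs on binary trees (the data type of pure Lisp). A value is a pointer to a node, and a
value is never modified, so every elementary operation takes a bounded number of pointer
operations. -/

/-- Binary trees. -/
inductive Data : Type
  | nil : Data
  | cons : Data → Data → Data

/-- Programs. Each program transforms one value; several variables are held as nested pairs. -/
inductive Prog : Type
  /-- return the constant `nil` -/
  | nil : Prog
  /-- return the input -/
  | id : Prog
  /-- return the first component of the input -/
  | hd : Prog
  /-- return the second component of the input -/
  | tl : Prog
  /-- run both programs on the input and return the pair of the results -/
  | cons : Prog → Prog → Prog
  /-- run the first program on the input, then the second on its result -/
  | seq : Prog → Prog → Prog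
  /-- if the test gives a pair, run the first branch on the input, otherwise the second -/
  | ite : Prog → Prog → Prog → Prog
  /-- as long as the test on the current value gives a pair, replace the value by the result of the
  body on it -/
  | loop : Prog → Prog → Prog

/-- `Run p x y k`: the program `p`, started on the value `x`, halts with the value `y` after exactly
`k` steps. Every elementary operation and every control step costs one step. -/
inductive Run : Prog → Data → Data → ℕ → Prop
  | nil (x : Data) : Run .nil x .nil 1
  | id (x : Data) : Run .id x x 1
  | hd_nil : Run .hd .nil .nil 1
  | hd_cons (a b : Data) : Run .hd (.cons a b) a 1
  | tl_nil : Run .tl .nil .nil 1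
  | tl_cons (a b : Data) : Run .tl (.cons a b) b 1
  | cons {f g : Prog} {x a b : Data} {k l : ℕ} :
      Run f x a k → Run g x b l → Run (.cons f g) x (.cons a b) (k + l + 1)
  | seq {f g : Prog} {x y z : Data} {k l : ℕ} :
      Run f x y k → Run g y z l → Run (.seq f g) x z (k + l + 1)
  | ite_true {c f g : Prog} {x a b y : Data} {k l : ℕ} :
      Run c x (.cons a b) k → Run f x y l → Run (.ite c f g) x y (k + l + 1)
  | ite_false {c f g : Prog} {x y : Data} {k l : ℕ} :
      Run c x .nil k → Run g x y l → Run (.ite c f g) x y (k + l + 1)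
  | loop_stop {c f : Prog} {x : Data} {k : ℕ} :
      Run c x .nil k → Run (.loop c f) x x (k + 1)
  | loop_step {c f : Prog} {x a b y z : Data} {k l m : ℕ} :
      Run c x (.cons a b) k → Run f x y l → Run (.loop c f) y z m →
        Run (.loop c f) x z (k + l + m + 1)

/-! ### Encodings of inputs and outputs -/

def encList : List Data → Data
  | [] => .nil
  | a :: l => .cons a (encList l)

def encBool : Bool → Data
  | false => .nil
  | true => .cons .nil .nil

/-- Natural numbers are written in binary, least significant bit first. -/
def encNat (n : ℕ) : Data := encList (n.bits.map encBool)

open Classical in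
/-- A subset of `Fin n`, as its characteristic vector. -/
noncomputable def encSet {n : ℕ} (S : Set (Fin n)) : Data :=
  encList ((List.finRange n).map fun i => encBool (decide (i ∈ S)))

/-- A graph on `Fin n`, as its adjacency matrix (list of rows). -/
noncomputable def encGraph {n : ℕ} (G : SimpleGraph (Fin n)) : Data :=
  encList ((List.finRange n).map fun i => encSet {j | G.Adj i j})

/-- A graph with a tree decomposition: the adjacency matrix of the graph, the adjacency matrix of
the tree, and the list of the bags. -/
noncomputable def encGraphWithDecomp {n N : ℕ} (G : SimpleGraph (Fin n))
    (D : TreeDecomposition G N) : Data :=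
  .cons (encGraph G)
    (.cons (encGraph D.tree)
      (encList ((List.finRange N).map fun i => encSet {v | v ∈ D.bag i})))

/-- The variables, each once: first the vertex weights `x i`, then the edge weights `y s(i, j)`
with `i ≤ j`, in lexicographic order. -/
def varList (q : ℕ) : List (Var q) :=
  (List.finRange q).map Sum.inl ++
    (List.finRange q).flatMap fun i =>
      ((List.finRange q).filter fun j => decide (i ≤ j)).map fun j => Sum.inr s(i, j)

/-- A monomial, as its vector of exponents. -/
def encMonomial {q : ℕ} (m : Var q →₀ ℕ) : Data :=
  encList ((varList q).map fun v => encNat (m v))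

/-- A list of terms, each a monomial together with a coefficient. -/
def encTerms {q : ℕ} (L : List ((Var q →₀ ℕ) × ℕ)) : Data :=
  encList (L.map fun mc => .cons (encMonomial mc.1) (encNat mc.2))

/-- `L` lists, in some order and each exactly once, the monomials occurring in `P` together with
their (non-zero) coefficients. -/
def IsExpansion {q : ℕ} (L : List ((Var q →₀ ℕ) × ℕ)) (P : MvPolynomial (Var q) ℕ) : Prop :=
  L.Nodup ∧ ∀ (m : Var q →₀ ℕ) (c : ℕ), (m, c) ∈ L ↔ P.coeff m = c ∧ c ≠ 0

/-- The program `A`, started on `x`, halts within `T` steps and outputs the expanded form of `P`. -/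
def ComputesWithin {q : ℕ} (A : Prog) (x : Data) (P : MvPolynomial (Var q) ℕ) (T : ℕ) : Prop :=
  ∃ (L : List ((Var q →₀ ℕ) × ℕ)) (k : ℕ), IsExpansion L P ∧ k ≤ T ∧ Run A x (encTerms L) k

end HomPoly

namespace HomPoly

/-! ### Families of values computable within a resource bound -/

/-! In the proof the number of colours is `q + 1`.

Reduction to one number. Every coefficient of the polynomial is at most `(q + 1) ^ n` and every
exponent at most `n + n ^ 2`. Put `R = n + n ^ 2 + 1` and `b = (q + 1) * n + 1`, and substitute `2 ^
(b * R ^ j)` for the variable in position `j`. The coefficients are then the digits to base `2 ^ b`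
of a single number, indexed by the exponent vectors (`eval_kronecker`, `exists_expansion`). As `q`
is fixed, this number has polynomially many bits. It is the partition function of the graph with
numerical weights (`val_netOf`).

Partition functions. `Net.val` sums over all colourings of a vertex set `C` the weights of the
vertices in `C` and of the edges touching `C`, the other vertices being coloured by `φ`. It depends
only on the colours of the neighbours of `C`. Once the vertices in `B ∩ C` are coloured as well, the
components of `C \ B` contribute independent factors (`Net.val_split`, `Net.val_comps`). If `B`
contains the neighbours of `C`, the table of `C` therefore comes from the tables of these components
by running through the colourings of `B \ C` and, for each, those of `B ∩ C`: at most `(q + 1) ^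
|B|` cases (`WtPT.table`).

Saturation. The decomposition tree is never traversed. Given a list of candidate separators, the
pieces are the components left after deleting one of them; `n` rounds try every piece `C` with every
separator `B`, and `C` is solved if `B` contains its neighbours and the components of `C \ B` are
solved. By `TreeDecomposition.exists_bag`, a connected set whose neighbours lie in one bag has a bag
that contains its neighbours and also meets it. The components that remain are smaller pieces of the
same kind, so induction on the size shows that enough pieces are solved (`Net.mem_rounds`,
`Net.solved_eq`). The separators are the bags if a decomposition is given, and all tuples of `t + 1`
vertices otherwise; in the second case no decomposition is constructed. Bags have at most `t + 1`
elements, and the surplus factor `q + 1` is moved into the polynomial factor (`pow_bound`).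

Running time. `PT` keeps the factor `(q + 1) ^ e` apart from the polynomial one and is closed under
the usual constructions, so that the large programs need not be written out. A loop adds the
exponent of its length to that of its body (`PT.fold`); the body is analysed in an arbitrary context
from which the input, the state and the current element can be computed. A positive exponent arises
only from enumerating colourings (`PT.ext`). -/

/-- The first component. -/
def Data.hd : Data → Data
  | .nil => .nil
  | .cons a _ => a

/-- The second component. -/
def Data.tl : Data → Data
  | .nil => .nil
  | .cons _ b => b

/-- A natural number in unary. -/
def unary (n : ℕ) : Data := encList (List.replicate n .nil)

/-- A list, with its elements encoded by `f`. -/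
def encL {α : Type} (f : α → Data) (l : List α) : Data := encList (l.map f)

/-- A pair. -/
def encP {α β : Type} (f : α → Data) (g : β → Data) (p : α × β) : Data := .cons (f p.1) (g p.2)

/-- `PT q e s x y`: one program computes `y i` from `x i`, for all indices `i`, within
`(q + 1) ^ e i` times a polynomial in `s i` many steps. -/
def PT (q : ℕ) {I : Type} (e s : I → ℕ) (x y : I → Data) : Prop :=
  ∃ (p : Prog) (c : ℕ), ∀ i, ∃ k, k ≤ (q + 1) ^ e i * (s i + 2) ^ c ∧ Run p (x i) (y i) k

/-- `f` is bounded by `(q + 1) ^ e` times a polynomial in `s`. -/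
def SmallW (q : ℕ) {I : Type} (e s : I → ℕ) (f : I → ℕ) : Prop :=
  ∃ c, ∀ i, f i ≤ (q + 1) ^ e i * (s i + 2) ^ c

/-- `f` is bounded by a polynomial in `s`. -/
def Small {I : Type} (s : I → ℕ) (f : I → ℕ) : Prop :=
  ∃ c, ∀ i, f i ≤ (s i + 2) ^ c

namespace Small

variable {I J : Type} {s f g : I → ℕ}

theorem mono (hf : Small s f) (h : ∀ i, g i ≤ f i) : Small s g :=
  let ⟨c, hc⟩ := hf
  ⟨c, fun i => (h i).trans (hc i)⟩

theorem self : Small s s := ⟨1, fun i => by simp⟩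

theorem const (m : ℕ) : Small s (fun _ => m) :=
  ⟨m, fun i => (Nat.lt_two_pow_self).le.trans (Nat.pow_le_pow_left (by omega) m)⟩

theorem add (hf : Small s f) (hg : Small s g) : Small s (fun i => f i + g i) := by
  obtain ⟨c, hc⟩ := hf
  obtain ⟨d, hd⟩ := hg
  refine ⟨c + d + 1, fun i => ?_⟩
  have h1 : (s i + 2) ^ c ≤ (s i + 2) ^ (c + d) := Nat.pow_le_pow_right (by omega) (by omega)
  have h2 : (s i + 2) ^ d ≤ (s i + 2) ^ (c + d) := Nat.pow_le_pow_right (by omega) (by omega)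
  have := hc i
  have := hd i
  rw [pow_succ]
  nlinarith [Nat.zero_le (s i * (s i + 2) ^ (c + d))]

theorem mul (hf : Small s f) (hg : Small s g) : Small s (fun i => f i * g i) := by
  obtain ⟨c, hc⟩ := hf
  obtain ⟨d, hd⟩ := hg
  exact ⟨c + d, fun i => by rw [pow_add]; exact Nat.mul_le_mul (hc i) (hd i)⟩

theorem pow (hf : Small s f) (m : ℕ) : Small s (fun i => f i ^ m) := by
  induction m with
  | zero => simpa using const 1
  | succ m ih => simpa [pow_succ] using ih.mul hf

theorem comap (hf : Small s f) (g : J → I) : Small (fun j => s (g j)) (fun j => f (g j)) :=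
  let ⟨c, hc⟩ := hf
  ⟨c, fun j => hc (g j)⟩

theorem comapLe {g : J → I} {f' : J → ℕ} (hf : Small s f) (h : ∀ j, f' j ≤ f (g j)) :
    Small (fun j => s (g j)) f' :=
  (hf.comap g).mono h

theorem toW {q : ℕ} {e : I → ℕ} (hf : Small s f) : SmallW q e s f :=
  let ⟨c, hc⟩ := hf
  ⟨c, fun i => (hc i).trans (Nat.le_mul_of_pos_left _ (by positivity))⟩

end Small

namespace PT

variable {q : ℕ} {I J : Type} {e s : I → ℕ} {x y z : I → Data}

/-- Each of the three summands is at most `W * P ^ (c + d)`, and `P ^ 2 ≥ 4`. A base of at least 2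
lets constants disappear in the exponent, which is why all bounds use `s + 2`. -/
theorem bound_add {W P a b c d : ℕ} (hW : 1 ≤ W) (hP : 2 ≤ P) (ha : a ≤ W * P ^ c)
    (hb : b ≤ W * P ^ d) : a + b + 1 ≤ W * P ^ (c + d + 2) := by
  have h1 : P ^ c ≤ P ^ (c + d) := Nat.pow_le_pow_right (by omega) (by omega)
  have h2 : P ^ d ≤ P ^ (c + d) := Nat.pow_le_pow_right (by omega) (by omega)
  have h3 : 1 ≤ P ^ (c + d) := Nat.one_le_pow _ _ (by omega)
  have h4 : W * P ^ c ≤ W * P ^ (c + d) := Nat.mul_le_mul_left _ h1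
  have h5 : W * P ^ d ≤ W * P ^ (c + d) := Nat.mul_le_mul_left _ h2
  have h6 : 1 ≤ W * P ^ (c + d) := Nat.mul_pos hW h3
  have h7 : 4 * (W * P ^ (c + d)) ≤ W * P ^ (c + d + 2) := by
    have h8 : 2 ^ 2 ≤ P ^ 2 := Nat.pow_le_pow_left hP 2
    calc 4 * (W * P ^ (c + d)) = W * P ^ (c + d) * 2 ^ 2 := by ring
      _ ≤ W * P ^ (c + d) * P ^ 2 := Nat.mul_le_mul_left _ h8
      _ = _ := by ring
  omega

theorem of_run_le {p : Prog} {c : ℕ} (h : ∀ i, ∃ k ≤ c, Run p (x i) (y i) k) :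
    PT q e s x y := by
  refine ⟨p, c, fun i => ?_⟩
  obtain ⟨k, hk, hr⟩ := h i
  refine ⟨k, hk.trans ?_, hr⟩
  calc c ≤ 2 ^ c := Nat.lt_two_pow_self.le
    _ ≤ (s i + 2) ^ c := Nat.pow_le_pow_left (by omega) c
    _ ≤ _ := Nat.le_mul_of_pos_left _ (by positivity)

theorem of_run {p : Prog} {c : ℕ} (h : ∀ i, Run p (x i) (y i) c) : PT q e s x y :=
  of_run_le fun i => ⟨c, le_rfl, h i⟩

theorem congr (h : PT q e s x y) (hy : ∀ i, y i = z i) : PT q e s x z := by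
  obtain rfl : y = z := funext hy
  exact h

theorem mono {e' : I → ℕ} (h : PT q e s x y) (he : ∀ i, e i ≤ e' i) : PT q e' s x y := by
  obtain ⟨p, c, h⟩ := h
  refine ⟨p, c, fun i => ?_⟩
  obtain ⟨k, hk, hr⟩ := h i
  exact ⟨k, hk.trans (Nat.mul_le_mul_right _ (Nat.pow_le_pow_right (by omega) (he i))), hr⟩

theorem up (h : PT q (fun _ => 0) s x y) : PT q e s x y := h.mono fun _ => Nat.zero_le _

theorem comap (h : PT q e s x y) (g : J → I) :
    PT q (fun j => e (g j)) (fun j => s (g j)) (fun j => x (g j)) (fun j => y (g j)) :=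
  let ⟨p, c, h⟩ := h
  ⟨p, c, fun j => h (g j)⟩

protected theorem id : PT q e s x x := of_run (p := .id) fun _ => .id _

theorem comp (h : PT q e s x y) (h' : PT q e s y z) : PT q e s x z := by
  obtain ⟨p, c, h⟩ := h
  obtain ⟨p', c', h'⟩ := h'
  refine ⟨.seq p p', c + c' + 2, fun i => ?_⟩
  obtain ⟨k, hk, hr⟩ := h i
  obtain ⟨k', hk', hr'⟩ := h' i
  exact ⟨k + k' + 1, bound_add (Nat.one_le_pow _ _ (by omega)) (by omega) hk hk', .seq hr hr'⟩

/-- Evaluation in a context in which the original input is available. -/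
theorem via {g : J → I} {x' : J → Data} (h : PT q e s x y)
    (hx : PT q (fun j => e (g j)) (fun j => s (g j)) x' (fun j => x (g j))) :
    PT q (fun j => e (g j)) (fun j => s (g j)) x' (fun j => y (g j)) :=
  hx.comp (h.comap g)

theorem cons (h : PT q e s x y) (h' : PT q e s x z) :
    PT q e s x (fun i => .cons (y i) (z i)) := by
  obtain ⟨p, c, h⟩ := h
  obtain ⟨p', c', h'⟩ := h'
  refine ⟨.cons p p', c + c' + 2, fun i => ?_⟩
  obtain ⟨k, hk, hr⟩ := h i
  obtain ⟨k', hk', hr'⟩ := h' i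
  exact ⟨k + k' + 1, bound_add (Nat.one_le_pow _ _ (by omega)) (by omega) hk hk', .cons hr hr'⟩

theorem const (d : Data) : PT q e s x (fun _ => d) := by
  induction d with
  | nil => exact of_run (p := .nil) fun _ => .nil _
  | cons a b iha ihb => exact iha.cons ihb

theorem hd (h : PT q e s x y) : PT q e s x (fun i => (y i).hd) :=
  h.comp <| of_run (p := .hd) (c := 1) fun i => by
    cases y i with
    | nil => exact .hd_nil
    | cons a b => exact .hd_cons a b

theorem tl (h : PT q e s x y) : PT q e s x (fun i => (y i).tl) :=
  h.comp <| of_run (p := .tl) (c := 1) fun i => by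
    cases y i with
    | nil => exact .tl_nil
    | cons a b => exact .tl_cons a b

theorem fst (h : PT q e s x (fun i => .cons (y i) (z i))) : PT q e s x y := h.hd

theorem snd (h : PT q e s x (fun i => .cons (y i) (z i))) : PT q e s x z := h.tl

/-- Case distinction, with each branch only analysed where it is taken. -/
theorem iteSub {b : I → Bool} (hb : PT q e s x (fun i => encBool (b i)))
    (hf : PT q (fun j : {i // b i = true} => e j) (fun j => s j) (fun j => x j) (fun j => y j))
    (hg : PT q (fun j : {i // b i = false} => e j) (fun j => s j) (fun j => x j) (fun j => y j)) :
    PT q e s x y := by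
  obtain ⟨p, c, h⟩ := hb
  obtain ⟨p1, c1, h1⟩ := hf
  obtain ⟨p2, c2, h2⟩ := hg
  refine ⟨.ite p p1 p2, c + (c1 + c2) + 2, fun i => ?_⟩
  obtain ⟨k, hk, hr⟩ := h i
  have hm : ∀ {c}, c ≤ c1 + c2 → (q + 1) ^ e i * (s i + 2) ^ c ≤
      (q + 1) ^ e i * (s i + 2) ^ (c1 + c2) := fun h =>
    Nat.mul_le_mul_left _ (Nat.pow_le_pow_right (by omega) h)
  cases hbi : b i with
  | true =>
    obtain ⟨k1, hk1, hr1⟩ := h1 ⟨i, hbi⟩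
    simp only [hbi] at hr
    exact ⟨k + k1 + 1, bound_add (Nat.one_le_pow _ _ (by omega)) (by omega) hk
      (hk1.trans (hm (by omega))), .ite_true hr hr1⟩
  | false =>
    obtain ⟨k1, hk1, hr1⟩ := h2 ⟨i, hbi⟩
    simp only [hbi] at hr
    exact ⟨k + k1 + 1, bound_add (Nat.one_le_pow _ _ (by omega)) (by omega) hk
      (hk1.trans (hm (by omega))), .ite_false hr hr1⟩

theorem ite {b : I → Bool} {f g : I → Data} (hb : PT q e s x (fun i => encBool (b i)))
    (hf : PT q e s x f) (hg : PT q e s x g)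
    (h1 : ∀ i, b i = true → f i = y i) (h2 : ∀ i, b i = false → g i = y i) : PT q e s x y :=
  iteSub hb ((hf.comap _).congr fun j => h1 _ j.2) ((hg.comap _).congr fun j => h2 _ j.2)

end PT

/-! ### Loops: folds over lists. -/

/-- The steps of the folds over the lists `l i`. -/
structure FoldIdx {I α : Type} (l : I → List α) where
  i : I
  pre : List α
  a : α
  h : pre ++ [a] <+: l i

theorem FoldIdx.mem {I α : Type} {l : I → List α} (j : FoldIdx l) : j.a ∈ l j.i :=
  j.h.subset (by simp)

theorem FoldIdx.pre_prefix {I α : Type} {l : I → List α} (j : FoldIdx l) : j.pre <+: l j.i :=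
  (List.prefix_append _ _).trans j.h

/-- The elements of the lists `l i`. -/
structure MemIdx {I α : Type} (l : I → List α) where
  i : I
  a : α
  h : a ∈ l i

namespace PT

variable {q : ℕ} {I J : Type} {e s : I → ℕ} {x y z : I → Data}

/-- One iteration of a fold: from `((x, state), a :: l)` to `((x, state'), l)`. -/
def foldBody (p : Prog) : Prog :=
  .cons (.cons (.seq .hd .hd)
    (.seq (.cons (.seq .hd .hd) (.cons (.seq .hd .tl) (.seq .tl .hd))) p)) (.seq .tl .tl)

theorem run_foldBody {p : Prog} {d st st' a l : Data} {k : ℕ}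
    (h : Run p (.cons d (.cons st a)) st' k) :
    Run (foldBody p) (.cons (.cons d st) (.cons a l)) (.cons (.cons d st') l) (k + 20) := by
  have hhh : Run (.seq .hd .hd) (.cons (.cons d st) (.cons a l)) d 3 :=
    .seq (.hd_cons _ _) (.hd_cons _ _)
  have hht : Run (.seq .hd .tl) (.cons (.cons d st) (.cons a l)) st 3 :=
    .seq (.hd_cons _ _) (.tl_cons _ _)
  have hth : Run (.seq .tl .hd) (.cons (.cons d st) (.cons a l)) a 3 :=
    .seq (.tl_cons _ _) (.hd_cons _ _)
  have htt : Run (.seq .tl .tl) (.cons (.cons d st) (.cons a l)) l 3 :=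
    .seq (.tl_cons _ _) (.tl_cons _ _)
  have := Run.cons (Run.cons hhh (Run.seq (Run.cons hhh (Run.cons hht hth)) h)) htt
  have hk : (3 + (3 + (3 + 3 + 1) + 1 + k + 1) + 1) + 3 + 1 = k + 20 := by omega
  exact hk ▸ this

theorem run_fold {α σ : Type} {p : Prog} {K : ℕ} {d : Data} {ea : α → Data} {es : σ → Data}
    {f : σ → α → σ} (l : List α) (st : σ)
    (h : ∀ pre a, pre ++ [a] <+: l → ∃ k ≤ K,
      Run p (.cons d (.cons (es (pre.foldl f st)) (ea a))) (es (f (pre.foldl f st) a)) k) :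
    ∃ k ≤ l.length * (K + 24) + 2,
      Run (.loop .tl (foldBody p)) (.cons (.cons d (es st)) (encL ea l))
        (.cons (.cons d (es (l.foldl f st))) .nil) k := by
  induction l generalizing st with
  | nil => exact ⟨2, by simp, Run.loop_stop (.tl_cons _ _)⟩
  | cons a l ih =>
    obtain ⟨k1, hk1, h1⟩ := h [] a (by simp)
    obtain ⟨k2, hk2, h2⟩ := ih (f st a) fun pre b hb => by
      simpa using h (a :: pre) b (by simpa using hb)
    -- A pass costs 22 steps besides those of `p`: the test, the loop step and the 20 steps of
    -- rearranging. The 24 in the bound leaves some slack.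
    refine ⟨1 + (k1 + 20) + k2 + 1, ?_, .loop_step (.tl_cons _ _) (run_foldBody h1) h2⟩
    simp only [List.length_cons, Nat.add_mul]
    omega

/-- Here `a` is the cost of preparing the loop, `m` the number of passes, `K` the cost of the body
and `b` the total. The exponential weights of `m` and `K` multiply; all constants together stay
below `2 ^ 8 ≤ P ^ 8`. -/
theorem fold_bound {W1 W2 W P a b m K k c0 c1 c2 : ℕ} (hW : W1 * W2 ≤ W) (hW1 : 1 ≤ W1)
    (hW2 : 1 ≤ W2) (hP : 2 ≤ P) (ha : a ≤ W * P ^ c0) (hm : m ≤ W1 * P ^ c1) (hK : K ≤ W2 * P ^ c2)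
    (hk : k ≤ m * (K + 24) + 2) (hb : b ≤ a + k + 10) : b ≤ W * P ^ (c0 + c1 + c2 + 8) := by
  have e1 : P ^ (c0 + c1 + c2 + 8) = P ^ c0 * (P ^ c1 * P ^ c2) * P ^ 8 := by ring
  have p0 : 1 ≤ P ^ c0 := Nat.one_le_pow _ _ (by omega)
  have p1 : 1 ≤ P ^ c1 := Nat.one_le_pow _ _ (by omega)
  have p2 : 1 ≤ P ^ c2 := Nat.one_le_pow _ _ (by omega)
  have p8 : 2 ^ 8 ≤ P ^ 8 := Nat.pow_le_pow_left hP 8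
  have h1 : m * (K + 24) ≤ (W1 * P ^ c1) * (25 * (W2 * P ^ c2)) := by
    refine Nat.mul_le_mul hm ?_
    have : 1 ≤ W2 * P ^ c2 := Nat.mul_pos hW2 p2
    omega
  have h2 : (W1 * P ^ c1) * (25 * (W2 * P ^ c2)) ≤ 25 * (W * (P ^ c1 * P ^ c2)) := by
    calc _ = 25 * ((W1 * W2) * (P ^ c1 * P ^ c2)) := by ring
      _ ≤ _ := Nat.mul_le_mul_left _ (Nat.mul_le_mul_right _ hW)
  have hWp : 1 ≤ W := le_trans (Nat.mul_pos hW1 hW2) hW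
  have p12 : 1 ≤ P ^ c1 * P ^ c2 := Nat.mul_pos p1 p2
  have hQ : W * (P ^ c1 * P ^ c2) ≤ W * (P ^ c0 * (P ^ c1 * P ^ c2)) :=
    Nat.mul_le_mul_left _ (Nat.le_mul_of_pos_left _ p0)
  have hQ0 : W * P ^ c0 ≤ W * (P ^ c0 * (P ^ c1 * P ^ c2)) :=
    Nat.mul_le_mul_left _ (Nat.le_mul_of_pos_right _ p12)
  have hQ1 : 1 ≤ W * (P ^ c0 * (P ^ c1 * P ^ c2)) := Nat.mul_pos hWp (Nat.mul_pos p0 p12)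
  have hfin : 256 * (W * (P ^ c0 * (P ^ c1 * P ^ c2))) ≤ W * P ^ (c0 + c1 + c2 + 8) := by
    rw [e1, ← mul_assoc W (P ^ c0 * (P ^ c1 * P ^ c2)), mul_comm 256]
    exact Nat.mul_le_mul_left _ p8
  omega

/-- Folds. The body is analysed in an arbitrary context in which the input, the state and the
current element are available. -/
theorem fold {α σ : Type} {ea : I → α → Data} {es : I → σ → Data} {f : I → σ → α → σ}
    {l : I → List α} {st : I → σ} {e1 e2 : I → ℕ} (he : ∀ i, e1 i + e2 i ≤ e i)
    (hl : PT q e s x (fun i => encL (ea i) (l i))) (hst : PT q e s x (fun i => es i (st i)))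
    (hlen : SmallW q e1 s (fun i => (l i).length))
    (hf : ∀ x' : FoldIdx l → Data,
      (∀ {e'}, PT q e' (fun j => s j.i) x' (fun j => x j.i)) →
      (∀ {e'}, PT q e' (fun j => s j.i) x'
        (fun j => es j.i (j.pre.foldl (f j.i) (st j.i)))) →
      (∀ {e'}, PT q e' (fun j => s j.i) x' (fun j => ea j.i j.a)) →
      PT q (fun j => e2 j.i) (fun j => s j.i) x'
        (fun j => es j.i (f j.i (j.pre.foldl (f j.i) (st j.i)) j.a))) :
    PT q e s x (fun i => es i ((l i).foldl (f i) (st i))) := by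
  -- The context is instantiated by the value on which `p` runs inside `foldBody`: the input, the
  -- state and the current element as nested pairs.
  have hid : ∀ {e'}, PT q e' (fun j : FoldIdx l => s j.i)
      (fun j => Data.cons (x j.i) (.cons (es j.i (j.pre.foldl (f j.i) (st j.i))) (ea j.i j.a))) _ :=
    PT.id
  obtain ⟨p, c2, hp⟩ := hf _ hid.fst hid.snd.fst hid.snd.snd
  obtain ⟨p0, c0, h0⟩ := (PT.id.cons hst).cons hl
  obtain ⟨c1, h1⟩ := hlen
  refine ⟨.seq (.seq p0 (.loop .tl (foldBody p))) (.seq .hd .tl), c0 + c1 + c2 + 8, fun i => ?_⟩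
  obtain ⟨a, ha, hra⟩ := h0 i
  obtain ⟨k, hk, hrk⟩ := run_fold (p := p) (K := (q + 1) ^ e2 i * (s i + 2) ^ c2) (d := x i)
    (ea := ea i) (es := es i) (f := f i) (l i) (st i) fun pre b hb => hp ⟨i, pre, b, hb⟩
  refine ⟨_, ?_, .seq (.seq hra hrk) (.seq (.hd_cons _ _) (.tl_cons _ _))⟩
  refine fold_bound (W1 := (q + 1) ^ e1 i) (W2 := (q + 1) ^ e2 i) ?_
    (Nat.one_le_pow _ _ (by omega)) (Nat.one_le_pow _ _ (by omega)) (by omega) ha (h1 i) le_rfl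
    hk (by omega)
  rw [← pow_add]
  exact Nat.pow_le_pow_right (by omega) (he i)

end PT

/-! ### Booleans, lists and unary numbers. -/

/-- Whether a value is a pair. -/
def Data.isCons : Data → Bool
  | .nil => false
  | .cons _ _ => true

theorem isCons_encL {α : Type} (f : α → Data) (l : List α) : (encL f l).isCons = !l.isEmpty := by
  cases l <;> rfl

theorem tl_encL {α : Type} (f : α → Data) (l : List α) : (encL f l).tl = encL f l.tail := by
  cases l <;> rfl

theorem encL_map {α β : Type} (f : β → Data) (g : α → β) (l : List α) :
    encL f (l.map g) = encL (fun a => f (g a)) l := by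
  simp [encL, Function.comp_def]

theorem encL_congr {α : Type} {f g : α → Data} {l : List α} (h : ∀ a ∈ l, f a = g a) :
    encL f l = encL g l := by
  simp only [encL]
  rw [List.map_congr_left h]

theorem unary_eq (n : ℕ) : unary n = encL (fun _ : Unit => .nil) (List.replicate n ()) := by
  simp [unary, encL]

theorem tl_unary (n : ℕ) : (unary n).tl = unary (n - 1) := by cases n <;> rfl

theorem isCons_unary (n : ℕ) : (unary n).isCons = decide (0 < n) := by cases n <;> rfl

theorem iterate_tl_encL {α : Type} (f : α → Data) (l : List α) (m : ℕ) :
    Data.tl^[m] (encL f l) = encL f (l.drop m) := by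
  induction m generalizing l with
  | zero => rfl
  | succ m ih => rw [Function.iterate_succ_apply, tl_encL, ih, List.drop_tail]

theorem iterate_tl_unary (n m : ℕ) : Data.tl^[m] (unary n) = unary (n - m) := by
  induction m generalizing n with
  | zero => rfl
  | succ m ih => rw [Function.iterate_succ_apply, tl_unary, ih]; congr 1; omega

/-- Beyond the end of a list the machine finds `nil`, whose first component is `nil`; the default
value must therefore be encoded by `nil`. -/
theorem hd_encL_drop {α : Type} (f : α → Data) (l : List α) (m : ℕ) {d : α} (hd : f d = .nil) :
    (encL f (l.drop m)).hd = f (l.getD m d) := by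
  rw [List.getD_eq_getElem?_getD, ← List.head?_drop]
  cases l.drop m with
  | nil => exact hd.symm
  | cons a l => rfl

/-- The steps of an iteration. -/
structure NatIdx {I : Type} (m : I → ℕ) where
  i : I
  k : ℕ
  h : k < m i

theorem SmallW.monoW {q : ℕ} {I : Type} {e e' s f : I → ℕ} (hf : SmallW q e s f)
    (he : ∀ i, e i ≤ e' i) : SmallW q e' s f :=
  let ⟨c, hc⟩ := hf
  ⟨c, fun i => (hc i).trans (Nat.mul_le_mul_right _ (Nat.pow_le_pow_right (by omega) (he i)))⟩

namespace PT

variable {q : ℕ} {I J : Type} {e s e1 e2 : I → ℕ} {x y z : I → Data}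

theorem isCons (h : PT q e s x y) : PT q e s x (fun i => encBool (y i).isCons) :=
  h.comp <| of_run_le (p := .ite .id (.cons .nil .nil) .nil) (c := 5) fun i => by
    cases y i with
    | nil => exact ⟨3, by omega, .ite_false (.id _) (.nil _)⟩
    | cons a b => exact ⟨5, by omega, .ite_true (.id _) (.cons (.nil _) (.nil _))⟩

section Bool

variable {a b : I → Bool}

theorem not (h : PT q e s x (fun i => encBool (b i))) : PT q e s x (fun i => encBool (!b i)) :=
  ite h (const .nil) (const (encBool true)) (fun i hi => by simp [hi, encBool])
    (fun i hi => by simp [hi])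

theorem and (ha : PT q e s x (fun i => encBool (a i))) (hb : PT q e s x (fun i => encBool (b i))) :
    PT q e s x (fun i => encBool (a i && b i)) :=
  ite ha hb (const .nil) (fun i hi => by simp [hi]) (fun i hi => by simp [hi, encBool])

theorem or (ha : PT q e s x (fun i => encBool (a i))) (hb : PT q e s x (fun i => encBool (b i))) :
    PT q e s x (fun i => encBool (a i || b i)) :=
  ite ha (const (encBool true)) hb (fun i hi => by simp [hi]) (fun i hi => by simp [hi])

end Bool

section List

variable {α β σ : Type} {ea : I → α → Data} {eb : I → β → Data} {l l' : I → List α}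

/-- A loop of polynomial length leaves the whole exponent `e` to its body. -/
theorem foldLight {es : I → σ → Data} {f : I → σ → α → σ} {st : I → σ}
    (hl : PT q e s x (fun i => encL (ea i) (l i))) (hst : PT q e s x (fun i => es i (st i)))
    (hlen : Small s (fun i => (l i).length))
    (hf : ∀ x' : FoldIdx l → Data,
      (∀ {e'}, PT q e' (fun j => s j.i) x' (fun j => x j.i)) →
      (∀ {e'}, PT q e' (fun j => s j.i) x'
        (fun j => es j.i (j.pre.foldl (f j.i) (st j.i)))) →
      (∀ {e'}, PT q e' (fun j => s j.i) x' (fun j => ea j.i j.a)) →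
      PT q (fun j => e j.i) (fun j => s j.i) x'
        (fun j => es j.i (f j.i (j.pre.foldl (f j.i) (st j.i)) j.a))) :
    PT q e s x (fun i => es i ((l i).foldl (f i) (st i))) :=
  fold (e1 := fun _ => 0) (fun i => by simp) hl hst hlen.toW hf

/-- Iteration. -/
theorem iterate {es : I → σ → Data} {f : I → σ → σ} {st : I → σ} {m : I → ℕ}
    (hm : PT q e s x (fun i => unary (m i))) (hst : PT q e s x (fun i => es i (st i)))
    (hlen : Small s m)
    (hf : ∀ x' : NatIdx m → Data,
      (∀ {e'}, PT q e' (fun j => s j.i) x' (fun j => x j.i)) →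
      (∀ {e'}, PT q e' (fun j => s j.i) x' (fun j => es j.i ((f j.i)^[j.k] (st j.i)))) →
      PT q (fun j => e j.i) (fun j => s j.i) x'
        (fun j => es j.i (f j.i ((f j.i)^[j.k] (st j.i))))) :
    PT q e s x (fun i => es i ((f i)^[m i] (st i))) := by
  -- A unary number is the encoding of a list of units, so iteration is a fold that ignores its
  -- elements.
  have key : ∀ i (l : List Unit), l.foldl (fun a _ => f i a) (st i) = (f i)^[l.length] (st i) := by
    intro i l
    rw [← List.foldl_const]
  have hpre : ∀ j : FoldIdx fun i => List.replicate (m i) (), j.pre.length < m j.i := fun j => by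
    simpa using j.h.length_le
  refine (foldLight (f := fun i a (_ : Unit) => f i a) (ea := fun _ _ => .nil)
    (hm.congr fun i => unary_eq _) hst (by simpa using hlen) fun x' hx hs _ => ?_).congr fun i => by
      rw [key, List.length_replicate]
  have := hf _ PT.id.fst PT.id.snd
  exact ((hx.cons hs).congr fun j => by rw [key]).comp
    ((this.comap fun j : FoldIdx fun i => List.replicate (m i) () =>
      (⟨j.i, j.pre.length, hpre j⟩ : NatIdx m)).congr fun j => by rw [key])

theorem reverseAux (hl : PT q e s x (fun i => encL (ea i) (l i)))
    (hl' : PT q e s x (fun i => encL (ea i) (l' i)))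
    (hlen : SmallW q e s (fun i => (l i).length)) :
    PT q e s x (fun i => encL (ea i) ((l i).reverse ++ l' i)) :=
  (fold (e1 := e) (e2 := fun _ => 0) (es := fun i => encL (ea i)) (f := fun _ acc a => a :: acc)
    (st := l') (fun i => by simp) hl hl' hlen (fun _ _ hs ha => ha.cons hs)).congr
    fun i => by rw [List.foldl_flip_cons_eq_append]; simp

theorem reverse (hl : PT q e s x (fun i => encL (ea i) (l i)))
    (hlen : SmallW q e s (fun i => (l i).length)) :
    PT q e s x (fun i => encL (ea i) (l i).reverse) :=
  (reverseAux (l' := fun _ => []) hl (const .nil) hlen).congr fun i => by simp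

theorem append (hl : PT q e s x (fun i => encL (ea i) (l i)))
    (hl' : PT q e s x (fun i => encL (ea i) (l' i)))
    (hlen : SmallW q e s (fun i => (l i).length)) :
    PT q e s x (fun i => encL (ea i) (l i ++ l' i)) :=
  (reverseAux (hl.reverse hlen) hl' (by simpa using hlen)).congr fun i => by simp

theorem mapW {g : I → α → β} (he : ∀ i, e1 i + e2 i ≤ e i)
    (hl : PT q e s x (fun i => encL (ea i) (l i)))
    (hlen : SmallW q e1 s (fun i => (l i).length))
    (hg : ∀ x' : MemIdx l → Data,
      (∀ {e'}, PT q e' (fun j => s j.i) x' (fun j => x j.i)) →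
      (∀ {e'}, PT q e' (fun j => s j.i) x' (fun j => ea j.i j.a)) →
      PT q (fun j => e2 j.i) (fun j => s j.i) x' (fun j => eb j.i (g j.i j.a))) :
    PT q e s x (fun i => encL (eb i) ((l i).map (g i))) := by
  have hlen' : SmallW q e s (fun i => (l i).length) :=
    hlen.monoW fun i => (Nat.le_add_right _ _).trans (he i)
  have key : ∀ i (l : List α) (acc : List β),
      l.foldl (fun acc a => g i a :: acc) acc = (l.map (g i)).reverse ++ acc := by
    intro i l
    induction l with
    | nil => simp
    | cons a l ih => simp [ih]
  refine (reverse (l := fun i => (l i).foldl (fun acc a => g i a :: acc) [])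
    (fold (es := fun i => encL (eb i)) (f := fun i acc a => g i a :: acc) (st := fun _ => [])
    he hl (const .nil) hlen fun x' hx hs ha => ?_) ?_).congr fun i => by rw [key]; simp
  · refine PT.cons ?_ hs
    exact (hx.cons ha).comp ((hg _ PT.id.fst PT.id.snd).comap
      fun j : FoldIdx l => (⟨j.i, j.a, j.mem⟩ : MemIdx l))
  · simpa [key] using hlen'

theorem map {g : I → α → β} (hl : PT q e s x (fun i => encL (ea i) (l i)))
    (hlen : Small s (fun i => (l i).length))
    (hg : ∀ x' : MemIdx l → Data,
      (∀ {e'}, PT q e' (fun j => s j.i) x' (fun j => x j.i)) →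
      (∀ {e'}, PT q e' (fun j => s j.i) x' (fun j => ea j.i j.a)) →
      PT q (fun j => e j.i) (fun j => s j.i) x' (fun j => eb j.i (g j.i j.a))) :
    PT q e s x (fun i => encL (eb i) ((l i).map (g i))) :=
  mapW (e1 := fun _ => 0) (fun i => by simp) hl hlen.toW hg

/-- Starting from the last inner list, each step puts one inner list in front of the result and
costs only the length of that list. An exponentially long result is therefore not copied again in
every step. -/
theorem flatten {l : I → List (List α)} (he : ∀ i, e1 i ≤ e i)
    (hl : PT q e s x (fun i => encL (encL (ea i)) (l i)))
    (hlen : SmallW q e1 s (fun i => (l i).length))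
    (hlen' : Small (fun j : MemIdx l => s j.i) (fun j => j.a.length)) :
    PT q e s x (fun i => encL (ea i) (l i).flatten) := by
  have key : ∀ l : List (List α), l.reverse.foldl (fun acc a => a ++ acc) [] = l.flatten := by
    intro l
    rw [List.foldl_reverse]
    induction l with
    | nil => rfl
    | cons a l ih => simp [ih]
  refine (fold (e1 := e1) (e2 := fun _ => 0) (es := fun i => encL (ea i))
    (f := fun _ acc a => a ++ acc) (st := fun _ => []) (fun i => by simpa using he i)
    (hl.reverse (hlen.monoW he)) (const .nil) (by simpa using hlen)
    fun x' _ hs ha => ha.append hs ?_).congr fun i => by rw [key]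
  exact (hlen'.comap fun j : FoldIdx fun i => (l i).reverse =>
      (⟨j.i, j.a, by simpa using j.mem⟩ : MemIdx l)).toW

theorem flatMapW {g : I → α → List β} (he : ∀ i, e1 i + e2 i ≤ e i)
    (hl : PT q e s x (fun i => encL (ea i) (l i)))
    (hlen : SmallW q e1 s (fun i => (l i).length))
    (hlen' : Small (fun j : MemIdx l => s j.i) (fun j => (g j.i j.a).length))
    (hg : ∀ x' : MemIdx l → Data,
      (∀ {e'}, PT q e' (fun j => s j.i) x' (fun j => x j.i)) →
      (∀ {e'}, PT q e' (fun j => s j.i) x' (fun j => ea j.i j.a)) →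
      PT q (fun j => e2 j.i) (fun j => s j.i) x' (fun j => encL (eb j.i) (g j.i j.a))) :
    PT q e s x (fun i => encL (eb i) ((l i).flatMap (g i))) := by
  refine (flatten (e1 := e1) (fun i => (Nat.le_add_right _ _).trans (he i))
    (mapW (eb := fun i => encL (eb i)) he hl hlen hg) (by simpa using hlen) ?_).congr fun i => by
    rw [List.flatMap_def]
  obtain ⟨c, hc⟩ := hlen'
  refine ⟨c, fun ⟨i, a, h⟩ => ?_⟩
  obtain ⟨b, hb, rfl⟩ := List.mem_map.1 h
  exact hc ⟨i, b, hb⟩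

theorem flatMap {g : I → α → List β} (hl : PT q e s x (fun i => encL (ea i) (l i)))
    (hlen : Small s (fun i => (l i).length))
    (hlen' : Small (fun j : MemIdx l => s j.i) (fun j => (g j.i j.a).length))
    (hg : ∀ x' : MemIdx l → Data,
      (∀ {e'}, PT q e' (fun j => s j.i) x' (fun j => x j.i)) →
      (∀ {e'}, PT q e' (fun j => s j.i) x' (fun j => ea j.i j.a)) →
      PT q (fun j => e j.i) (fun j => s j.i) x' (fun j => encL (eb j.i) (g j.i j.a))) :
    PT q e s x (fun i => encL (eb i) ((l i).flatMap (g i))) :=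
  flatMapW (e1 := fun _ => 0) (fun i => by simp) hl hlen.toW hlen' hg

theorem filter {p : I → α → Bool} (hl : PT q e s x (fun i => encL (ea i) (l i)))
    (hlen : Small s (fun i => (l i).length))
    (hp : ∀ x' : MemIdx l → Data,
      (∀ {e'}, PT q e' (fun j => s j.i) x' (fun j => x j.i)) →
      (∀ {e'}, PT q e' (fun j => s j.i) x' (fun j => ea j.i j.a)) →
      PT q (fun j => e j.i) (fun j => s j.i) x' (fun j => encBool (p j.i j.a))) :
    PT q e s x (fun i => encL (ea i) ((l i).filter (p i))) := by
  have key : ∀ i (l : List α), l.flatMap (fun a => if p i a then [a] else []) = l.filter (p i) := by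
    intro i l
    induction l with
    | nil => rfl
    | cons a l ih => cases h : p i a <;> simp [h, ih]
  refine (flatMap (g := fun i a => if p i a then [a] else []) hl hlen
    ⟨1, fun j => by dsimp only; split <;> simp⟩ fun x' hx ha => ?_).congr fun i => by rw [key]
  exact ite (hp x' hx ha) (ha.cons (const .nil)) (const .nil) (fun i h => by simp [h]; rfl)
    (fun i h => by simp [h]; rfl)

theorem any {p : I → α → Bool} (hl : PT q e s x (fun i => encL (ea i) (l i)))
    (hlen : Small s (fun i => (l i).length))
    (hp : ∀ x' : MemIdx l → Data,
      (∀ {e'}, PT q e' (fun j => s j.i) x' (fun j => x j.i)) →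
      (∀ {e'}, PT q e' (fun j => s j.i) x' (fun j => ea j.i j.a)) →
      PT q (fun j => e j.i) (fun j => s j.i) x' (fun j => encBool (p j.i j.a))) :
    PT q e s x (fun i => encBool ((l i).any (p i))) :=
  (hl.filter hlen hp).isCons.congr fun i => by
    rw [isCons_encL]
    congr 1
    rw [Bool.eq_iff_iff]
    simp [List.filter_eq_nil_iff]

theorem all {p : I → α → Bool} (hl : PT q e s x (fun i => encL (ea i) (l i)))
    (hlen : Small s (fun i => (l i).length))
    (hp : ∀ x' : MemIdx l → Data,
      (∀ {e'}, PT q e' (fun j => s j.i) x' (fun j => x j.i)) →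
      (∀ {e'}, PT q e' (fun j => s j.i) x' (fun j => ea j.i j.a)) →
      PT q (fun j => e j.i) (fun j => s j.i) x' (fun j => encBool (p j.i j.a))) :
    PT q e s x (fun i => encBool ((l i).all (p i))) :=
  (any (p := fun i a => !p i a) hl hlen fun x' hx ha => (hp x' hx ha).not).not.congr fun i => by
    rw [← List.not_all_eq_any_not, Bool.not_not]

theorem iterateTl {m : I → ℕ} (hy : PT q e s x y) (hm : PT q e s x (fun i => unary (m i)))
    (hs : Small s m) : PT q e s x (fun i => Data.tl^[m i] (y i)) :=
  iterate (es := fun _ d => d) (f := fun _ => Data.tl) hm hy hs fun _ _ h => h.tl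

/-- Lookup in a list. -/
theorem getD {m : I → ℕ} {d : α} (hd : ∀ i, ea i d = .nil)
    (hl : PT q e s x (fun i => encL (ea i) (l i))) (hm : PT q e s x (fun i => unary (m i)))
    (hs : Small s m) : PT q e s x (fun i => ea i ((l i).getD (m i) d)) :=
  (hl.iterateTl hm hs).hd.congr fun i => by rw [iterate_tl_encL, hd_encL_drop _ _ _ (hd i)]

theorem length (hl : PT q e s x (fun i => encL (ea i) (l i)))
    (hlen : Small s (fun i => (l i).length)) : PT q e s x (fun i => unary (l i).length) :=
  (map (eb := fun _ _ => .nil) (g := fun _ _ => ()) hl hlen fun _ _ _ => const .nil).congr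
    fun i => by simp [unary_eq]

end List

section Unary

variable {m n : I → ℕ}

theorem succ (hm : PT q e s x (fun i => unary (m i))) : PT q e s x (fun i => unary (m i + 1)) :=
  (const .nil).cons hm

theorem add (hm : PT q e s x (fun i => unary (m i))) (hn : PT q e s x (fun i => unary (n i)))
    (hs : Small s n) : PT q e s x (fun i => unary (m i + n i)) :=
  (iterate (es := fun _ => unary) (f := fun _ a => a + 1) hn hm hs fun _ _ h => h.succ).congr
    fun i => by rw [Nat.succ_iterate]

theorem mul (hm : PT q e s x (fun i => unary (m i))) (hn : PT q e s x (fun i => unary (n i)))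
    (hsm : Small s m) (hsn : Small s n) : PT q e s x (fun i => unary (m i * n i)) :=
  (iterate (es := fun _ => unary) (f := fun i a => a + m i) (st := fun _ => 0) hn (const .nil) hsn
    fun _ hx h => h.add (hm.via hx) (hsm.comap _)).congr fun i => by
      rw [add_right_iterate]; simp [mul_comm]

theorem powConst (hm : PT q e s x (fun i => unary (m i))) (hsm : Small s m) (c : ℕ) :
    PT q e s x (fun i => unary (m i ^ c)) := by
  induction c with
  | zero => exact const (unary 1)
  | succ c ih => exact ih.mul hm (hsm.pow c) hsm

theorem lt (hm : PT q e s x (fun i => unary (m i))) (hn : PT q e s x (fun i => unary (n i)))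
    (hs : Small s m) : PT q e s x (fun i => encBool (decide (m i < n i))) :=
  (hn.iterateTl hm hs).isCons.congr fun i => by
    rw [iterate_tl_unary, isCons_unary]; congr 2; simp

theorem eq (hm : PT q e s x (fun i => unary (m i))) (hn : PT q e s x (fun i => unary (n i)))
    (hsm : Small s m) (hsn : Small s n) : PT q e s x (fun i => encBool (m i == n i)) :=
  ((hm.lt hn hsm).or (hn.lt hm hsn)).not.congr fun i => by
    congr 1
    rw [Bool.eq_iff_iff]
    simp
    omega

theorem range (hm : PT q e s x (fun i => unary (m i))) (hs : Small s m) :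
    PT q e s x (fun i => encL unary (List.range (m i))) := by
  have key : ∀ m : ℕ, (fun p : ℕ × List ℕ => (p.1 + 1, p.1 :: p.2))^[m] (0, []) =
      (m, (List.range m).reverse) := by
    intro m
    induction m with
    | zero => rfl
    | succ m ih => rw [Function.iterate_succ_apply', ih, List.range_succ]; simp
  refine (reverse (l := fun i => (List.range (m i)).reverse) (snd (y := fun i => unary (m i))
    ((iterate (es := fun _ => encP unary (encL unary)) (f := fun _ p => (p.1 + 1, p.1 :: p.2))
    (st := fun _ => (0, [])) hm (const (.cons .nil .nil)) hs
    fun _ _ h => ?_).congr fun i => by rw [key]; rfl)) ?_).congr fun i => by simp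
  · exact (h.fst.succ).cons (h.fst.cons h.snd)
  · simpa using hs.toW

theorem contains {l : I → List ℕ} (hl : PT q e s x (fun i => encL unary (l i)))
    (hm : PT q e s x (fun i => unary (m i))) (hlen : Small s (fun i => (l i).length))
    (hs : Small s m) (hs' : Small (fun j : MemIdx l => s j.i) (fun j => j.a)) :
    PT q e s x (fun i => encBool ((l i).contains (m i))) :=
  (any (p := fun i a => m i == a) hl hlen
    fun _ hx ha => (hm.via hx).eq ha (hs.comap _) hs').congr fun i => by
      congr 1
      rw [Bool.eq_iff_iff]
      simp

end Unary
end PT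

/-! ### Binary arithmetic. -/

/-- The number with the given binary digits, the most significant first. -/
def ofBits (l : List Bool) : ℕ := l.foldl (fun a b => Nat.bit b a) 0

theorem foldl_bit (l : List Bool) (a : ℕ) :
    l.foldl (fun a b => Nat.bit b a) a = 2 ^ l.length * a + ofBits l := by
  induction l generalizing a with
  | nil => simp [ofBits]
  | cons b l ih =>
    rw [ofBits, List.foldl_cons, List.foldl_cons, ih, ih (Nat.bit b 0), List.length_cons, pow_succ]
    cases b <;> simp [Nat.bit] <;> ring

theorem ofBits_cons (b : Bool) (l : List Bool) :
    ofBits (b :: l) = 2 ^ l.length * b.toNat + ofBits l := by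
  rw [ofBits, List.foldl_cons, foldl_bit]
  cases b <;> simp [Nat.bit]

theorem ofBits_concat (l : List Bool) (b : Bool) : ofBits (l ++ [b]) = Nat.bit b (ofBits l) := by
  simp [ofBits]

theorem ofBits_lt (l : List Bool) : ofBits l < 2 ^ l.length := by
  induction l with
  | nil => simp [ofBits]
  | cons b l ih =>
    rw [ofBits_cons, List.length_cons, pow_succ]
    cases b <;> simp <;> omega

theorem bits_bit (b : Bool) (a : ℕ) (h : b = true ∨ a ≠ 0) : (Nat.bit b a).bits = b :: a.bits :=
  Nat.bits_append_bit _ _ fun ha => h.resolve_right (by simpa using ha)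

theorem ofBits_bits_reverse (a : ℕ) : ofBits a.bits.reverse = a := by
  induction a using Nat.binaryRec' with
  | zero => rfl
  | bit b n h ih => rw [Nat.bits_append_bit _ _ h, List.reverse_cons, ofBits_concat, ih]

theorem encNat_eq (a : ℕ) : encNat a = encL encBool a.bits := rfl

theorem encNat_zero : encNat 0 = .nil := by simp [encNat_eq, encL, encList]

theorem encNat_bit (b : Bool) (a : ℕ) (h : b = true ∨ a ≠ 0) :
    encNat (Nat.bit b a) = .cons (encBool b) (encNat a) := by
  rw [encNat_eq, bits_bit b a h]; rfl

theorem isCons_encNat (a : ℕ) : (encNat a).isCons = decide (a ≠ 0) := by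
  induction a using Nat.binaryRec' with
  | zero => simp [encNat_zero, Data.isCons]
  | bit b n h ih =>
    have h' : b = true ∨ n ≠ 0 := by
      by_cases hn : n = 0
      · exact .inl (h hn)
      · exact .inr hn
    rw [encNat_bit b n h']
    rcases h' with rfl | h' <;> simp [Data.isCons]
    exact .inl h'

theorem tl_encNat (a : ℕ) : (encNat a).tl = encNat (a / 2) := by
  induction a using Nat.binaryRec' with
  | zero => simp [encNat_zero, Data.tl]
  | bit b n h ih =>
    have h' : b = true ∨ n ≠ 0 := by
      by_cases hn : n = 0
      · exact .inl (h hn)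
      · exact .inr hn
    rw [encNat_bit b n h', Nat.bit_div_two]; rfl

theorem hd_encNat (a : ℕ) : (encNat a).hd = encBool a.bodd := by
  induction a using Nat.binaryRec' with
  | zero => simp [encNat_zero, Data.hd, encBool]
  | bit b n h ih =>
    have h' : b = true ∨ n ≠ 0 := by
      by_cases hn : n = 0
      · exact .inl (h hn)
      · exact .inr hn
    rw [encNat_bit b n h', Nat.bodd_bit]; rfl

theorem size_add_le (a b : ℕ) : (a + b).size ≤ a.size + b.size + 1 := by
  rw [Nat.size_le, pow_succ]
  have h1 := Nat.lt_size_self a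
  have h2 := Nat.lt_size_self b
  have h3 : 2 ^ a.size ≤ 2 ^ (a.size + b.size) := Nat.pow_le_pow_right (by omega) (by omega)
  have h4 : 2 ^ b.size ≤ 2 ^ (a.size + b.size) := Nat.pow_le_pow_right (by omega) (by omega)
  omega

theorem size_mul_le (a b : ℕ) : (a * b).size ≤ a.size + b.size := by
  rw [Nat.size_le, pow_add]
  exact Nat.mul_lt_mul'' (Nat.lt_size_self a) (Nat.lt_size_self b)

theorem size_le_self (a : ℕ) : a.size ≤ a := Nat.size_le.2 Nat.lt_two_pow_self

/-- One step of binary addition: the remaining digits, the carry and the digits of the result. -/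
def addStep (t : ℕ × ℕ × Bool × List Bool) : ℕ × ℕ × Bool × List Bool :=
  let x := t.1.bodd
  let y := t.2.1.bodd
  let c := t.2.2.1
  (t.1 / 2, t.2.1 / 2, (x && y) || ((x || y) && c), ((x != y) != c) :: t.2.2.2)

/-- The invariant of addition with carry: the digits produced so far, together with the carry and
the remaining digits shifted by `k` places, still represent `a + b`. -/
theorem addStep_iterate (a b k : ℕ) :
    ∃ c l, addStep^[k] (a, b, false, []) = (a / 2 ^ k, b / 2 ^ k, c, l) ∧ l.length = k ∧
      ofBits l + 2 ^ k * (a / 2 ^ k + b / 2 ^ k + c.toNat) = a + b := by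
  induction k with
  | zero => exact ⟨false, [], by simp, rfl, by simp [ofBits]⟩
  | succ k ih =>
    obtain ⟨c, l, h, hl, hv⟩ := ih
    refine ⟨_, _, by
      rw [Function.iterate_succ_apply', h, addStep, Nat.div_div_eq_div_mul, Nat.div_div_eq_div_mul,
        ← pow_succ], by simp [hl], ?_⟩
    rw [ofBits_cons, hl, ← hv, pow_succ, ← Nat.div_div_eq_div_mul, ← Nat.div_div_eq_div_mul]
    generalize a / 2 ^ k = u
    generalize b / 2 ^ k = v
    have hu := Nat.bodd_add_div2 u
    have hv := Nat.bodd_add_div2 v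
    rw [Nat.div2_val] at hu hv
    conv_rhs => rw [← hu, ← hv]
    cases u.bodd <;> cases v.bodd <;> cases c <;> simp <;> ring

theorem addStep_final {a b k : ℕ} (h : a + b < 2 ^ k) :
    ofBits (addStep^[k] (a, b, false, [])).2.2.2 = a + b := by
  obtain ⟨c, l, h1, _, hv⟩ := addStep_iterate a b k
  rw [h1, ← hv]
  have : a / 2 ^ k + b / 2 ^ k + c.toNat = 0 := by
    by_contra h0
    have := Nat.le_mul_of_pos_right (2 ^ k) (Nat.pos_of_ne_zero h0)
    omega
  simp [this]

namespace PT

variable {q : ℕ} {I J : Type} {e s e1 e2 : I → ℕ} {x y z : I → Data} {a b : I → ℕ}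

theorem xor {a b : I → Bool} (ha : PT q e s x (fun i => encBool (a i)))
    (hb : PT q e s x (fun i => encBool (b i))) : PT q e s x (fun i => encBool (a i != b i)) :=
  ite ha hb.not hb (fun i hi => by simp [hi]) (fun i hi => by simp [hi])

/-- Numerals have no leading zeros, so a zero digit attached to the number zero has to give `nil`.
-/
theorem bit {b : I → Bool} (hb : PT q e s x (fun i => encBool (b i)))
    (ha : PT q e s x (fun i => encNat (a i))) :
    PT q e s x (fun i => encNat (Nat.bit (b i) (a i))) := by
  refine ite (hb.or ha.isCons) (hb.cons ha) (const .nil) (fun i hi => ?_) (fun i hi => ?_)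
  · rw [encNat_bit]
    simpa [isCons_encNat] using hi
  · simp only [isCons_encNat, Bool.or_eq_false_iff, decide_eq_false_iff_not, not_not] at hi
    rw [hi.1, hi.2]
    exact encNat_zero.symm

theorem ofBits {l : I → List Bool} (hl : PT q e s x (fun i => encL encBool (l i)))
    (hlen : Small s (fun i => (l i).length)) : PT q e s x (fun i => encNat (ofBits (l i))) :=
  foldLight (ea := fun _ => encBool) (es := fun _ => encNat) (f := fun _ a b => Nat.bit b a)
    (st := fun _ => 0) hl ((const .nil).congr fun _ => encNat_zero.symm) hlen
    fun _ _ hs ha => (ha.bit hs).up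

theorem natAdd (ha : PT q e s x (fun i => encNat (a i))) (hb : PT q e s x (fun i => encNat (b i)))
    (hsa : Small s (fun i => (a i).size)) (hsb : Small s (fun i => (b i).size)) :
    PT q e s x (fun i => encNat (a i + b i)) := by
  have hla : Small s (fun i => (a i).bits.length) := hsa.mono fun i => by rw [Nat.size_eq_bits_len]
  have hlb : Small s (fun i => (b i).bits.length) := hsb.mono fun i => by rw [Nat.size_eq_bits_len]
  -- With this many rounds `2 ^ k` exceeds `a + b`, so no digit and no carry remains. Leading zeros
  -- in the result are removed by `PT.ofBits`.
  have hk : Small s (fun i => (a i).bits.length + (b i).bits.length + 1) :=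
    (hla.add hlb).add (.const 1)
  have hit := iterate (es := fun _ => encP encNat (encP encNat (encP encBool (encL encBool))))
    (f := fun _ => addStep) (st := fun i => (a i, b i, false, []))
    (((length (ea := fun _ => encBool) ha hla).add (length (ea := fun _ => encBool) hb hlb) hlb).succ)
    (ha.cons (hb.cons (const (.cons .nil .nil)))) hk
    fun _ _ h => by
      have h := @h fun j => e j.i
      have hx : PT q _ _ _ (fun j => encBool _) := h.fst.hd.congr fun j => hd_encNat _
      have hy : PT q _ _ _ (fun j => encBool _) := h.snd.fst.hd.congr fun j => hd_encNat _
      have hc := h.snd.snd.fst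
      have h1 : PT q _ _ _ (fun j => encNat _) := h.fst.tl.congr fun j => tl_encNat _
      have h2 : PT q _ _ _ (fun j => encNat _) := h.snd.fst.tl.congr fun j => tl_encNat _
      exact h1.cons (h2.cons (((hx.and hy).or ((hx.or hy).and hc)).cons
        ((((hx.xor hy).xor hc)).cons h.snd.snd.snd)))
  refine (PT.ofBits hit.snd.snd.snd (hk.mono fun i => ?_)).congr fun i => ?_
  · obtain ⟨c, l, h1, hl, _⟩ := addStep_iterate (a i) (b i)
      ((a i).bits.length + (b i).bits.length + 1)
    rw [h1]
    exact hl.le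
  · congr 1
    refine addStep_final ?_
    rw [Nat.size_eq_bits_len, Nat.size_eq_bits_len, ← Nat.size_le]
    exact size_add_le _ _

/-- Horner's scheme over the digits of `a`, the most significant first. Every intermediate value is
`b` times a number with no more digits than `a`. -/
theorem natMul (ha : PT q e s x (fun i => encNat (a i))) (hb : PT q e s x (fun i => encNat (b i)))
    (hsa : Small s (fun i => (a i).size)) (hsb : Small s (fun i => (b i).size)) :
    PT q e s x (fun i => encNat (a i * b i)) := by
  have hla : Small s (fun i => (a i).bits.length) := hsa.mono fun i => by rw [Nat.size_eq_bits_len]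
  have key : ∀ (b : ℕ) (l : List Bool) , l.foldl
      (fun acc c => Nat.bit false acc + if c then b else 0) 0 = HomPoly.ofBits l * b := by
    intro b l
    induction l using List.reverseRecOn with
    | nil => simp [HomPoly.ofBits]
    | append_singleton l c ih =>
      rw [List.foldl_append, ih, ofBits_concat]
      cases c <;> simp [Nat.bit] <;> ring
  refine (foldLight (ea := fun _ => encBool) (es := fun _ => encNat)
    (f := fun i acc c => Nat.bit false acc + if c then b i else 0) (st := fun _ => 0)
    (reverse (ea := fun _ => encBool) ha hla.toW) ((const .nil).congr fun _ => encNat_zero.symm)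
    (by simpa using hla) fun x' hx hs hc => ?_).congr fun i => by rw [key, ofBits_bits_reverse]
  have hsz : Small (fun j : FoldIdx fun i => (a i).bits.reverse => s j.i)
      (fun j => (j.pre.foldl (fun acc c => Nat.bit false acc + if c then b j.i else 0) 0).size) := by
    refine ((hla.add hsb).comap fun j : FoldIdx fun i => (a i).bits.reverse => j.i).mono fun j => ?_
    rw [key]
    refine (size_mul_le _ _).trans (Nat.add_le_add_right ?_ _)
    rw [Nat.size_le]
    refine (ofBits_lt _).trans_le (Nat.pow_le_pow_right (by omega) ?_)
    simpa using j.pre_prefix.length_le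
  have hsb' := hsb.comap fun j : FoldIdx fun i => (a i).bits.reverse => j.i
  refine natAdd ((const (encBool false)).bit hs) (ite hc (hb.via hx) (const .nil)
    (fun j hj => by simp [hj]) (fun j hj => by simp [hj, encNat_zero])) ?_ ?_
  · refine (hsz.add (.const 1)).mono fun j => ?_
    generalize j.pre.foldl (fun acc c => Nat.bit false acc + if c then b j.i else 0) 0 = m
    have := Nat.lt_size_self m
    rw [Nat.size_le, pow_succ, Nat.bit_false]
    dsimp only
    omega
  · refine hsb'.mono fun j => ?_
    split
    · exact le_rfl
    · simp

theorem natProd {l : I → List ℕ} (hl : PT q e s x (fun i => encL encNat (l i)))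
    (hlen : Small s (fun i => (l i).length))
    (hs : Small (fun j : MemIdx l => s j.i) (fun j => j.a.size)) :
    PT q e s x (fun i => encNat (l i).prod) := by
  obtain ⟨c, hc⟩ := hs
  have hpow : Small s (fun i => (s i + 2) ^ c) := (Small.self.add (.const 2)).pow c
  have key : ∀ (M : ℕ) (l : List ℕ), (∀ a ∈ l, a.size ≤ M) → l.prod.size ≤ l.length * M + 1 := by
    intro M l h
    induction l with
    | nil => simp
    | cons a l ih =>
      have h1 := ih fun b hb => h b (by simp [hb])
      have h2 := h a (by simp)
      have := size_mul_le a l.prod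
      simp only [List.prod_cons, List.length_cons, Nat.add_mul]
      omega
  refine (foldLight (es := fun _ => encNat) (f := fun _ a b => a * b) (st := fun _ => 1) hl
    (const (encNat 1)) hlen fun x' _ hp ha => natMul hp.up ha.up ?_ ⟨c, fun j => hc ⟨j.i, j.a, j.mem⟩⟩).congr
    fun i => by rw [List.prod_eq_foldl]
  refine (((hlen.mul hpow).add (.const 1)).comap fun j : FoldIdx l => j.i).mono fun j => ?_
  rw [← List.prod_eq_foldl]
  refine (key ((s j.i + 2) ^ c) j.pre fun a ha => hc ⟨j.i, a, j.pre_prefix.subset ha⟩).trans ?_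
  exact Nat.add_le_add_right (Nat.mul_le_mul_right _ j.pre_prefix.length_le) _

/-- There may be exponentially many summands. Partial sums and summands are bounded by the total, so
a bound on the size of the total makes every single addition cheap. -/
theorem natSum {l : I → List ℕ} (hl : PT q e s x (fun i => encL encNat (l i)))
    (hlen : SmallW q e s (fun i => (l i).length)) (hs : Small s (fun i => (l i).sum.size)) :
    PT q e s x (fun i => encNat (l i).sum) := by
  refine (fold (e1 := e) (e2 := fun _ => 0) (es := fun _ => encNat) (f := fun _ a b => a + b)
    (st := fun _ => 0) (fun i => by simp) hl ((const .nil).congr fun _ => encNat_zero.symm) hlen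
    fun x' _ hp ha => natAdd hp ha ?_ ?_).congr fun i => by rw [List.sum_eq_foldl]
  · refine (hs.comap fun j : FoldIdx l => j.i).mono fun j => Nat.size_le_size ?_
    rw [← List.sum_eq_foldl]
    exact j.pre_prefix.sublist.sum_le_sum fun _ _ => Nat.zero_le _
  · exact (hs.comap fun j : FoldIdx l => j.i).mono fun j =>
      Nat.size_le_size (List.single_le_sum (fun _ _ => Nat.zero_le _) _ j.mem)

/-- Conversion from unary to binary. -/
theorem toBin (ha : PT q e s x (fun i => unary (a i))) (hs : Small s a) :
    PT q e s x (fun i => encNat (a i)) := by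
  refine (iterate (es := fun _ => encNat) (f := fun _ m => m + 1) (st := fun _ => 0) ha
    ((const .nil).congr fun _ => encNat_zero.symm) hs fun _ _ h =>
    natAdd h (const (encNat 1)) ?_ (.const (Nat.size 1))).congr fun i => by
      rw [Nat.succ_iterate, zero_add]
  refine (hs.comap fun j : NatIdx a => j.i).mono fun j => ?_
  rw [Nat.succ_iterate, zero_add]
  exact (size_le_self _).trans j.h.le

theorem twoPow (ha : PT q e s x (fun i => unary (a i))) (hs : Small s a) :
    PT q e s x (fun i => encNat (2 ^ a i)) :=
  (iterate (es := fun _ => encNat) (f := fun _ m => Nat.bit false m) (st := fun _ => 1) ha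
    (const (encNat 1)) hs fun _ _ h => (const (encBool false)).bit h).congr fun i => by
      congr 1
      generalize a i = m
      induction m with
      | zero => rfl
      | succ m ih => rw [Function.iterate_succ_apply', ih, Nat.bit_false, pow_succ, mul_comm]

/-- Splitting off the `b` lowest digits. -/
theorem divMod (ha : PT q e s x (fun i => encNat (a i))) (hb : PT q e s x (fun i => unary (b i)))
    (hs : Small s b) :
    PT q e s x (fun i => .cons (encNat (a i / 2 ^ b i)) (encNat (a i % 2 ^ b i))) := by
  have key : ∀ a k : ℕ, ∃ l, (fun t : ℕ × List Bool => (t.1 / 2, t.1.bodd :: t.2))^[k] (a, []) =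
      (a / 2 ^ k, l) ∧ l.length = k ∧ HomPoly.ofBits l = a % 2 ^ k := by
    intro a k
    induction k with
    | zero => exact ⟨[], by simp, rfl, by simp [HomPoly.ofBits, Nat.mod_one]⟩
    | succ k ih =>
      obtain ⟨l, h1, h2, h3⟩ := ih
      refine ⟨_, by rw [Function.iterate_succ_apply', h1, Nat.div_div_eq_div_mul, ← pow_succ],
        by simp [h2], ?_⟩
      rw [ofBits_cons, h2, h3, Nat.mod_pow_succ, Nat.mod_two_of_bodd, add_comm]
  have hit := iterate (es := fun _ => encP encNat (encL encBool))
    (f := fun _ t => (t.1 / 2, t.1.bodd :: t.2)) (st := fun i => (a i, [])) hb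
    (ha.cons (const .nil)) hs fun _ _ h =>
      (h.fst.tl.congr fun j => tl_encNat _).cons ((h.fst.hd.congr fun j => hd_encNat _).cons h.snd)
  refine PT.congr (hit.fst.cons (PT.ofBits hit.snd (hs.mono fun i => ?_))) fun i => ?_
  all_goals
    obtain ⟨l, h1, h2, h3⟩ := key (a i) (b i)
    simp only [h1, h2, h3, le_refl]

end PT

/-! ### Partition functions of networks -/

/-- The sum of `F` over all colourings that arise from `φ` by recolouring the vertices in the
list. -/
def sumOver (q : ℕ) : List ℕ → ((ℕ → ℕ) → ℕ) → (ℕ → ℕ) → ℕ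
  | [], F, φ => F φ
  | a :: A, F, φ => ((List.range (q + 1)).map fun c => sumOver q A F (Function.update φ a c)).sum

section sumOver

variable {q : ℕ} {A B : List ℕ} {F G : (ℕ → ℕ) → ℕ} {φ ψ : ℕ → ℕ}

theorem sumOver_append : sumOver q (A ++ B) F φ = sumOver q A (sumOver q B F) φ := by
  induction A generalizing φ with
  | nil => rfl
  | cons a A ih => simp only [List.cons_append, sumOver, ih]

theorem list_sum_comm {α β : Type} (l : List α) (m : List β) (f : α → β → ℕ) :
    (l.map fun a => (m.map fun b => f a b).sum).sum =
      (m.map fun b => (l.map fun a => f a b).sum).sum := by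
  induction l with
  | nil => simp
  | cons a l ih => simp [ih, List.sum_map_add]

theorem sumOver_perm (h : A.Perm B) : sumOver q A F φ = sumOver q B F φ := by
  induction h generalizing φ with
  | nil => rfl
  | cons a _ ih => simp only [sumOver, ih]
  | swap a b l =>
    by_cases hab : a = b
    · rw [hab]
    · simp only [sumOver]
      rw [list_sum_comm]
      simp only [Function.update_comm hab]
  | trans _ _ ih1 ih2 => rw [ih1, ih2]

/-- `P` marks the vertices on which the summand depends. Those in `A` are recoloured anyway. -/
theorem sumOver_congr (P : ℕ → Prop) (hF : ∀ χ χ', (∀ v, P v → χ v = χ' v) → F χ = G χ')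
    (h : ∀ v, P v → v ∉ A → φ v = ψ v) : sumOver q A F φ = sumOver q A G ψ := by
  induction A generalizing φ ψ with
  | nil => exact hF _ _ fun v hv => h v hv (by simp)
  | cons a A ih =>
    simp only [sumOver]
    congr 1
    refine List.map_congr_left fun c _ => ih fun v hv hA => ?_
    by_cases hva : v = a
    · simp [hva]
    · simpa [Function.update_of_ne hva] using h v hv (by simp [hva, hA])

theorem sumOver_mul_left (hF : ∀ χ, (∀ v, v ∉ A → χ v = φ v) → F χ = F φ) :
    sumOver q A (fun χ => F χ * G χ) φ = F φ * sumOver q A G φ := by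
  -- The induction runs over a part `A'` of `A`, while `A` stays fixed in the condition on `F`: the
  -- recolourings made on the way change `ψ` only inside `A`.
  have key : ∀ (A' : List ℕ) (ψ : ℕ → ℕ), (∀ v, v ∉ A' → (v ∉ A → ψ v = φ v)) → A' ⊆ A →
      sumOver q A' (fun χ => F χ * G χ) ψ = F φ * sumOver q A' G ψ := by
    intro A'
    induction A' with
    | nil =>
      intro ψ h _
      simp only [sumOver]
      rw [hF ψ fun v => h v (by simp)]
    | cons a A' ih =>
      intro ψ h hs
      simp only [sumOver]
      rw [← List.sum_map_mul_left]
      congr 1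
      refine List.map_congr_left fun c _ => ih _ (fun v hv hvA => ?_) fun v hv => hs (by simp [hv])
      have hva : v ≠ a := by
        rintro rfl
        exact hvA (hs (by simp))
      rw [Function.update_of_ne hva]
      exact h v (by simp [hva, hv]) hvA
  exact key A φ (fun _ _ _ => rfl) fun _ h => h

theorem sumOver_le {m : ℕ} (hF : ∀ χ, F χ ≤ m) : sumOver q A F φ ≤ (q + 1) ^ A.length * m := by
  induction A generalizing φ with
  | nil => simpa [sumOver] using hF φ
  | cons a A ih =>
    simp only [sumOver]
    refine (List.sum_le_card_nsmul _ ((q + 1) ^ A.length * m) ?_).trans ?_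
    · simp only [List.mem_map]
      rintro _ ⟨c, _, rfl⟩
      exact ih
    · simp [pow_succ]
      exact le_of_eq (by ring)

end sumOver

/-- A graph with vertices `0, …, n - 1`, given by the list of its edges, and the weights of the
colours and of the pairs of colours. -/
structure Net where
  n : ℕ
  E : List (ℕ × ℕ)
  X : List ℕ
  Y : List (List ℕ)

/-- Whether a pair has an element in a list. -/
def touches (C : List ℕ) (e : ℕ × ℕ) : Bool := C.contains e.1 || C.contains e.2

namespace Net

variable {q : ℕ} (T : Net)

def wX (ψ : ℕ → ℕ) (v : ℕ) : ℕ := T.X.getD (ψ v) 0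

def wY (ψ : ℕ → ℕ) (e : ℕ × ℕ) : ℕ := (T.Y.getD (ψ e.1) []).getD (ψ e.2) 0

/-- The weight of all vertices in `C` and all edges touching `C`. -/
def wt (C : List ℕ) (ψ : ℕ → ℕ) : ℕ :=
  (C.map (T.wX ψ)).prod * ((T.E.filter (touches C)).map (T.wY ψ)).prod

/-- The sum of the weights of all colourings of `C` that extend `φ`. -/
def val (q : ℕ) (C : List ℕ) (φ : ℕ → ℕ) : ℕ := sumOver q C (T.wt C) φ

/-- The weight of all vertices in `A` and all edges touching `A` and not `R`. -/
def wtOff (A R : List ℕ) (ψ : ℕ → ℕ) : ℕ :=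
  (A.map (T.wX ψ)).prod *
    ((T.E.filter fun e => touches A e && !touches R e).map (T.wY ψ)).prod

variable {T} {A B C R : List ℕ} {φ ψ : ℕ → ℕ}

theorem touches_perm (h : A.Perm B) : touches A = touches B := by
  funext e
  simp [touches, h.mem_iff]

theorem wt_perm (h : A.Perm B) : T.wt A = T.wt B := by
  funext ψ
  rw [wt, wt, touches_perm h, (h.map _).prod_eq]

theorem val_perm (h : A.Perm B) : T.val q A φ = T.val q B φ := by
  rw [val, val, wt_perm h, sumOver_perm h]

theorem wX_congr {v : ℕ} (h : φ v = ψ v) : T.wX φ v = T.wX ψ v := by rw [wX, wX, h]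

theorem wY_congr {e : ℕ × ℕ} (h1 : φ e.1 = ψ e.1) (h2 : φ e.2 = ψ e.2) :
    T.wY φ e = T.wY ψ e := by rw [wY, wY, h1, h2]

theorem prod_filter_split {α : Type} (l : List α) (p r : α → Bool) (f : α → ℕ) :
    ((l.filter fun a => p a || r a).map f).prod =
      ((l.filter fun a => p a && !r a).map f).prod * ((l.filter r).map f).prod := by
  induction l with
  | nil => simp
  | cons a l ih =>
    cases hp : p a <;> cases hr : r a <;> simp [hp, hr, ih] <;> ring

/-- Edges that touch both lists are counted with `R`. -/
theorem wt_append : T.wt (A ++ R) ψ = T.wtOff A R ψ * T.wt R ψ := by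
  have h : touches (A ++ R) = fun e => touches A e || touches R e := by
    funext e
    rw [Bool.eq_iff_iff]
    simp [touches]
    tauto
  rw [wt, wtOff, wt, h, prod_filter_split, List.map_append, List.prod_append]
  ring

theorem wt_congr (h : ∀ v, v ∈ C ∨ (∃ e ∈ T.E, touches C e ∧ (v = e.1 ∨ v = e.2)) → φ v = ψ v) :
    T.wt C φ = T.wt C ψ := by
  rw [wt, wt]
  congr 2
  · exact List.map_congr_left fun v hv => wX_congr (h v (.inl hv))
  · refine List.map_congr_left fun e he => ?_
    obtain ⟨h1, h2⟩ := List.mem_filter.1 he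
    exact wY_congr (h _ (.inr ⟨e, h1, h2, .inl rfl⟩)) (h _ (.inr ⟨e, h1, h2, .inr rfl⟩))

/-- `val C φ` depends only on the colours of the neighbours of `C`. -/
theorem val_congr (h : ∀ e ∈ T.E, touches C e → ∀ v, v ∉ C → (v = e.1 ∨ v = e.2) → φ v = ψ v) :
    T.val q C φ = T.val q C ψ :=
  sumOver_congr (fun v => v ∈ C ∨ (∃ e ∈ T.E, touches C e ∧ (v = e.1 ∨ v = e.2)))
    (fun _ _ h => wt_congr h) fun v hv hvC => by
      obtain hv | ⟨e, he, het, hv⟩ := hv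
      · exact absurd hv hvC
      · exact h e he het v hvC hv

/-- The factor `wtOff A R` involves no vertex of `R`, so it can be taken out of the sum over the
colourings of `R`. -/
theorem val_append (hA : ∀ v ∈ A, v ∉ R) :
    T.val q (A ++ R) φ = sumOver q A (fun ψ => T.wtOff A R ψ * T.val q R ψ) φ := by
  rw [val, sumOver_append]
  congr 1
  funext ψ
  rw [funext fun χ => wt_append (T := T) (A := A) (R := R) (ψ := χ)]
  refine sumOver_mul_left fun χ hχ => ?_
  rw [wtOff, wtOff]
  congr 2
  · exact List.map_congr_left fun v hv => wX_congr (hχ v (hA v hv))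
  · refine List.map_congr_left fun e he => ?_
    have h2 := (List.mem_filter.1 he).2
    simp only [touches, Bool.and_eq_true, Bool.not_eq_true', Bool.or_eq_false_iff] at h2
    exact wY_congr (hχ _ (by simpa using h2.2.1)) (hχ _ (by simpa using h2.2.2))

/-- Splitting off the vertices in `B`. -/
theorem val_split (B : List ℕ) : T.val q C φ = sumOver q (C.filter fun v => B.contains v)
    (fun ψ => T.wtOff (C.filter fun v => B.contains v) (C.filter fun v => !B.contains v) ψ *
      T.val q (C.filter fun v => !B.contains v) ψ) φ := by
  rw [← val_append fun v hv => by
    have := (List.mem_filter.1 hv).2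
    simp only [List.mem_filter, not_and]
    intro _
    simpa using this]
  exact val_perm (List.filter_append_perm _ _).symm

/-- Without edges between the two sets, `val R` does not depend on the colours of `A` and is a
constant factor in the sum over the colourings of `A`. -/
theorem val_mul (hA : ∀ v ∈ A, v ∉ R) (h : ∀ e ∈ T.E, touches A e → touches R e → False) :
    T.val q (A ++ R) φ = T.val q A φ * T.val q R φ := by
  have hoff : T.wtOff A R = T.wt A := by
    funext ψ
    rw [wtOff, wt]
    congr 3
    refine List.filter_congr fun e he => ?_
    cases h1 : touches A e with
    | false => simp
    | true =>
      cases h2 : touches R e with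
      | false => simp
      | true => exact (h e he h1 h2).elim
  have hR : ∀ χ, (∀ v, v ∉ A → χ v = φ v) → T.val q R χ = T.val q R φ := fun χ hχ =>
    val_congr fun e he het v _ hv => hχ v fun hvA => h e he (by
      rcases hv with rfl | rfl <;> simp [touches, hvA]) het
  rw [val_append hA, hoff, mul_comm (T.val q A φ)]
  simp only [mul_comm (T.wt A _)]
  exact sumOver_mul_left hR

/-- Multiplicativity over the parts of a partition without edges between different parts. -/
theorem val_flatten {K : List (List ℕ)} (hK : K.flatten.Nodup)
    (h : ∀ e ∈ T.E, ∀ C ∈ K, ∀ D ∈ K, touches C e → touches D e → C = D) :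
    T.val q K.flatten φ = (K.map fun C => T.val q C φ).prod := by
  induction K with
  | nil =>
    have : touches [] = fun _ => false := by funext e; simp [touches]
    simp [val, wt, sumOver, this]
  | cons C K ih =>
    rw [List.flatten_cons, List.nodup_append] at hK
    have hdis : ∀ v ∈ C, v ∉ K.flatten := fun v hv hv' => hK.2.2 v hv v hv' rfl
    rw [List.flatten_cons, val_mul hdis, ih hK.2.1, List.map_cons, List.prod_cons]
    · exact fun e he D hD D' hD' => h e he D (by simp [hD]) D' (by simp [hD'])
    · intro e he h1 h2
      obtain ⟨D, hD, h3⟩ : ∃ D ∈ K, touches D e := by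
        simp only [touches, Bool.or_eq_true, List.contains_iff_mem, List.mem_flatten] at h2 ⊢
        rcases h2 with ⟨D, hD, h⟩ | ⟨D, hD, h⟩
        · exact ⟨D, hD, .inl h⟩
        · exact ⟨D, hD, .inr h⟩
      -- Then `C` would occur again among the later parts, and the end of the edge that lies in `C`
      -- would be repeated in the flattened list.
      have hCD := h e he C (by simp) D (by simp [hD]) h1 h3
      subst hCD
      simp only [touches, Bool.or_eq_true, List.contains_iff_mem] at h1
      rcases h1 with h1 | h1
      · exact hdis _ h1 (List.mem_flatten.2 ⟨C, hD, h1⟩)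
      · exact hdis _ h1 (List.mem_flatten.2 ⟨C, hD, h1⟩)

end Net

/-! ### Components -/

namespace Net

variable {q : ℕ} (T : Net)

def adj (u v : ℕ) : Bool := T.E.any fun e => (e.1 == u && e.2 == v) || (e.1 == v && e.2 == u)

/-- The vertices that do not belong to a list. -/
def off (S : List ℕ) : List ℕ := (List.range T.n).filter fun v => !S.contains v

/-- Add the neighbours of `S` in `R`. -/
def reachStep (R S : List ℕ) : List ℕ :=
  (List.range T.n).filter fun v => R.contains v && (S.contains v || S.any fun u => T.adj u v)

/-- The connected component of `u` in the subgraph induced on `R`. -/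
def reach (R : List ℕ) (u : ℕ) : List ℕ := (T.reachStep R)^[T.n] [u]

/-- The connected components of the subgraph induced on `R`. -/
def comps (R : List ℕ) : List (List ℕ) :=
  (List.range T.n).foldl (fun K u =>
    if R.contains u && !(K.any fun C => C.contains u) then T.reach R u :: K else K) []

variable {T} {R S C : List ℕ} {u v w : ℕ}

theorem adj_iff : T.adj u v = true ↔ (u, v) ∈ T.E ∨ (v, u) ∈ T.E := by
  simp only [adj, List.any_eq_true, Bool.or_eq_true, Bool.and_eq_true, beq_iff_eq]
  constructor
  · rintro ⟨⟨a, b⟩, h, ⟨rfl, rfl⟩ | ⟨rfl, rfl⟩⟩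
    · exact .inl h
    · exact .inr h
  · rintro (h | h)
    · exact ⟨_, h, .inl ⟨rfl, rfl⟩⟩
    · exact ⟨_, h, .inr ⟨rfl, rfl⟩⟩

theorem adj_comm : T.adj u v = T.adj v u := by
  rw [Bool.eq_iff_iff, adj_iff, adj_iff, or_comm]

/-- Paths in the subgraph induced on `R`. -/
def Conn (T : Net) (R : List ℕ) : ℕ → ℕ → Prop :=
  Relation.ReflTransGen fun a b => T.adj a b = true ∧ b ∈ R

theorem mem_reachStep : v ∈ T.reachStep R S ↔
    v < T.n ∧ v ∈ R ∧ (v ∈ S ∨ ∃ u ∈ S, T.adj u v = true) := by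
  simp [reachStep]

theorem nodup_reachStep : (T.reachStep R S).Nodup := List.nodup_range.filter _

theorem iterate_reachStep_subset (hu : u < T.n) (huR : u ∈ R) (k : ℕ) :
    (T.reachStep R)^[k] [u] ⊆ (T.reachStep R)^[k + 1] [u] := by
  rw [Function.iterate_succ_apply']
  have : ∀ v ∈ (T.reachStep R)^[k] [u], v < T.n ∧ v ∈ R := by
    cases k with
    | zero => simp [hu, huR]
    | succ k =>
      intro v hv
      rw [Function.iterate_succ_apply', mem_reachStep] at hv
      exact ⟨hv.1, hv.2.1⟩
  intro v hv
  exact mem_reachStep.2 ⟨(this v hv).1, (this v hv).2, .inl hv⟩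

theorem nodup_iterate_reachStep (k : ℕ) : ((T.reachStep R)^[k] [u]).Nodup := by
  cases k with
  | zero => simp
  | succ k =>
    rw [Function.iterate_succ_apply']
    exact nodup_reachStep

theorem reachStep_congr {S' : List ℕ} (h : ∀ v, v ∈ S ↔ v ∈ S') :
    T.reachStep R S = T.reachStep R S' := by
  refine List.filter_congr fun v _ => ?_
  rw [Bool.eq_iff_iff]
  simp [h]

/-- Every round that changes the set adds an element, and after a round without change the set stays
the same. As there are only `n` vertices, `n` rounds suffice. -/
theorem iterate_reachStep_stable (hu : u < T.n) (huR : u ∈ R) (k : ℕ) :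
    (∀ v, v ∈ (T.reachStep R)^[k + 1] [u] → v ∈ (T.reachStep R)^[k] [u]) ∨
      k + 1 ≤ ((T.reachStep R)^[k] [u]).length := by
  induction k with
  | zero => exact .inr (by simp)
  | succ k ih =>
    by_cases hst : ∀ v, v ∈ (T.reachStep R)^[k + 1] [u] → v ∈ (T.reachStep R)^[k] [u]
    · left
      intro v hv
      rw [Function.iterate_succ_apply', reachStep_congr fun v =>
        ⟨fun h => hst v h, fun h => iterate_reachStep_subset hu huR k h⟩,
        ← Function.iterate_succ_apply' (T.reachStep R)] at hv
      exact hv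
    · right
      have hk := ih.resolve_left hst
      push Not at hst
      obtain ⟨v, hv, hv'⟩ := hst
      have := (List.subperm_of_subset (l₁ := v :: (T.reachStep R)^[k] [u])
        (List.nodup_cons.2 ⟨hv', nodup_iterate_reachStep k⟩) (l₂ := (T.reachStep R)^[k + 1] [u])
        (List.cons_subset.2 ⟨hv, iterate_reachStep_subset hu huR k⟩)).length_le
      simp only [List.length_cons] at this
      omega

theorem mem_reach (hu : u < T.n) (huR : u ∈ R) (hR : ∀ v ∈ R, v < T.n) :
    v ∈ T.reach R u ↔ T.Conn R u v := by
  constructor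
  · have : ∀ k, v ∈ (T.reachStep R)^[k] [u] → T.Conn R u v := by
      intro k
      induction k generalizing v with
      | zero =>
        intro h
        rw [Function.iterate_zero, id, List.mem_singleton] at h
        exact h ▸ .refl
      | succ k ih =>
        rw [Function.iterate_succ_apply', mem_reachStep]
        rintro ⟨_, hv, h | ⟨w, hw, h⟩⟩
        · exact ih h
        · exact (ih hw).tail ⟨h, hv⟩
    exact this _
  · have hst : ∀ v, v ∈ (T.reachStep R)^[T.n + 1] [u] → v ∈ T.reach R u := by
      refine (iterate_reachStep_stable hu huR T.n).resolve_right fun h => ?_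
      have := (List.subperm_of_subset (nodup_iterate_reachStep (T := T) (R := R) (u := u) T.n)
        (l₂ := List.range T.n) fun v hv => ?_).length_le
      · rw [List.length_range] at this
        omega
      · have h := iterate_reachStep_subset hu huR _ hv
        rw [Function.iterate_succ_apply', mem_reachStep] at h
        exact List.mem_range.2 h.1
    have hmem : ∀ k, u ∈ (T.reachStep R)^[k] [u] := by
      intro k
      induction k with
      | zero => simp
      | succ k ih => exact iterate_reachStep_subset hu huR k ih
    intro h
    induction h with
    | refl => exact hmem _
    | tail _ h ih =>
      refine hst _ ?_
      rw [Function.iterate_succ_apply', mem_reachStep]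
      exact ⟨hR _ h.2, h.2, .inr ⟨_, ih, h.1⟩⟩

/-- Solved sets are compared as lists, so equality of the lists is required. After at least one
round the list is a filter of `List.range` and hence determined by its elements; there is a round
because the vertex `u` makes `T.n` positive. -/
theorem reach_congr {R' : List ℕ} (huR : u ∈ R) (hwR' : w ∈ R')
    (hR : ∀ v ∈ R, v < T.n) (hR' : ∀ v ∈ R', v < T.n)
    (h : ∀ v, T.Conn R u v ↔ T.Conn R' w v) : T.reach R u = T.reach R' w := by
  have hm : ∀ v, v ∈ T.reach R u ↔ v ∈ T.reach R' w := fun v => by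
    rw [mem_reach (hR u huR) huR hR, mem_reach (hR' w hwR') hwR' hR', h]
  have key : ∀ R u, ∃ p : ℕ → Bool, T.reach R u = (List.range T.n).filter p := by
    intro R u
    have := hR _ huR
    obtain ⟨k, hk⟩ : ∃ k, T.n = k + 1 := ⟨T.n - 1, by omega⟩
    rw [reach]
    generalize hm : T.n = m at hk
    rw [hk, Function.iterate_succ_apply', ← hk, ← hm]
    exact ⟨_, rfl⟩
  obtain ⟨p, hp⟩ := key R u
  obtain ⟨p', hp'⟩ := key R' w
  rw [hp, hp'] at hm ⊢
  refine List.filter_congr fun v hv => ?_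
  have := hm v
  rw [Bool.eq_iff_iff]
  simpa [List.mem_range.1 hv] using this

theorem nodup_reach : (T.reach R u).Nodup := nodup_iterate_reachStep _

theorem Conn.mem (h : T.Conn R u v) (hu : u ∈ R) : v ∈ R := by
  cases h with
  | refl => exact hu
  | tail _ h => exact h.2

theorem Conn.symm (h : T.Conn R u v) (hu : u ∈ R) : T.Conn R v u := by
  induction h with
  | refl => exact .refl
  | tail h1 h2 ih => exact .head ⟨by rw [adj_comm]; exact h2.1, Conn.mem h1 hu⟩ ih

theorem reach_subset (hu : u < T.n) (huR : u ∈ R) (hR : ∀ v ∈ R, v < T.n) : T.reach R u ⊆ R :=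
  fun _ hv => ((mem_reach hu huR hR).1 hv).mem huR

/-- The invariant of the computation of the components. -/
theorem comps_aux (hR : ∀ v ∈ R, v < T.n) (m : ℕ) (hm : m ≤ T.n) :
    let K := (List.range m).foldl (fun K u =>
      if R.contains u && !(K.any fun C => C.contains u) then T.reach R u :: K else K) []
    (∀ C ∈ K, ∃ u ∈ R, C = T.reach R u) ∧ (∀ u ∈ R, u < m → u ∈ K.flatten) ∧ K.flatten.Nodup := by
  induction m with
  | zero => simp
  | succ m ih =>
    obtain ⟨h1, h2, h3⟩ := ih (by omega)
    simp only [List.range_succ, List.foldl_append, List.foldl_cons, List.foldl_nil]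
    set K := (List.range m).foldl (fun K u =>
      if R.contains u && !(K.any fun C => C.contains u) then T.reach R u :: K else K) []
    split
    · rename_i h
      simp only [Bool.and_eq_true, List.contains_iff_mem, Bool.not_eq_true',
        List.any_eq_false] at h
      refine ⟨?_, ?_, ?_⟩
      · intro C hC
        rcases List.mem_cons.1 hC with rfl | hC
        · exact ⟨m, h.1, rfl⟩
        · exact h1 C hC
      · intro u hu hum
        rw [List.flatten_cons, List.mem_append]
        rcases Nat.lt_succ_iff_lt_or_eq.1 hum with h' | rfl
        · exact .inr (h2 u hu h')
        · exact .inl ((mem_reach (hR _ hu) hu hR).2 .refl)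
      · rw [List.flatten_cons, List.nodup_append]
        refine ⟨nodup_reach, h3, fun a ha b hb hab => ?_⟩
        subst hab
        -- A vertex shared with an earlier component would put `m` into that component.
        obtain ⟨C, hC, haC⟩ := List.mem_flatten.1 hb
        obtain ⟨u, hu, rfl⟩ := h1 C hC
        have ha := (mem_reach (hR _ h.1) h.1 hR).1 ha
        have haC := (mem_reach (hR _ hu) hu hR).1 haC
        exact h.2 _ hC ((mem_reach (hR _ hu) hu hR).2 (haC.trans (ha.symm h.1)))
    · rename_i h
      refine ⟨h1, fun u hu hum => ?_, h3⟩
      rcases Nat.lt_succ_iff_lt_or_eq.1 hum with h' | rfl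
      · exact h2 u hu h'
      · have : u ∈ R → ∃ C ∈ K, u ∈ C := by simpa using h
        exact List.mem_flatten.2 (this hu)

theorem mem_comps (hR : ∀ v ∈ R, v < T.n) (hC : C ∈ T.comps R) : ∃ u ∈ R, C = T.reach R u :=
  (comps_aux hR T.n le_rfl).1 C hC

theorem nodup_flatten_comps (hR : ∀ v ∈ R, v < T.n) : (T.comps R).flatten.Nodup :=
  (comps_aux hR T.n le_rfl).2.2

theorem flatten_comps_perm (hR : ∀ v ∈ R, v < T.n) (hn : R.Nodup) :
    (T.comps R).flatten.Perm R := by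
  refine (List.perm_ext_iff_of_nodup (nodup_flatten_comps hR) hn).2 fun v => ⟨fun h => ?_, fun h =>
    (comps_aux hR T.n le_rfl).2.1 v h (hR v h)⟩
  obtain ⟨C, hC, hv⟩ := List.mem_flatten.1 h
  obtain ⟨u, hu, rfl⟩ := mem_comps hR hC
  exact reach_subset (hR u hu) hu hR hv

/-- The partition function factors over components. -/
theorem val_comps (hR : ∀ v ∈ R, v < T.n) (hn : R.Nodup) (φ : ℕ → ℕ) :
    T.val q R φ = ((T.comps R).map fun C => T.val q C φ).prod := by
  rw [← val_perm (flatten_comps_perm hR hn)]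
  refine val_flatten (nodup_flatten_comps hR) fun e he C hC D hD h1 h2 => ?_
  obtain ⟨u, hu, rfl⟩ := mem_comps hR hC
  obtain ⟨w, hw, rfl⟩ := mem_comps hR hD
  have hnd := nodup_flatten_comps (T := T) hR
  have hadj : T.adj e.1 e.2 = true := adj_iff.2 (.inl he)
  simp only [touches, Bool.or_eq_true, List.contains_iff_mem, mem_reach (hR _ hu) hu hR,
    mem_reach (hR _ hw) hw hR] at h1 h2
  -- An edge touching both components joins `u` to `w`; the cases say which end lies in which
  -- component.
  have huw : T.Conn R u w := by
    have hs : ∀ {a}, T.Conn R w a → T.Conn R a w := fun h => h.symm hw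
    have ha : ∀ {a b}, T.Conn R w b → T.adj a b = true → T.Conn R a w := fun hb hab =>
      (hs hb).head ⟨hab, hb.mem hw⟩
    rcases h1 with h1 | h1 <;> rcases h2 with h2 | h2
    · exact h1.trans (hs h2)
    · exact h1.trans (ha h2 hadj)
    · exact h1.trans (ha h2 (by rw [adj_comm]; exact hadj))
    · exact h1.trans (hs h2)
  exact reach_congr hu hw hR hR fun v => ⟨fun h => (huw.symm hu).trans h, fun h => huw.trans h⟩

end Net

/-! ### Saturation -/

namespace Net

variable (T : Net)

/-- Whether all neighbours of `C` belong to `B`. -/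
def closed (C B : List ℕ) : Bool := T.E.all fun e =>
  (!C.contains e.1 || (C.contains e.2 || B.contains e.2)) &&
    (!C.contains e.2 || (C.contains e.1 || B.contains e.1))

/-- Add `C` to the solved sets, if the neighbours of `C` belong to `B` and the components of `C \ B`
have been solved. -/
def attempt (L : List (List ℕ)) (p : List ℕ × List ℕ) : List (List ℕ) :=
  if T.closed p.1 p.2 && (T.comps (p.1.filter fun v => !p.2.contains v)).all fun C => L.contains C
  then p.1 :: L else L

/-- The components of the graphs obtained by deleting one of the separators. -/
def cands (S : List (List ℕ)) : List (List ℕ) :=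
  S.flatMap fun B => (T.off B).map fun u => T.reach (T.off B) u

/-- All attempts in one round. -/
def pairs (S : List (List ℕ)) : List (List ℕ × List ℕ) :=
  (T.cands S).flatMap fun C => S.map fun B => (C, B)

/-- All attempts: `n` rounds, and the attempt on the set of all vertices. -/
def attempts (S : List (List ℕ)) : List (List ℕ × List ℕ) :=
  ((List.range T.n).flatMap fun _ => T.pairs S) ++ [(List.range T.n, [])]

/-- The sets solved in the end. -/
def solved (S : List (List ℕ)) : List (List ℕ) := (T.attempts S).foldl T.attempt []

/-- The components of the graphs obtained by deleting one of the separators, as a predicate. -/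
def IsPiece (S : List (List ℕ)) (C : List ℕ) : Prop :=
  ∃ B ∈ S, ∃ u ∈ T.off B, C = T.reach (T.off B) u

variable {T} {S S' L : List (List ℕ)} {B C R : List ℕ} {u v : ℕ}

theorem mem_off : v ∈ T.off B ↔ v < T.n ∧ v ∉ B := by simp [off]

theorem lt_of_mem_off : ∀ v ∈ T.off B, v < T.n := fun _ h => (mem_off.1 h).1

theorem closed_adj (h : T.closed C B = true) (hu : u ∈ C) (huv : T.adj u v = true) :
    v ∈ C ∨ v ∈ B := by
  simp only [closed, List.all_eq_true, Bool.and_eq_true, Bool.or_eq_true, Bool.not_eq_true',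
    List.contains_iff_mem] at h
  rcases adj_iff.1 huv with h' | h'
  · exact (h _ h').1.resolve_left (by simpa using hu)
  · exact (h _ h').2.resolve_left (by simpa using hu)

theorem mem_cands : C ∈ T.cands S ↔ T.IsPiece S C := by
  simp only [cands, IsPiece, List.mem_flatMap, List.mem_map, eq_comm]

theorem IsPiece.lt (h : T.IsPiece S C) : ∀ v ∈ C, v < T.n := by
  obtain ⟨B, _, u, hu, rfl⟩ := h
  exact fun v hv => lt_of_mem_off v (reach_subset (lt_of_mem_off u hu) hu lt_of_mem_off hv)

theorem IsPiece.nodup (h : T.IsPiece S C) : C.Nodup := by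
  obtain ⟨B, _, u, hu, rfl⟩ := h
  exact nodup_reach

theorem subset_attempt (p : List ℕ × List ℕ) : L ⊆ T.attempt L p := by
  rw [attempt]
  split
  · exact List.subset_cons_self _ _
  · exact fun _ h => h

theorem subset_foldl_attempt (l : List (List ℕ × List ℕ)) : L ⊆ l.foldl T.attempt L := by
  induction l generalizing L with
  | nil => exact fun _ h => h
  | cons p l ih => exact List.Subset.trans (subset_attempt p) ih

theorem attempt_of (h : T.closed C B = true)
    (h' : ∀ D ∈ T.comps (C.filter fun v => !B.contains v), D ∈ L) :
    T.attempt L (C, B) = C :: L := by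
  rw [attempt, if_pos]
  simp only [h, Bool.true_and, List.all_eq_true]
  exact fun D hD => by simpa using h' D hD

theorem mem_foldl_attempt {l : List (List ℕ × List ℕ)} (hl : (C, B) ∈ l)
    (h : T.closed C B = true) (h' : ∀ D ∈ T.comps (C.filter fun v => !B.contains v), D ∈ L) :
    C ∈ l.foldl T.attempt L := by
  obtain ⟨l1, l2, rfl⟩ := List.append_of_mem hl
  rw [List.foldl_append, List.foldl_cons, attempt_of h fun D hD => subset_foldl_attempt _ (h' D hD)]
  exact subset_foldl_attempt _ (by simp)

/-- The components that remain of a piece after deleting a separator that contains its neighbours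
are pieces. -/
theorem isPiece_of_mem_comps (hC : ∀ v ∈ C, v < T.n) (h : T.closed C B = true) (hB : B ∈ S)
    {D : List ℕ} (hD : D ∈ T.comps (C.filter fun v => !B.contains v)) :
    T.IsPiece S D ∧ D ⊆ C.filter fun v => !B.contains v := by
  have hR : ∀ v ∈ C.filter fun v => !B.contains v, v < T.n := fun v hv =>
    hC v (List.mem_filter.1 hv).1
  obtain ⟨u, hu, rfl⟩ := mem_comps hR hD
  refine ⟨⟨B, hB, u, ?_, ?_⟩, reach_subset (hR u hu) hu hR⟩
  · exact mem_off.2 ⟨hR u hu, by simpa using (List.mem_filter.1 hu).2⟩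
  · refine reach_congr hu (mem_off.2 ⟨hR u hu, by simpa using (List.mem_filter.1 hu).2⟩) hR
      lt_of_mem_off fun v => ⟨fun h => ?_, fun h' => ?_⟩
    · induction h with
      | refl => exact .refl
      | tail _ h1 ih =>
        exact ih.tail ⟨h1.1, mem_off.2 ⟨hR _ h1.2, by simpa using (List.mem_filter.1 h1.2).2⟩⟩
    -- A path that avoids `B` cannot leave `C`, since all neighbours of `C` outside `C` belong to
    -- `B`.
    · refine (?_ : T.Conn _ u v ∧ v ∈ C).1
      induction h' with
      | refl => exact ⟨.refl, (List.mem_filter.1 hu).1⟩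
      | tail _ h1 ih =>
        have hb := (mem_off.1 h1.2).2
        have := (closed_adj h ih.2 h1.1).resolve_right hb
        exact ⟨ih.1.tail ⟨h1.1, List.mem_filter.2 ⟨this, by simpa using hb⟩⟩, this⟩

/-- Pieces of size at most `r` are solved within `r` rounds: the separator meets `C`, so the
components it leaves are smaller and were solved before. The hypothesis concerns only a subfamily
`S'`, because other separators in `S` may have pieces that are never solved. -/
theorem mem_rounds (hSS : S' ⊆ S) (hS : ∀ C, T.IsPiece S' C → ∃ B ∈ S', T.closed C B = true ∧
    ∃ v ∈ C, v ∈ B) (r : ℕ) (hC : T.IsPiece S' C) (hr : C.length ≤ r) :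
    C ∈ ((List.range r).flatMap fun _ => T.pairs S).foldl T.attempt [] := by
  induction r generalizing C with
  | zero =>
    obtain ⟨B, _, _, v, hv, _⟩ := hS C hC
    rw [List.eq_nil_of_length_eq_zero (by omega : C.length = 0)] at hv
    simp at hv
  | succ r ih =>
    obtain ⟨B, hB, hcl, v, hv, hvB⟩ := hS C hC
    rw [List.range_succ, List.flatMap_append, List.foldl_append]
    refine mem_foldl_attempt (B := B) ?_ hcl fun D hD => ?_
    · simp only [List.flatMap_cons, List.flatMap_nil, List.append_nil, pairs, List.mem_flatMap,
        List.mem_map, Prod.mk.injEq, mem_cands]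
      obtain ⟨A, hA, h⟩ := hC
      exact ⟨C, ⟨A, hSS hA, h⟩, B, hSS hB, rfl, rfl⟩
    · obtain ⟨h1, h2⟩ := isPiece_of_mem_comps hC.lt hcl hB hD
      refine ih h1 ?_
      have hle := (List.subperm_of_subset (l₁ := v :: D) (l₂ := C) ?_ ?_).length_le
      · simp only [List.length_cons] at hle
        omega
      · refine List.nodup_cons.2 ⟨fun hvD => ?_, h1.nodup⟩
        have := (List.mem_filter.1 (h2 hvD)).2
        simp [hvB] at this
      · exact List.cons_subset.2 ⟨hv, fun w hw => (List.mem_filter.1 (h2 hw)).1⟩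

/-- If some of the separators suffice, then the set of all vertices is solved in the end. -/
theorem solved_eq (hE : ∀ e ∈ T.E, e.1 < T.n ∧ e.2 < T.n) (hSS : S' ⊆ S) (h0 : [] ∈ S')
    (hS : ∀ C, T.IsPiece S' C → ∃ B ∈ S', T.closed C B = true ∧ ∃ v ∈ C, v ∈ B) :
    ∃ L, T.solved S = List.range T.n :: L := by
  rw [solved, attempts, List.foldl_append, List.foldl_cons, List.foldl_nil, attempt_of]
  · exact ⟨_, rfl⟩
  · simp only [closed, List.all_eq_true, Bool.and_eq_true, Bool.or_eq_true, List.contains_iff_mem,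
      List.mem_range]
    exact fun e he => ⟨.inr (.inl (hE e he).2), .inr (.inl (hE e he).1)⟩
  -- The components of the whole graph are the pieces of the empty separator.
  · intro D hD
    obtain ⟨u, hu, rfl⟩ := mem_comps (fun v hv => lt_of_mem_off v hv) hD
    refine mem_rounds hSS hS _ ⟨[], h0, u, hu, rfl⟩ ?_
    have hsub : T.reach (T.off []) u ⊆ List.range T.n := fun v hv =>
      List.mem_range.2 (lt_of_mem_off v (reach_subset (lt_of_mem_off u hu) hu lt_of_mem_off hv))
    simpa using (List.subperm_of_subset nodup_reach hsub).length_le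

end Net

/-! ### Tables -/

/-- All colourings that arise from `φ` by recolouring the vertices in `A`. -/
def ext (q : ℕ) (A : List ℕ) (φ : ℕ → ℕ) : List (ℕ → ℕ) :=
  A.foldl (fun L a => L.flatMap fun ψ =>
    (List.range (q + 1)).map fun c => Function.update ψ a c) [φ]

/-- The restriction of a colouring to `0, …, n - 1`. -/
def encFn (n : ℕ) (φ : ℕ → ℕ) : Data := encL unary ((List.range n).map φ)

/-- The table of the values of `f` at all colourings of the vertices `m, …, m + k - 1`. -/
def trie (q : ℕ) : ℕ → ℕ → ((ℕ → ℕ) → ℕ) → (ℕ → ℕ) → Data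
  | 0, _, f, φ => encNat (f φ)
  | k + 1, m, f, φ =>
    encList ((List.range (q + 1)).map fun c => trie q k (m + 1) f (Function.update φ m c))

/-- The entry of a table at the given colours. -/
def lookup (d : Data) (l : List ℕ) : Data := l.foldl (fun d c => (Data.tl^[c] d).hd) d

/-- One step of grouping: the current group and the finished groups. -/
def chunkStep (q : ℕ) (a : Data) (t : List Data × List Data) : List Data × List Data :=
  if decide (q < (a :: t.1).length) then ([], encList (a :: t.1) :: t.2) else (a :: t.1, t.2)

/-- Group `q + 1` consecutive elements. -/
def chunk (q : ℕ) (l : List Data) : List Data := (l.foldr (chunkStep q) ([], [])).2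

/-- One step in building a table. -/
def buildStep (q : ℕ) (p : ℕ → Bool) (v : ℕ) (l : List Data) : List Data :=
  if p v then chunk q l else l.map fun d => encList (List.replicate (q + 1) d)

variable {q : ℕ}

theorem ext_concat (A : List ℕ) (a : ℕ) (φ : ℕ → ℕ) : ext q (A ++ [a]) φ =
    (ext q A φ).flatMap fun ψ => (List.range (q + 1)).map fun c => Function.update ψ a c := by
  simp [ext]

theorem sum_ext (A : List ℕ) (F : (ℕ → ℕ) → ℕ) (φ : ℕ → ℕ) :
    ((ext q A φ).map F).sum = sumOver q A F φ := by
  induction A using List.reverseRecOn generalizing F with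
  | nil => simp [ext, sumOver]
  | append_singleton A a ih =>
    rw [ext_concat, sumOver_append, ← ih]
    generalize ext q A φ = L
    induction L with
    | nil => rfl
    | cons ψ L ihL =>
      rw [List.flatMap_cons, List.map_append, List.sum_append, ihL, List.map_cons, List.sum_cons,
        List.map_map]
      rfl

theorem length_ext (A : List ℕ) (φ : ℕ → ℕ) : (ext q A φ).length = (q + 1) ^ A.length := by
  induction A using List.reverseRecOn with
  | nil => simp [ext]
  | append_singleton A a ih => simp [ext_concat, List.length_flatMap, ih, pow_succ]

theorem ext_le {A : List ℕ} {φ ψ : ℕ → ℕ} (h : ∀ v, φ v ≤ q) (hψ : ψ ∈ ext q A φ) (v : ℕ) :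
    ψ v ≤ q := by
  induction A using List.reverseRecOn generalizing ψ with
  | nil =>
    obtain rfl : ψ = φ := by simpa [ext] using hψ
    exact h v
  | append_singleton A a ih =>
    rw [ext_concat, List.mem_flatMap] at hψ
    obtain ⟨χ, hχ, h⟩ := hψ
    obtain ⟨c, hc, rfl⟩ := List.mem_map.1 h
    by_cases hva : v = a
    · simpa [hva, Nat.lt_succ_iff] using hc
    · rw [Function.update_of_ne hva]
      exact ih hχ

theorem lookup_trie {k m : ℕ} {f : (ℕ → ℕ) → ℕ} {φ χ : ℕ → ℕ} (h : ∀ v, φ v ≤ q) :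
    lookup (trie q k m f χ) ((List.range' m k).map φ) =
      encNat (f fun v => if m ≤ v ∧ v < m + k then φ v else χ v) := by
  induction k generalizing m χ with
  | zero =>
    have : (fun v => if m ≤ v ∧ v < m + 0 then φ v else χ v) = χ := by
      funext v
      rw [if_neg (by omega)]
    rw [this]
    rfl
  | succ k ih =>
    have hstep : (Data.tl^[φ m] (trie q (k + 1) m f χ)).hd =
        trie q k (m + 1) f (Function.update χ m (φ m)) := by
      have he : trie q (k + 1) m f χ = encL (fun d => d) ((List.range (q + 1)).map fun c =>
        trie q k (m + 1) f (Function.update χ m c)) := by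
        simp [trie, encL, Function.comp_def]
      rw [he, iterate_tl_encL, hd_encL_drop _ _ _ (d := .nil) rfl]
      have : φ m < q + 1 := Nat.lt_succ_of_le (h m)
      simp [List.getD, this]
    rw [List.range'_succ, List.map_cons, lookup, List.foldl_cons, hstep]
    have := ih (m := m + 1) (χ := Function.update χ m (φ m))
    rw [lookup] at this
    rw [this]
    congr 2
    funext v
    by_cases hv : v = m
    · subst hv
      rw [if_neg (by omega), if_pos (by omega), Function.update_self]
    · rw [Function.update_of_ne hv]
      congr 1
      exact propext ⟨fun h => ⟨by omega, by omega⟩, fun h => ⟨by omega, by omega⟩⟩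

theorem trie_update {k m m' c : ℕ} {f : (ℕ → ℕ) → ℕ} {φ : ℕ → ℕ} (hm : m < m')
    (hf : ∀ χ, f (Function.update χ m c) = f χ) :
    trie q k m' f (Function.update φ m c) = trie q k m' f φ := by
  induction k generalizing m' φ with
  | zero => rw [trie, trie, hf]
  | succ k ih =>
    rw [trie, trie]
    congr 1
    refine List.map_congr_left fun d _ => ?_
    rw [Function.update_comm (by omega), ih (by omega)]

theorem foldr_chunkStep (b : List Data) (out : List Data) (hb : b.length ≤ q) :
    b.foldr (chunkStep q) ([], out) = (b, out) := by
  induction b with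
  | nil => rfl
  | cons a b ih =>
    rw [List.length_cons] at hb
    rw [List.foldr_cons, ih (by omega), chunkStep, if_neg (by simp; omega)]

/-- Grouping starts at the end of the list. As all blocks have length `q + 1`, the group in progress
is empty at every block boundary. -/
theorem chunk_flatMap {α : Type} (l : List α) (b : α → List Data)
    (hb : ∀ a ∈ l, (b a).length = q + 1) :
    chunk q (l.flatMap b) = l.map fun a => encList (b a) := by
  have : (l.flatMap b).foldr (chunkStep q) ([], []) = ([], l.map fun a => encList (b a)) := by
    induction l with
    | nil => rfl
    | cons a l ih =>
      rw [List.flatMap_cons, List.foldr_append, ih fun a ha => hb a (by simp [ha])]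
      have ha := hb a (by simp)
      cases hba : b a with
      | nil => simp [hba] at ha
      | cons d b' =>
        rw [hba, List.length_cons] at ha
        rw [List.foldr_cons, foldr_chunkStep _ _ (by omega), chunkStep, if_pos (by simp; omega)]
        simp [hba]
  rw [chunk, this]

theorem foldr_chunkStep_length (l : List Data) :
    (l.foldr (chunkStep q) ([], [])).2.length + (l.foldr (chunkStep q) ([], [])).1.length
      ≤ l.length := by
  induction l with
  | nil => simp
  | cons a l ih =>
    rw [List.foldr_cons, chunkStep]
    split <;> simp <;> omega

/-- This preserves the bound on the number of subtables through all the steps of building. -/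
theorem length_buildStep_le (p : ℕ → Bool) (v : ℕ) (l : List Data) :
    (buildStep q p v l).length ≤ l.length := by
  rw [buildStep]
  split
  · have := foldr_chunkStep_length (q := q) l
    rw [chunk]
    omega
  · simp

/-- The table is assembled from its leaves upwards. In `ext` the last vertex varies fastest, so at a
vertex with `p` the subtables for its colours are consecutive and are grouped. At any other vertex
`f` ignores the colour, and one subtable is entered `q + 1` times. These copies are shared pointers,
so a table with `(q + 1) ^ n` nominal entries costs little more than its relevant ones. -/
theorem build_eq {p : ℕ → Bool} {f : (ℕ → ℕ) → ℕ} {φ : ℕ → ℕ} (k m : ℕ)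
    (hf : ∀ v < m, p v = false → ∀ χ c, f (Function.update χ v c) = f χ) :
    (List.range m).foldr (buildStep q p)
      ((ext q ((List.range m).filter p) φ).map (trie q k m f)) = [trie q (m + k) 0 f φ] := by
  induction m generalizing k with
  | zero => simp [ext]
  | succ m ih =>
    rw [List.range_succ, List.foldr_append, List.foldr_cons, List.foldr_nil, List.filter_append]
    have hstep : buildStep q p m ((ext q ((List.range m).filter p ++ [m].filter p) φ).map
        (trie q k (m + 1) f)) = (ext q ((List.range m).filter p) φ).map (trie q (k + 1) m f) := by
      rw [buildStep]
      cases hp : p m with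
      | true =>
        rw [if_pos rfl, List.filter_cons_of_pos hp, List.filter_nil, ext_concat, List.map_flatMap,
          chunk_flatMap _ _ (by simp)]
        refine List.map_congr_left fun ψ _ => ?_
        rw [trie, List.map_map]
        rfl
      | false =>
        rw [if_neg (by simp), List.filter_cons_of_neg (by simp [hp]), List.filter_nil,
          List.append_nil, List.map_map]
        refine List.map_congr_left fun ψ _ => ?_
        rw [Function.comp_apply, trie]
        congr 1
        symm
        rw [List.eq_replicate_iff]
        refine ⟨by simp, fun d hd => ?_⟩
        obtain ⟨c, _, rfl⟩ := List.mem_map.1 hd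
        exact trie_update (by omega) fun χ => hf m (by omega) hp χ c
    rw [hstep, ih (k + 1) fun v hv => hf v (by omega)]
    congr 2
    omega

/-! ### Programs for colourings and tables. -/

namespace PT

variable {I : Type} {e s e1 : I → ℕ} {x : I → Data}

theorem fnApply {n : I → ℕ} {φ : I → ℕ → ℕ} {v : I → ℕ}
    (hφ : PT q e s x (fun i => encFn (n i) (φ i))) (hv : PT q e s x (fun i => unary (v i)))
    (hs : Small s v) (hvn : ∀ i, v i < n i) : PT q e s x (fun i => unary (φ i (v i))) :=
  (getD (ea := fun _ => unary) (d := 0) (fun _ => rfl) hφ hv hs).congr fun i => by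
    simp [List.getD, hvn i]

theorem fnUpdate {n : I → ℕ} {φ : I → ℕ → ℕ} {a c : I → ℕ} (hn : PT q e s x (fun i => unary (n i)))
    (hφ : PT q e s x (fun i => encFn (n i) (φ i))) (ha : PT q e s x (fun i => unary (a i)))
    (hc : PT q e s x (fun i => unary (c i))) (hsn : Small s n) (hsa : Small s a) :
    PT q e s x (fun i => encFn (n i) (Function.update (φ i) (a i) (c i))) := by
  refine map (ea := fun _ => unary) (hn.range hsn) (by simpa using hsn) fun x' hx hv => ?_
  have hsv : Small (fun j : MemIdx fun i => List.range (n i) => s j.i) (fun j => j.a) :=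
    (hsn.comap fun j : MemIdx fun i => List.range (n i) => j.i).mono fun j =>
      (List.mem_range.1 j.h).le
  refine ite (b := fun j => j.a == a j.i) (hv.eq (ha.via hx) hsv (hsa.comap _)) (hc.via hx)
    ((hφ.via hx).fnApply hv hsv fun j => List.mem_range.1 j.h) (fun j hj => ?_) (fun j hj => ?_)
  · rw [beq_iff_eq] at hj
    rw [hj, Function.update_self]
  · rw [beq_eq_false_iff_ne] at hj
    rw [Function.update_of_ne hj]

/-- Enumeration of colourings. -/
theorem ext {n : I → ℕ} {φ : I → ℕ → ℕ} {A : I → List ℕ}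
    (hn : PT q (fun _ => 0) s x (fun i => unary (n i)))
    (hφ : PT q (fun _ => 0) s x (fun i => encFn (n i) (φ i)))
    (hA : PT q (fun _ => 0) s x (fun i => encL unary (A i)))
    (hsn : Small s n) (hsA : Small s (fun i => (A i).length)) (hAn : ∀ i, ∀ a ∈ A i, a < n i) :
    PT q (fun i => (A i).length) s x
      (fun i => encL (encFn (n i)) (HomPoly.ext q (A i) (φ i))) := by
  refine fold (e1 := fun _ => 0) (e2 := fun i => (A i).length) (fun i => by simp) hA.up
    (es := fun i => encL (encFn (n i))) (st := fun i => [φ i])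
    (f := fun i L a => L.flatMap fun ψ =>
      (List.range (q + 1)).map fun c => Function.update ψ a c) (hφ.up.cons (const .nil)) hsA.toW
    fun x' hx hL ha => ?_
  have hsa : Small (fun j : FoldIdx A => s j.i) (fun j => j.a) :=
    (hsn.comap fun j : FoldIdx A => j.i).mono fun j => (hAn j.i _ j.mem).le
  -- The exponent is spent on the length of the current list of colourings; the outer loop over `A`
  -- is polynomial.
  refine flatMapW (e1 := fun j => (A j.i).length) (e2 := fun _ => 0) (fun j => by simp) hL ?_
    ((Small.const (q + 1)).mono fun j => by simp) fun x'' hx' hψ => ?_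
  · refine ⟨0, fun j => ?_⟩
    change (HomPoly.ext q j.pre (φ j.i)).length ≤ _
    rw [length_ext, pow_zero, mul_one]
    exact Nat.pow_le_pow_right (by omega) j.pre_prefix.length_le
  · refine map (ea := fun _ => unary) (const (encL unary (List.range (q + 1))))
      (.const (List.range (q + 1)).length) fun x3 hx3 hc => ?_
    exact fnUpdate (((hn.via hx).via hx').via hx3) ((hψ (e' := fun _ => 0)).via hx3) (((ha (e' := fun _ => 0)).via hx').via hx3) hc
      (hsn.comap _) (hsa.comap _)

theorem lookup {d : I → Data} {l : I → List ℕ} (hd : PT q e s x d)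
    (hl : PT q e s x (fun i => encL unary (l i))) (hlen : Small s (fun i => (l i).length))
    (hq : ∀ i, ∀ c ∈ l i, c ≤ q) : PT q e s x (fun i => lookup (d i) (l i)) :=
  foldLight (ea := fun _ => unary) (es := fun _ d => d) (f := fun _ d c => (Data.tl^[c] d).hd)
    hl hd hlen fun _ _ hd hc => (hd.iterateTl hc ((Small.const q).mono fun j => hq _ _ j.mem)).hd

theorem replicate {d : I → Data} (hd : PT q e s x d) (k : ℕ) :
    PT q e s x (fun i => encList (List.replicate k (d i))) := by
  induction k with
  | zero => exact const .nil
  | succ k ih => exact hd.cons ih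

theorem chunk {l : I → List Data} (hl : PT q e s x (fun i => encList (l i)))
    (hlen : SmallW q e s (fun i => (l i).length)) :
    PT q e s x (fun i => encList (chunk q (l i))) := by
  have hid : ∀ l : List Data, encL (fun d => d) l = encList l := fun l => by simp [encL]
  refine (snd (fold (e1 := e) (e2 := fun _ => 0) (fun i => by simp) (ea := fun _ d => d)
    (es := fun _ => encP encList encList) (f := fun _ t a => chunkStep q a t)
    (st := fun _ => ([], [])) (reverse (ea := fun _ d => d) (hl.congr fun i => (hid _).symm) hlen)
    (const (.cons .nil .nil)) (by simpa using hlen) fun x' hx hs ha => ?_)).congr fun i => by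
      rw [List.foldl_reverse, HomPoly.chunk]
  refine ite (b := fun j => decide (q < (j.a :: (j.pre.foldl (fun t a => chunkStep q a t)
    ([], [])).1).length)) ?_ ((const .nil).cons ((ha.cons hs.fst).cons hs.snd))
    ((ha.cons hs.fst).cons hs.snd) (fun j hj => ?_) (fun j hj => ?_)
  · refine ((ha.cons hs.fst).iterateTl (m := fun _ => q) (const (unary q)) (.const q)).isCons.congr
      fun j => ?_
    rw [← hid, show Data.cons j.a (encL _ _) = encL (fun d => d) (j.a :: _) from rfl,
      iterate_tl_encL, isCons_encL]
    congr 1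
    rw [Bool.eq_iff_iff]
    simp
  · rw [chunkStep, if_pos hj]; rfl
  · rw [chunkStep, if_neg (by rw [hj]; exact Bool.false_ne_true)]; rfl

/-- Building a table from the list of its values. -/
theorem build {n : I → ℕ} {p : I → ℕ → Bool} {l : I → List Data}
    (hn : PT q e s x (fun i => unary (n i))) (hl : PT q e s x (fun i => encList (l i)))
    (hlen : SmallW q e s (fun i => (l i).length)) (hsn : Small s n)
    (hp : ∀ x' : MemIdx (fun i => List.range (n i)) → Data,
      (∀ {e'}, PT q e' (fun j => s j.i) x' (fun j => x j.i)) →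
      (∀ {e'}, PT q e' (fun j => s j.i) x' (fun j => unary j.a)) →
      PT q (fun j => e j.i) (fun j => s j.i) x' (fun j => encBool (p j.i j.a))) :
    PT q e s x (fun i => encList ((List.range (n i)).foldr (buildStep q (p i)) (l i))) := by
  have hid : ∀ l : List Data, encL (fun d => d) l = encList l := fun l => by simp [encL]
  refine (foldLight (ea := fun _ => unary) (es := fun _ => encList)
    (f := fun i L v => buildStep q (p i) v L) (st := l)
    (reverse (ea := fun _ => unary) (hn.range hsn) (by simpa using hsn.toW)) hl
    (by simpa using hsn) fun x' hx hL hv => ?_).congr fun i => by rw [List.foldl_reverse]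
  have hlen' : SmallW q (fun j : FoldIdx fun i => (List.range (n i)).reverse => e j.i)
      (fun j => s j.i) (fun j => (j.pre.foldl (fun L v => buildStep q (p j.i) v L) (l j.i)).length) := by
    obtain ⟨c, hc⟩ := hlen
    have key : ∀ i (pre : List ℕ),
        (pre.foldl (fun L v => buildStep q (p i) v L) (l i)).length ≤ (l i).length := by
      intro i pre
      induction pre using List.reverseRecOn with
      | nil => exact le_rfl
      | append_singleton pre v ih =>
        rw [List.foldl_append, List.foldl_cons, List.foldl_nil]
        exact (length_buildStep_le _ _ _).trans ih
    exact ⟨c, fun j => (key j.i j.pre).trans (hc j.i)⟩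
  refine ite (b := fun j => p j.i j.a) ?_ (hL.chunk hlen')
    ((mapW (e1 := fun j => e j.i) (e2 := fun _ => 0) (ea := fun _ d => d) (eb := fun _ d => d)
    (g := fun _ d => encList (List.replicate (q + 1) d)) (fun j => by simp)
    (hL.congr fun j => (hid _).symm) hlen' fun _ _ hd => hd.replicate _).congr fun j => hid _)
    (fun j hj => by rw [buildStep, if_pos hj]) (fun j hj => by
      rw [buildStep, if_neg (by simp [hj])])
  exact (hx.cons hv).comp ((hp _ PT.id.fst PT.id.snd).comap
    fun j : FoldIdx fun i => (List.range (n i)).reverse =>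
      (⟨j.i, j.a, by simpa using j.mem⟩ : MemIdx fun i => List.range (n i)))

end PT

/-! ### Programs for components -/

/-- The graphs `T i` are computable. -/
structure NetPT (q : ℕ) {I : Type} (e s : I → ℕ) (x : I → Data) (T : I → Net) : Prop where
  n : PT q e s x fun i => unary (T i).n
  E : PT q e s x fun i => encL (encP unary unary) (T i).E
  sn : Small s fun i => (T i).n
  sE : Small s fun i => (T i).E.length
  lt : ∀ i, ∀ a ∈ (T i).E, a.1 < (T i).n ∧ a.2 < (T i).n

/-- The sets `C i` of numbers less than `n i` are computable. -/
structure SetPT (q : ℕ) {I : Type} (e s : I → ℕ) (x : I → Data) (n : I → ℕ)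
    (C : I → List ℕ) : Prop where
  pt : PT q e s x fun i => encL unary (C i)
  lt : ∀ i, ∀ v ∈ C i, v < n i
  sn : Small s n
  len : Small s fun i => (C i).length

variable {q : ℕ} {I J : Type} {e s : I → ℕ} {x : I → Data}

theorem NetPT.via {T : I → Net} (h : NetPT q e s x T) {g : J → I} {x' : J → Data}
    (hx : PT q (fun j => e (g j)) (fun j => s (g j)) x' (fun j => x (g j))) :
    NetPT q (fun j => e (g j)) (fun j => s (g j)) x' (fun j => T (g j)) :=
  ⟨h.n.via hx, h.E.via hx, h.sn.comap g, h.sE.comap g, fun j => h.lt (g j)⟩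

theorem SetPT.via {n : I → ℕ} {C : I → List ℕ} (h : SetPT q e s x n C) {g : J → I} {x' : J → Data}
    (hx : PT q (fun j => e (g j)) (fun j => s (g j)) x' (fun j => x (g j))) :
    SetPT q (fun j => e (g j)) (fun j => s (g j)) x' (fun j => n (g j)) (fun j => C (g j)) :=
  ⟨h.pt.via hx, fun j => h.lt (g j), h.sn.comap g, h.len.comap g⟩

theorem SetPT.contains {n : I → ℕ} {C : I → List ℕ} (h : SetPT q e s x n C) {v : I → ℕ}
    (hv : PT q e s x fun i => unary (v i)) (hvn : ∀ i, v i < n i) :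
    PT q e s x fun i => encBool ((C i).contains (v i)) :=
  h.pt.contains hv h.len (h.sn.mono fun i => (hvn i).le)
    ((h.sn.comap fun j : MemIdx C => j.i).mono fun j => (h.lt j.i _ j.h).le)

theorem length_le_of_nodup {l : List ℕ} {n : ℕ} (h : l.Nodup) (hl : ∀ v ∈ l, v < n) :
    l.length ≤ n := by
  simpa using (List.subperm_of_subset h (l₂ := List.range n)
    fun v hv => List.mem_range.2 (hl v hv)).length_le

/-- Subsets of `0, …, n - 1` given by a predicate. -/
theorem SetPT.filter {n : I → ℕ} {p : I → ℕ → Bool} (hn : PT q e s x fun i => unary (n i))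
    (sn : Small s n)
    (hp : ∀ x' : MemIdx (fun i => List.range (n i)) → Data,
      (∀ {e'}, PT q e' (fun j => s j.i) x' (fun j => x j.i)) →
      (∀ {e'}, PT q e' (fun j => s j.i) x' (fun j => unary j.a)) →
      PT q (fun j => e j.i) (fun j => s j.i) x' (fun j => encBool (p j.i j.a))) :
    SetPT q e s x n fun i => (List.range (n i)).filter (p i) where
  pt := PT.filter (ea := fun _ => unary) (hn.range sn) (by simpa using sn) hp
  lt i v hv := List.mem_range.1 (List.mem_filter.1 hv).1
  sn := sn
  len := sn.mono fun i => by simpa using List.length_filter_le (p i) (List.range (n i))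

theorem SetPT.filter' {n : I → ℕ} {C : I → List ℕ} (h : SetPT q e s x n C) {p : I → ℕ → Bool}
    (hp : ∀ x' : MemIdx C → Data,
      (∀ {e'}, PT q e' (fun j => s j.i) x' (fun j => x j.i)) →
      (∀ {e'}, PT q e' (fun j => s j.i) x' (fun j => unary j.a)) →
      PT q (fun j => e j.i) (fun j => s j.i) x' (fun j => encBool (p j.i j.a))) :
    SetPT q e s x n fun i => (C i).filter (p i) where
  pt := PT.filter (ea := fun _ => unary) h.pt h.len hp
  lt i v hv := h.lt i v (List.mem_filter.1 hv).1
  sn := h.sn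
  len := h.len.mono fun i => List.length_filter_le (p i) (C i)

namespace NetPT

variable {T : I → Net} {C B : I → List ℕ} {u v : I → ℕ}

theorem adj (h : NetPT q e s x T) (hu : PT q e s x fun i => unary (u i))
    (hv : PT q e s x fun i => unary (v i)) (hun : ∀ i, u i < (T i).n) (hvn : ∀ i, v i < (T i).n) :
    PT q e s x fun i => encBool ((T i).adj (u i) (v i)) := by
  refine PT.any (ea := fun _ => encP unary unary) (l := fun i => (T i).E) h.E h.sE
    fun x' hx ha => ?_
  have hn := h.sn.comap fun j : MemIdx fun i => (T i).E => j.i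
  have su := hn.mono fun j => (hun j.i).le
  have sv := hn.mono fun j => (hvn j.i).le
  have s1 := hn.mono fun j => (h.lt j.i _ j.h).1.le
  have s2 := hn.mono fun j => (h.lt j.i _ j.h).2.le
  exact ((ha.fst.eq (hu.via hx) s1 su).and (ha.snd.eq (hv.via hx) s2 sv)).or
    ((ha.fst.eq (hv.via hx) s1 sv).and (ha.snd.eq (hu.via hx) s2 su))

theorem off (h : NetPT q e s x T) (hC : SetPT q e s x (fun i => (T i).n) C) :
    SetPT q e s x (fun i => (T i).n) fun i => (T i).off (C i) :=
  SetPT.filter h.n h.sn fun _ hx hv => ((hC.via hx).contains hv fun j => List.mem_range.1 j.h).not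

theorem reachStep (h : NetPT q e s x T) (hB : SetPT q e s x (fun i => (T i).n) B)
    (hC : SetPT q e s x (fun i => (T i).n) C) :
    SetPT q e s x (fun i => (T i).n) fun i => (T i).reachStep (B i) (C i) :=
  SetPT.filter h.n h.sn fun _ hx hv =>
    ((hB.via hx).contains hv fun j => List.mem_range.1 j.h).and
      (((hC.via hx).contains hv fun j => List.mem_range.1 j.h).or
        (PT.any (ea := fun _ => unary) (hC.pt.via hx) (hC.len.comap _) fun _ hx' hu =>
          ((h.via hx).via hx').adj hu ((hv (e' := fun j => e j.i)).via hx')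
            (fun j => hC.lt _ _ j.h) fun j => List.mem_range.1 j.i.h))

theorem iterate_lt {T : Net} {R : List ℕ} {u : ℕ} (hu : u < T.n) (k : ℕ) :
    ∀ v ∈ (T.reachStep R)^[k] [u], v < T.n := by
  cases k with
  | zero => simpa using hu
  | succ k =>
    intro v hv
    rw [Function.iterate_succ_apply', Net.mem_reachStep] at hv
    exact hv.1

theorem reach_lt {T : Net} {R : List ℕ} {u : ℕ} (hu : u < T.n) : ∀ v ∈ T.reach R u, v < T.n :=
  iterate_lt hu _

theorem reach (h : NetPT q e s x T) (hB : SetPT q e s x (fun i => (T i).n) B)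
    (hu : PT q e s x fun i => unary (u i)) (hun : ∀ i, u i < (T i).n) :
    SetPT q e s x (fun i => (T i).n) fun i => (T i).reach (B i) (u i) where
  pt := PT.iterate (es := fun _ => encL unary) (f := fun i => (T i).reachStep (B i)) h.n
    (hu.cons (.const .nil)) h.sn fun _ hx hs => ((h.via hx).reachStep (hB.via hx) ⟨hs,
      fun j => iterate_lt (hun j.i) j.k, h.sn.comap _, h.sn.comapLe fun j =>
        length_le_of_nodup (Net.nodup_iterate_reachStep _) (iterate_lt (hun j.i) j.k)⟩).pt
  lt i := reach_lt (hun i)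
  sn := h.sn
  len := h.sn.mono fun i => length_le_of_nodup Net.nodup_reach (reach_lt (hun i))

/-- Bounds on the intermediate states of the search for components, used for the running time. In
contrast to `Net.comps_aux`, nothing is assumed about `R`. -/
theorem comps_fold (T : Net) (R pre : List ℕ) :
    let K := pre.foldl (fun K u =>
      if R.contains u && !(K.any fun C => C.contains u) then T.reach R u :: K else K) []
    K.length ≤ pre.length ∧ ∀ C ∈ K, ∃ u ∈ pre, C = T.reach R u := by
  induction pre using List.reverseRecOn with
  | nil => simp
  | append_singleton pre v ih =>
    simp only [List.foldl_append, List.foldl_cons, List.foldl_nil]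
    split
    · refine ⟨by simpa using ih.1, fun C hC => ?_⟩
      rcases List.mem_cons.1 hC with rfl | hC
      · exact ⟨v, by simp, rfl⟩
      · obtain ⟨u, hu, h⟩ := ih.2 C hC
        exact ⟨u, by simp [hu], h⟩
    · refine ⟨by simpa using ih.1.trans (Nat.le_succ _), fun C hC => ?_⟩
      obtain ⟨u, hu, h⟩ := ih.2 C hC
      exact ⟨u, by simp [hu], h⟩

theorem comps_lt {T : Net} {R C : List ℕ} (hC : C ∈ T.comps R) :
    (∀ v ∈ C, v < T.n) ∧ C.Nodup := by
  obtain ⟨u, hu, rfl⟩ := (comps_fold T R (List.range T.n)).2 C hC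
  exact ⟨reach_lt (List.mem_range.1 hu), Net.nodup_reach⟩

theorem length_comps {T : Net} {R : List ℕ} : (T.comps R).length ≤ T.n := by
  exact (comps_fold T R (List.range T.n)).1.trans_eq List.length_range

theorem comps (h : NetPT q e s x T) (hB : SetPT q e s x (fun i => (T i).n) B) :
    PT q e s x fun i => encL (encL unary) ((T i).comps (B i)) := by
  refine PT.foldLight (ea := fun _ => unary) (es := fun _ => encL (encL unary))
    (f := fun i K u => if (B i).contains u && !(K.any fun C => C.contains u) then
      (T i).reach (B i) u :: K else K) (st := fun _ => []) (h.n.range h.sn) (.const .nil)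
    (by simpa using h.sn) fun x' hx hK hu => ?_
  have hn := h.sn.comap fun j : FoldIdx fun i => List.range (T i).n => j.i
  have hlt : ∀ j : FoldIdx fun i => List.range (T i).n, j.a < (T j.i).n := fun j =>
    List.mem_range.1 j.mem
  have hKlt : ∀ j : FoldIdx fun i => List.range (T i).n, ∀ C ∈ j.pre.foldl (fun K u =>
      if (B j.i).contains u && !(K.any fun C => C.contains u) then
      (T j.i).reach (B j.i) u :: K else K) [], (∀ v ∈ C, v < (T j.i).n) ∧ C.Nodup := by
    intro j C hC
    obtain ⟨u, hu, rfl⟩ := (comps_fold (T j.i) (B j.i) j.pre).2 C hC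
    exact ⟨reach_lt (List.mem_range.1 (j.pre_prefix.subset hu)), Net.nodup_reach⟩
  refine PT.ite (b := fun j => (B j.i).contains j.a && !(List.any (j.pre.foldl (fun K u =>
      if (B j.i).contains u && !(K.any fun C => C.contains u) then
      (T j.i).reach (B j.i) u :: K else K) []) fun C => C.contains j.a))
    (((hB.via hx).contains hu hlt).and (PT.not (PT.any (ea := fun _ => encL unary) hK ?_
      fun x'' hx' hC => ?_))) (((h.via hx).reach (hB.via hx) hu hlt).pt.cons hK) hK
      (fun j hj => by rw [if_pos hj]; rfl) (fun j hj => by rw [if_neg (by simp only [hj]; simp)])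
  · refine hn.mono fun j => (comps_fold (T j.i) (B j.i) j.pre).1.trans ?_
    simpa using j.pre_prefix.length_le
  · exact SetPT.contains (n := fun j => (T j.i.i).n) ⟨hC, fun j => (hKlt j.i _ j.h).1, hn.comap _,
      hn.comapLe fun j => length_le_of_nodup (hKlt j.i _ j.h).2
      (hKlt j.i _ j.h).1⟩ ((hu (e' := fun j => e j.i)).via hx') fun j => hlt j.i

theorem closed (h : NetPT q e s x T) (hC : SetPT q e s x (fun i => (T i).n) C)
    (hB : SetPT q e s x (fun i => (T i).n) B) :
    PT q e s x fun i => encBool ((T i).closed (C i) (B i)) :=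
  PT.all (ea := fun _ => encP unary unary) (l := fun i => (T i).E) h.E h.sE fun _ hx ha =>
    (((hC.via hx).contains ha.fst fun j => (h.lt _ _ j.h).1).not.or
      (((hC.via hx).contains ha.snd fun j => (h.lt _ _ j.h).2).or
        ((hB.via hx).contains ha.snd fun j => (h.lt _ _ j.h).2))).and
    (((hC.via hx).contains ha.snd fun j => (h.lt _ _ j.h).2).not.or
      (((hC.via hx).contains ha.fst fun j => (h.lt _ _ j.h).1).or
        ((hB.via hx).contains ha.fst fun j => (h.lt _ _ j.h).1)))

end NetPT

/-- Equality of lists. -/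
theorem PT.listEq {l l' : I → List ℕ} {n : I → ℕ} (h : SetPT q e s x n l)
    (h' : SetPT q e s x n l') : PT q e s x fun i => encBool (l i == l' i) := by
  have hl := PT.length (ea := fun _ => unary) h.pt h.len
  have hl' := PT.length (ea := fun _ => unary) h'.pt h'.len
  have hbd : ∀ {l : List ℕ} {n k : ℕ}, (∀ v ∈ l, v < n) → l.getD k 0 ≤ n := by
    intro l n k hl
    by_cases hk : k < l.length
    · rw [List.getD_eq_getElem _ _ hk]
      exact (hl _ (List.getElem_mem hk)).le
    · rw [List.getD_eq_default _ _ (by omega)]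
      exact Nat.zero_le _
  refine ((hl.eq hl' h.len h'.len).and (PT.all (ea := fun _ => unary)
    (p := fun i k => (l i).getD k 0 == (l' i).getD k 0) (hl.range h.len) (by simpa using h.len)
    fun x' hx hk => ?_)).congr fun i => ?_
  · have sk := (h.len.comap fun j : MemIdx fun i => List.range (l i).length => j.i).mono fun j =>
      (List.mem_range.1 j.h).le
    exact PT.eq (PT.getD (ea := fun _ => unary) (fun _ => rfl) (h.pt.via hx) hk sk)
      (PT.getD (ea := fun _ => unary) (fun _ => rfl) (h'.pt.via hx) hk sk)
      (h.sn.comapLe fun j => hbd (h.lt j.i))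
      (h.sn.comapLe fun j => hbd (h'.lt j.i))
  · congr 1
    rw [Bool.eq_iff_iff]
    simp only [Bool.and_eq_true, beq_iff_eq, List.all_eq_true, List.mem_range]
    constructor
    · rintro ⟨h1, h2⟩
      refine List.ext_getElem h1 fun k hk hk' => ?_
      have := h2 k hk
      rwa [List.getD_eq_getElem _ _ hk, List.getD_eq_getElem _ _ hk'] at this
    · rintro h
      simp [h]

/-! ### Programs for tables -/

/-- The table of the values of `val C`. -/
def Net.table (T : Net) (q : ℕ) (C : List ℕ) : Data := trie q T.n 0 (T.val q C) fun _ => 0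

/-- The networks `T i` are computable, and their weights are less than `2 ^ M i`. -/
structure WtPT (q : ℕ) {I : Type} (e s : I → ℕ) (x : I → Data) (T : I → Net) (M : I → ℕ) : Prop
    extends NetPT q e s x T where
  X : PT q e s x fun i => encL encNat (T i).X
  Y : PT q e s x fun i => encL (encL encNat) (T i).Y
  sM : Small s M
  ltX : ∀ i, ∀ a ∈ (T i).X, a < 2 ^ M i
  ltY : ∀ i, ∀ r ∈ (T i).Y, ∀ a ∈ r, a < 2 ^ M i

variable {q : ℕ} {I J : Type} {e s : I → ℕ} {x : I → Data} {T : I → Net} {M : I → ℕ}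

theorem WtPT.via (h : WtPT q e s x T M) {g : J → I} {x' : J → Data}
    (hx : PT q (fun j => e (g j)) (fun j => s (g j)) x' (fun j => x (g j))) :
    WtPT q (fun j => e (g j)) (fun j => s (g j)) x' (fun j => T (g j)) (fun j => M (g j)) :=
  ⟨h.toNetPT.via hx, h.X.via hx, h.Y.via hx, h.sM.comap g, fun j => h.ltX (g j),
    fun j => h.ltY (g j)⟩

theorem smallW_ext {A : I → List ℕ} {φ : I → ℕ → ℕ} :
    SmallW q (fun i => (A i).length) s fun i => (ext q (A i) (φ i)).length :=
  ⟨0, fun i => by simp [length_ext]⟩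

namespace Net

variable {T : Net} {M : ℕ}

theorem getD_lt {l : List ℕ} (h : ∀ a ∈ l, a < 2 ^ M) (k : ℕ) : l.getD k 0 < 2 ^ M := by
  by_cases hk : k < l.length
  · rw [List.getD_eq_getElem _ _ hk]
    exact h _ (List.getElem_mem hk)
  · rw [List.getD_eq_default _ _ (by omega)]
    positivity

theorem wX_lt (h : ∀ a ∈ T.X, a < 2 ^ M) (ψ : ℕ → ℕ) (v : ℕ) : T.wX ψ v < 2 ^ M := getD_lt h _

theorem wY_lt (h : ∀ r ∈ T.Y, ∀ a ∈ r, a < 2 ^ M) (ψ : ℕ → ℕ) (e : ℕ × ℕ) :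
    T.wY ψ e < 2 ^ M := by
  rw [wY]
  by_cases hk : ψ e.1 < T.Y.length
  · rw [List.getD_eq_getElem _ _ hk]
    exact getD_lt (h _ (List.getElem_mem hk)) _
  · rw [List.getD_eq_default (l := T.Y) _ (by omega)]
    exact getD_lt (by simp) _

theorem prod_le_pow {l : List ℕ} {b : ℕ} (h : ∀ a ∈ l, a ≤ b) : l.prod ≤ b ^ l.length := by
  induction l with
  | nil => simp
  | cons a l ih =>
    rw [List.prod_cons, List.length_cons, pow_succ, mul_comm]
    exact Nat.mul_le_mul (ih fun b hb => h b (by simp [hb])) (h a (by simp))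

/-- There are at most `(q + 1) ^ n` colourings, and each weight has at most `n + |E|` factors below
`2 ^ M`. All values in the tables thus have polynomially many bits. -/
theorem size_val_le (hX : ∀ a ∈ T.X, a < 2 ^ M) (hY : ∀ r ∈ T.Y, ∀ a ∈ r, a < 2 ^ M)
    {C : List ℕ} (hC : C.length ≤ T.n) (φ : ℕ → ℕ) :
    (T.val q C φ).size ≤ (q + 1) * T.n + M * (T.n + T.E.length) + 1 := by
  have h1 : ∀ ψ, T.wt C ψ ≤ 2 ^ (M * (T.n + T.E.length)) := by
    intro ψ
    have hx := prod_le_pow (l := C.map (T.wX ψ)) (b := 2 ^ M) (by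
      simp only [List.mem_map]
      rintro _ ⟨v, _, rfl⟩
      exact (wX_lt hX ψ v).le)
    have hy := prod_le_pow (l := (T.E.filter (touches C)).map (T.wY ψ)) (b := 2 ^ M) (by
      simp only [List.mem_map]
      rintro _ ⟨v, _, rfl⟩
      exact (wY_lt hY ψ v).le)
    rw [List.length_map] at hx hy
    refine (Nat.mul_le_mul hx hy).trans ?_
    rw [← pow_add, ← pow_mul]
    refine Nat.pow_le_pow_right (by omega) (Nat.mul_le_mul_left _ (Nat.add_le_add hC ?_))
    exact List.length_filter_le _ _
  have h2 : T.val q C φ ≤ (q + 1) ^ C.length * 2 ^ (M * (T.n + T.E.length)) := sumOver_le h1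
  have h3 : (q + 1) ^ C.length ≤ 2 ^ ((q + 1) * T.n) := by
    rw [pow_mul]
    exact (Nat.pow_le_pow_right (by omega) hC).trans
      (Nat.pow_le_pow_left Nat.lt_two_pow_self.le _)
  rw [Nat.size_le, pow_succ, pow_add]
  have h4 := Nat.mul_le_mul_right (2 ^ (M * (T.n + T.E.length))) h3
  have h5 : 0 < 2 ^ ((q + 1) * T.n) * 2 ^ (M * (T.n + T.E.length)) := by positivity
  omega

/-- The table fixes the colour 0 at all numbers from `T.n` on. This is harmless, since only ends of
edges matter to `val`. -/
theorem lookup_table (hE : ∀ a ∈ T.E, a.1 < T.n ∧ a.2 < T.n) (D : List ℕ) {ψ : ℕ → ℕ}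
    (hψ : ∀ v, ψ v ≤ q) :
    lookup (T.table q D) ((List.range T.n).map ψ) = encNat (T.val q D ψ) := by
  rw [table, List.range_eq_range', lookup_trie hψ]
  congr 1
  refine val_congr fun e he _ v _ hv => if_pos ⟨Nat.zero_le _, ?_⟩
  rw [Nat.zero_add]
  rcases hv with rfl | rfl
  · exact (hE e he).1
  · exact (hE e he).2

end Net

namespace WtPT

theorem wX (h : WtPT q e s x T M) {ψ : I → ℕ → ℕ} {v : I → ℕ}
    (hψ : PT q e s x fun i => encFn (T i).n (ψ i)) (hv : PT q e s x fun i => unary (v i))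
    (hvn : ∀ i, v i < (T i).n) (hq : ∀ i v, ψ i v ≤ q) :
    PT q e s x fun i => encNat ((T i).wX (ψ i) (v i)) :=
  PT.getD (ea := fun _ => encNat) (l := fun i => (T i).X) (m := fun i => ψ i (v i)) (d := 0)
    (fun _ => encNat_zero) h.X (hψ.fnApply hv (h.sn.mono fun i => (hvn i).le) hvn)
    ((Small.const q).mono fun i => hq i _)

theorem wY (h : WtPT q e s x T M) {ψ : I → ℕ → ℕ} {a : I → ℕ × ℕ}
    (hψ : PT q e s x fun i => encFn (T i).n (ψ i))
    (ha : PT q e s x fun i => encP unary unary (a i))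
    (han : ∀ i, (a i).1 < (T i).n ∧ (a i).2 < (T i).n) (hq : ∀ i v, ψ i v ≤ q) :
    PT q e s x fun i => encNat ((T i).wY (ψ i) (a i)) :=
  PT.getD (ea := fun _ => encNat) (l := fun i => (T i).Y.getD (ψ i (a i).1) [])
    (m := fun i => ψ i (a i).2) (d := 0) (fun _ => encNat_zero)
    (PT.getD (ea := fun _ => encL encNat) (l := fun i => (T i).Y) (m := fun i => ψ i (a i).1)
      (d := []) (fun _ => rfl) h.Y
      (hψ.fnApply ha.fst (h.sn.mono fun i => (han i).1.le) fun i => (han i).1)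
      ((Small.const q).mono fun i => hq i _))
    (hψ.fnApply ha.snd (h.sn.mono fun i => (han i).2.le) fun i => (han i).2)
    ((Small.const q).mono fun i => hq i _)

theorem smallVal (h : WtPT q e s x T M) : Small s fun i =>
    (q + 1) * (T i).n + M i * ((T i).n + (T i).E.length) + 1 :=
  (((Small.const (q + 1)).mul h.sn).add (h.sM.mul (h.sn.add h.sE))).add (.const 1)

/-- The weight of a colouring of the separator. -/
theorem weight (h : WtPT q e s x T M) {A R : I → List ℕ} {K : I → List (List ℕ)}
    {ψ : I → ℕ → ℕ} (hA : SetPT q e s x (fun i => (T i).n) A)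
    (hR : SetPT q e s x (fun i => (T i).n) R)
    (hK : PT q e s x fun i => encL ((T i).table q) (K i))
    (hKl : ∀ i, (K i).length ≤ (T i).n) (hKn : ∀ i, ∀ C ∈ K i, C.length ≤ (T i).n)
    (hψ : PT q e s x fun i => encFn (T i).n (ψ i)) (hq : ∀ i v, ψ i v ≤ q) :
    PT q e s x fun i => encNat ((T i).wtOff (A i) (R i) (ψ i) *
      ((K i).map fun C => (T i).val q C (ψ i)).prod) := by
  have h1 : PT q e s x fun i => encL encNat ((A i).map ((T i).wX (ψ i))) :=
    PT.map (ea := fun _ => unary) hA.pt hA.len fun _ hx hv =>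
      (h.via hx).wX (hψ.via hx) hv (fun j => hA.lt _ _ j.h) fun j => hq j.i
  have hlf : Small s fun i => ((T i).E.filter fun e => touches (A i) e && !touches (R i) e).length :=
    h.sE.mono fun i => List.length_filter_le _ _
  have h2 : PT q e s x fun i => encL encNat (((T i).E.filter fun e =>
      touches (A i) e && !touches (R i) e).map ((T i).wY (ψ i))) := by
    refine PT.map (ea := fun _ => encP unary unary) (PT.filter (ea := fun _ => encP unary unary)
      (l := fun i => (T i).E) h.E h.sE fun _ hx ha => ?_) hlf fun _ hx ha =>
      (h.via hx).wY (hψ.via hx) ha (fun j => h.lt _ _ (List.mem_filter.1 j.h).1) fun j => hq j.i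
    exact (((hA.via hx).contains ha.fst fun j => (h.lt _ _ j.h).1).or
      ((hA.via hx).contains ha.snd fun j => (h.lt _ _ j.h).2)).and
      (((hR.via hx).contains ha.fst fun j => (h.lt _ _ j.h).1).or
      ((hR.via hx).contains ha.snd fun j => (h.lt _ _ j.h).2)).not
  have hKs : Small s fun i => (K i).length := h.sn.mono hKl
  have h3 : PT q e s x fun i => encL encNat ((K i).map fun C => (T i).val q C (ψ i)) := by
    refine PT.map (ea := fun i => (T i).table q) hK hKs fun _ hx ha =>
      (PT.lookup (l := fun j => (List.range (T j.i).n).map (ψ j.i)) ha (hψ.via hx) ?_ ?_).congr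
      fun j => Net.lookup_table (h.lt j.i) _ (hq j.i)
    · simpa using h.sn.comap fun j : MemIdx K => j.i
    · intro j c hc
      obtain ⟨v, _, rfl⟩ := List.mem_map.1 hc
      exact hq _ _
  refine (PT.natProd (h1.append (h2.append h3 (by simpa using hlf.toW)) (by
    simpa using hA.len.toW)) (by simpa using hA.len.add (hlf.add hKs)) ?_).congr fun i => by
    rw [List.prod_append, List.prod_append, ← mul_assoc, Net.wtOff]
  refine Small.comapLe (g := MemIdx.i) (h.sM.add h.smallVal) ?_
  rintro ⟨i, a, ha⟩
  simp only [List.mem_append, List.mem_map] at ha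
  rcases ha with ⟨v, _, rfl⟩ | ⟨v, _, rfl⟩ | ⟨C, hC, rfl⟩
  · exact le_add_right (Nat.size_le.2 (Net.wX_lt (h.ltX i) _ _))
  · exact le_add_right (Nat.size_le.2 (Net.wY_lt (h.ltY i) _ _))
  · exact le_add_left (Net.size_val_le (h.ltX i) (h.ltY i) (hKn i C hC) _)

/-- The exponents of the enumerations over `B \ C` and `B ∩ C` add up to at most the length of `B`,
which keeps the cost of a table at `(q + 1) ^ |B|`. `B` may contain repetitions; the two filtered
lists do not. -/
theorem length_sep_le {n : ℕ} {B C : List ℕ} (hC : C.Nodup) :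
    ((List.range n).filter fun v => B.contains v && !C.contains v).length +
      (C.filter fun v => B.contains v).length ≤ B.length := by
  rw [← List.length_append]
  refine (List.subperm_of_subset ?_ fun v hv => ?_).length_le
  · rw [List.nodup_append]
    refine ⟨List.nodup_range.filter _, hC.filter _, fun a ha b hb hab => ?_⟩
    subst hab
    have h1 := (List.mem_filter.1 ha).2
    have h2 := (List.mem_filter.1 hb).1
    simp [h2] at h1
  · rcases List.mem_append.1 hv with h | h
    · have := (List.mem_filter.1 h).2
      simp only [Bool.and_eq_true, List.contains_iff_mem] at this
      exact this.1
    · simpa using (List.mem_filter.1 h).2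

/-- One entry of a table. -/
theorem entry {B C : I → List ℕ} {φ : I → ℕ → ℕ} (h : WtPT q (fun _ => 0) s x T M)
    (hC : SetPT q (fun _ => 0) s x (fun i => (T i).n) C)
    (hB : SetPT q (fun _ => 0) s x (fun i => (T i).n) B) (hCn : ∀ i, (C i).Nodup)
    (hK : PT q (fun _ => 0) s x fun i => encL ((T i).table q)
      ((T i).comps ((C i).filter fun v => !(B i).contains v)))
    (hφ : PT q (fun _ => 0) s x fun i => encFn (T i).n (φ i)) (hq : ∀ i v, φ i v ≤ q) :
    PT q (fun i => ((C i).filter fun v => (B i).contains v).length) s x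
      fun i => encNat ((T i).val q (C i) (φ i)) := by
  have hA : SetPT q (fun _ => 0) s x (fun i => (T i).n) fun i =>
      (C i).filter fun v => (B i).contains v :=
    hC.filter' fun _ hx hv => (hB.via hx).contains hv fun j => hC.lt _ _ j.h
  have hR : SetPT q (fun _ => 0) s x (fun i => (T i).n) fun i =>
      (C i).filter fun v => !(B i).contains v :=
    hC.filter' fun _ hx hv => ((hB.via hx).contains hv fun j => hC.lt _ _ j.h).not
  have hlen : SmallW q (fun i => ((C i).filter fun v => (B i).contains v).length) s fun i =>
      (HomPoly.ext q ((C i).filter fun v => (B i).contains v) (φ i)).length := smallW_ext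
  -- The product over the components is `val` of `C \ B`; summing over the colourings of `B ∩ C`
  -- then gives `val` of `C`.
  have hval : ∀ i, ((HomPoly.ext q ((C i).filter fun v => (B i).contains v) (φ i)).map fun ψ =>
      (T i).wtOff ((C i).filter fun v => (B i).contains v)
        ((C i).filter fun v => !(B i).contains v) ψ *
        (((T i).comps ((C i).filter fun v => !(B i).contains v)).map
          fun D => (T i).val q D ψ).prod).sum = (T i).val q (C i) (φ i) := by
    intro i
    rw [sum_ext]
    simp only [← Net.val_comps (q := q) (T := T i) (fun v hv => hR.lt i v hv) ((hCn i).filter _)]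
    rw [← Net.val_split]
  refine (PT.natSum (PT.mapW (ea := fun i => encFn (T i).n) (eb := fun _ => encNat)
    (e1 := fun i => ((C i).filter fun v => (B i).contains v).length) (e2 := fun _ => 0)
    (l := fun i => HomPoly.ext q ((C i).filter fun v => (B i).contains v) (φ i))
    (g := fun i ψ => (T i).wtOff ((C i).filter fun v => (B i).contains v)
        ((C i).filter fun v => !(B i).contains v) ψ *
        (((T i).comps ((C i).filter fun v => !(B i).contains v)).map
          fun D => (T i).val q D ψ).prod)
    (fun i => le_rfl) (PT.ext h.n hφ hA.pt h.sn hA.len hA.lt) hlen fun x' hx hψ => ?_)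
    (by simpa using hlen) ?_).congr fun i => by rw [hval]
  · exact (h.via hx).weight (hA.via hx) (hR.via hx) (hK.via hx) (fun j => NetPT.length_comps)
      (fun j D hD => length_le_of_nodup (NetPT.comps_lt hD).2 (NetPT.comps_lt hD).1) hψ
      fun j => ext_le (hq j.i) j.h
  · refine h.smallVal.mono fun i => ?_
    rw [hval]
    exact Net.size_val_le (h.ltX _) (h.ltY _) (length_le_of_nodup (hCn _) (hC.lt _)) _

/-- The table of a set from the tables of the components that remain after deleting a separator. -/
theorem table {B C : I → List ℕ} (h : WtPT q (fun _ => 0) s x T M)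
    (hC : SetPT q (fun _ => 0) s x (fun i => (T i).n) C)
    (hB : SetPT q (fun _ => 0) s x (fun i => (T i).n) B) (hCn : ∀ i, (C i).Nodup)
    (hcl : ∀ i, (T i).closed (C i) (B i) = true)
    (hK : PT q (fun _ => 0) s x fun i => encL ((T i).table q)
      ((T i).comps ((C i).filter fun v => !(B i).contains v))) :
    PT q (fun i => (B i).length) s x fun i => (T i).table q (C i) := by
  have hU : SetPT q (fun _ => 0) s x (fun i => (T i).n) fun i =>
      (List.range (T i).n).filter fun v => (B i).contains v && !(C i).contains v :=
    SetPT.filter h.n h.sn fun _ hx hv =>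
      ((hB.via hx).contains hv fun j => List.mem_range.1 j.h).and
      ((hC.via hx).contains hv fun j => List.mem_range.1 j.h).not
  have h0 : PT q (fun _ => 0) s x fun i => encFn (T i).n fun _ => 0 :=
    PT.map (ea := fun _ => unary) (h.n.range h.sn) (by simpa using h.sn) fun _ _ _ => .const .nil
  have hext := PT.ext h.n h0 hU.pt h.sn hU.len hU.lt
  have hlen : SmallW q (fun i => ((List.range (T i).n).filter
      fun v => (B i).contains v && !(C i).contains v).length) s fun i => (HomPoly.ext q
      ((List.range (T i).n).filter fun v => (B i).contains v && !(C i).contains v)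
      fun _ => 0).length := smallW_ext
  have hle := fun i => length_sep_le (n := (T i).n) (B := B i) (hCn i)
  have hleaves : PT q (fun i => (B i).length) s x fun i => encL encNat
      ((HomPoly.ext q ((List.range (T i).n).filter
        fun v => (B i).contains v && !(C i).contains v) fun _ => 0).map ((T i).val q (C i))) := by
    -- The colourings of `B \ C` are enumerated, and each entry has the exponent `|B ∩ C|`.
    refine PT.mapW (ea := fun i => encFn (T i).n)
      (e1 := fun i => ((List.range (T i).n).filter
        fun v => (B i).contains v && !(C i).contains v).length)
      (e2 := fun i => ((C i).filter fun v => (B i).contains v).length) hle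
      (hext.mono fun i => (Nat.le_add_right _ _).trans (hle i)) hlen fun x' hx hφ => ?_
    exact (h.via hx).entry (hC.via hx) (hB.via hx) (fun j => hCn j.i) (hK.via hx) hφ fun j =>
      ext_le (fun _ => Nat.zero_le _) j.h
  have hb := (PT.build (p := fun i v => (B i).contains v && !(C i).contains v) h.n.up
    (hleaves.congr fun i => by rw [← encL_map (fun d => d) encNat, encL, List.map_id'])
    (by simpa using hlen.monoW fun i => (Nat.le_add_right _ _).trans (hle i)) h.sn
    fun _ hx hv => (((hB.via hx).contains hv fun j => List.mem_range.1 j.h).and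
      ((hC.via hx).contains hv fun j => List.mem_range.1 j.h).not).up).hd
  refine hb.congr fun i => ?_
  have hbe := build_eq (q := q) (p := fun v => (B i).contains v && !(C i).contains v)
    (f := (T i).val q (C i)) (φ := fun _ => 0) 0 (T i).n ?_
  · rw [List.map_map]
    simp only [trie] at hbe
    rw [show (encNat ∘ (T i).val q (C i)) = fun φ => encNat ((T i).val q (C i) φ) from rfl, hbe]
    rfl
  -- Colours outside `B \ C` are irrelevant: by closedness every neighbour of `C` outside `C` lies
  -- in `B`.
  · intro v hv hp χ c
    refine Net.val_congr fun a ha hta w hwC hw => Function.update_of_ne ?_ _ _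
    rintro rfl
    have hcl' := hcl i
    simp only [Net.closed, List.all_eq_true, Bool.and_eq_true, Bool.or_eq_true,
      Bool.not_eq_true', List.contains_iff_mem] at hcl'
    have hwB : w ∉ B i := by simpa [hwC] using hp
    simp only [touches, Bool.or_eq_true, List.contains_iff_mem] at hta
    have := hcl' a ha
    rcases hw with rfl | rfl
    · have h2 := hta.resolve_left hwC
      exact (this.2.resolve_left (by simpa using h2)).elim hwC hwB
    · have h2 := hta.resolve_right hwC
      exact (this.1.resolve_left (by simpa using h2)).elim hwC hwB

end WtPT

/-! ### The program for saturation -/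

theorem length_flatMap_le {α β : Type} {l : List α} {f : α → List β} {m : ℕ}
    (h : ∀ a ∈ l, (f a).length ≤ m) : (l.flatMap f).length ≤ l.length * m := by
  induction l with
  | nil => simp
  | cons a l ih =>
    have := ih fun b hb => h b (by simp [hb])
    have := h a (by simp)
    simp only [List.flatMap_cons, List.length_append, List.length_cons, Nat.add_mul]
    omega

/-- The families `S i` of sets of vertices are computable, and their elements have at most `w i`
elements. -/
structure SepPT (q : ℕ) {I : Type} (s : I → ℕ) (x : I → Data) (n w : I → ℕ)
    (S : I → List (List ℕ)) : Prop where
  pt : PT q (fun _ => 0) s x fun i => encL (encL unary) (S i)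
  len : Small s fun i => (S i).length
  lt : ∀ i, ∀ B ∈ S i, ∀ v ∈ B, v < n i
  sw : Small s w
  le : ∀ i, ∀ B ∈ S i, B.length ≤ w i

variable {q : ℕ} {I J : Type} {e s : I → ℕ} {x : I → Data} {T : I → Net} {M w : I → ℕ}
  {S : I → List (List ℕ)}

theorem SepPT.via {n : I → ℕ} (h : SepPT q s x n w S) {g : J → I} {x' : J → Data}
    (hx : PT q (fun _ => 0) (fun j => s (g j)) x' (fun j => x (g j))) :
    SepPT q (fun j => s (g j)) x' (fun j => n (g j)) (fun j => w (g j)) (fun j => S (g j)) :=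
  ⟨h.pt.via hx, h.len.comap g, fun j => h.lt (g j), h.sw.comap g, fun j => h.le (g j)⟩

namespace NetPT

theorem sep {g : J → I} {x' : J → Data} {B : J → List ℕ} (h : NetPT q (fun _ => 0) s x T)
    (hS : SepPT q s x (fun i => (T i).n) w S)
    (hB : PT q (fun _ => 0) (fun j => s (g j)) x' fun j => encL unary (B j))
    (hBS : ∀ j, B j ∈ S (g j)) :
    SetPT q (fun _ => 0) (fun j => s (g j)) x' (fun j => (T (g j)).n) B :=
  ⟨hB, fun j => hS.lt _ _ (hBS j), h.sn.comap g, hS.sw.comapLe fun j => hS.le _ _ (hBS j)⟩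

theorem length_off {T : Net} {B : List ℕ} : (T.off B).length ≤ T.n :=
  (List.length_filter_le _ _).trans_eq List.length_range

theorem cands (h : NetPT q (fun _ => 0) s x T) (hS : SepPT q s x (fun i => (T i).n) w S) :
    PT q (fun _ => 0) s x fun i => encL (encL unary) ((T i).cands (S i)) := by
  refine PT.flatMap (ea := fun _ => encL unary) hS.pt hS.len (h.sn.comapLe fun j => ?_)
    fun x' hx hB => ?_
  · rw [List.length_map]
    exact length_off
  · have hoff := (h.via hx).off (h.sep hS hB fun j => j.h)
    exact PT.map (ea := fun _ => unary) hoff.pt hoff.len fun x'' hx' hu =>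
      ((((h.via hx).via hx').reach (hoff.via hx') hu fun j => hoff.lt _ _ j.h).pt)

theorem length_cands {T : Net} {S : List (List ℕ)} : (T.cands S).length ≤ S.length * T.n :=
  length_flatMap_le fun B _ => by rw [List.length_map]; exact length_off

theorem length_pairs {T : Net} {S : List (List ℕ)} :
    (T.pairs S).length ≤ S.length * T.n * S.length :=
  (length_flatMap_le fun C _ => by rw [List.length_map]).trans
    (Nat.mul_le_mul_right _ length_cands)

theorem pairs (h : NetPT q (fun _ => 0) s x T) (hS : SepPT q s x (fun i => (T i).n) w S) :
    PT q (fun _ => 0) s x fun i => encL (encP (encL unary) (encL unary)) ((T i).pairs (S i)) := by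
  refine PT.flatMap (ea := fun _ => encL unary) (h.cands hS) ((hS.len.mul h.sn).mono fun i =>
    length_cands) (hS.len.comapLe fun j => by rw [List.length_map]) fun x' hx hC => ?_
  exact PT.map (ea := fun _ => encL unary) (hS.pt.via hx) (hS.len.comap _) fun x'' hx' hB =>
    ((hC (e' := fun _ => 0)).via hx').cons hB

theorem length_attempts {T : Net} {S : List (List ℕ)} :
    (T.attempts S).length ≤ T.n * (S.length * T.n * S.length) + 1 := by
  rw [Net.attempts, List.length_append]
  refine Nat.add_le_add_right ((length_flatMap_le fun C _ => length_pairs).trans_eq ?_) _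
  rw [List.length_range]

theorem smallAttempts (h : NetPT q (fun _ => 0) s x T) (hS : SepPT q s x (fun i => (T i).n) w S) :
    Small s fun i => ((T i).attempts (S i)).length :=
  ((h.sn.mul ((hS.len.mul h.sn).mul hS.len)).add (.const 1)).mono fun _ => length_attempts

theorem attempts (h : NetPT q (fun _ => 0) s x T) (hS : SepPT q s x (fun i => (T i).n) w S) :
    PT q (fun _ => 0) s x
      fun i => encL (encP (encL unary) (encL unary)) ((T i).attempts (S i)) := by
  have hlen : Small s fun i => ((List.range (T i).n).flatMap fun _ => (T i).pairs (S i)).length :=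
    (h.sn.mul ((hS.len.mul h.sn).mul hS.len)).mono fun i =>
      (length_flatMap_le fun C _ => length_pairs).trans_eq (by rw [List.length_range])
  refine PT.append (ea := fun _ => encP (encL unary) (encL unary)) ?_
    (((h.n.range h.sn).cons (.const .nil)).cons (.const .nil)) hlen.toW
  exact PT.flatMap (ea := fun _ => unary) (h.n.range h.sn) (by simpa using h.sn)
    (((hS.len.mul h.sn).mul hS.len).comapLe fun j => length_pairs)
    fun _ hx _ => (h.via hx).pairs (hS.via hx)

theorem mem_attempts {T : Net} {S : List (List ℕ)} {p : List ℕ × List ℕ}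
    (hp : p ∈ T.attempts S) : (∀ v ∈ p.1, v < T.n) ∧ p.1.Nodup ∧ (p.2 ∈ S ∨ p.2 = []) := by
  rw [Net.attempts, List.mem_append] at hp
  rcases hp with hp | hp
  · obtain ⟨_, _, hp⟩ := List.mem_flatMap.1 hp
    obtain ⟨C, hC, hp⟩ := List.mem_flatMap.1 hp
    obtain ⟨B, hB, rfl⟩ := List.mem_map.1 hp
    have := Net.mem_cands.1 hC
    exact ⟨this.lt, this.nodup, .inl hB⟩
  · rw [List.mem_singleton] at hp
    subst hp
    exact ⟨fun v hv => List.mem_range.1 hv, List.nodup_range, .inr rfl⟩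

/-- The same set may be entered repeatedly, so the length is bounded by the number of attempts,
which is still polynomial. -/
theorem foldl_attempt (T : Net) (l : List (List ℕ × List ℕ)) :
    (l.foldl T.attempt []).length ≤ l.length ∧
      ∀ C ∈ l.foldl T.attempt [], ∃ p ∈ l, C = p.1 := by
  induction l using List.reverseRecOn with
  | nil => simp
  | append_singleton l p ih =>
    have h2 : ∀ C ∈ l.foldl T.attempt [], ∃ p' ∈ l ++ [p], C = p'.1 := fun C hC =>
      let ⟨p', hp', h⟩ := ih.2 C hC
      ⟨p', by simp [hp'], h⟩
    simp only [List.foldl_append, List.foldl_cons, List.foldl_nil, List.length_append,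
      List.length_singleton]
    rw [Net.attempt]
    split
    · refine ⟨by simpa using ih.1, fun C hC => ?_⟩
      rcases List.mem_cons.1 hC with rfl | hC
      · exact ⟨p, by simp, rfl⟩
      · exact h2 C hC
    · exact ⟨by omega, h2⟩

end NetPT

/-- A solved set together with its table. -/
def Net.encSolved (T : Net) (q : ℕ) (C : List ℕ) : Data := .cons (encL unary C) (T.table q C)

namespace WtPT

/-- Search in the list of the solved sets. -/
theorem find {D : I → List ℕ} {L : I → List (List ℕ)} (h : WtPT q e s x T M)
    (hD : SetPT q e s x (fun i => (T i).n) D)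
    (hL : PT q e s x fun i => encL ((T i).encSolved q) (L i))
    (hLs : Small s fun i => (L i).length)
    (hLn : ∀ i, ∀ C ∈ L i, (∀ v ∈ C, v < (T i).n) ∧ C.Nodup) :
    PT q e s x (fun i => encBool ((L i).contains (D i))) ∧
      PT q e s x fun i => if D i ∈ L i then (T i).table q (D i) else .nil := by
  constructor
  · refine (PT.any (ea := fun i => (T i).encSolved q) (p := fun i C => D i == C) hL hLs
      fun x' hx hC => ?_).congr fun i => by rw [← List.contains_eq_any_beq]
    exact PT.listEq (hD.via hx) ⟨hC.fst, fun j => (hLn _ _ j.h).1, h.sn.comap _,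
      h.sn.comapLe fun j => length_le_of_nodup (hLn _ _ j.h).2 (hLn _ _ j.h).1⟩
  · have key : ∀ (T : Net) (D : List ℕ) (L : List (List ℕ)) (d : Data),
        L.foldl (fun d C => if D == C then T.table q C else d) d =
          if D ∈ L then T.table q D else d := by
      intro T D L
      induction L with
      | nil => simp
      | cons C L ih =>
        intro d
        rw [List.foldl_cons, ih]
        by_cases h1 : D = C
        · subst h1
          simp
        · by_cases h2 : D ∈ L <;> simp [h1, h2]
    refine (PT.foldLight (ea := fun i => (T i).encSolved q) (es := fun _ d => d)
      (f := fun i d C => if D i == C then (T i).table q C else d) (st := fun _ => .nil) hL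
      (.const .nil) hLs fun x' hx hd hC => ?_).congr fun i => key _ _ _ _
    exact PT.ite (b := fun j => D j.i == j.a) (PT.listEq (n := fun j => (T j.i).n) (hD.via hx)
      ⟨hC.fst, fun j => (hLn _ _ j.mem).1, h.sn.comap _,
      h.sn.comapLe fun j => length_le_of_nodup (hLn _ _ j.mem).2 (hLn _ _ j.mem).1⟩)
      hC.snd hd (fun j hj => by rw [if_pos hj]) (fun j hj => by rw [if_neg (by simp only [hj]; simp)])

theorem attempt {C B : I → List ℕ} {L : I → List (List ℕ)} (h : WtPT q (fun _ => 0) s x T M)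
    (hC : SetPT q (fun _ => 0) s x (fun i => (T i).n) C)
    (hB : SetPT q (fun _ => 0) s x (fun i => (T i).n) B) (hCn : ∀ i, (C i).Nodup)
    (hL : PT q (fun _ => 0) s x fun i => encL ((T i).encSolved q) (L i))
    (hLs : Small s fun i => (L i).length)
    (hLn : ∀ i, ∀ C ∈ L i, (∀ v ∈ C, v < (T i).n) ∧ C.Nodup) :
    PT q (fun i => (B i).length) s x
      fun i => encL ((T i).encSolved q) ((T i).attempt (L i) (C i, B i)) := by
  have hR : SetPT q (fun _ => 0) s x (fun i => (T i).n) fun i =>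
      (C i).filter fun v => !(B i).contains v :=
    hC.filter' fun _ hx hv => ((hB.via hx).contains hv fun j => hC.lt _ _ j.h).not
  have hcomps := h.comps hR
  have hcs : Small s fun i => ((T i).comps ((C i).filter fun v => !(B i).contains v)).length :=
    h.sn.mono fun i => NetPT.length_comps
  have hD : ∀ x' : MemIdx (fun i => (T i).comps ((C i).filter fun v => !(B i).contains v)) → Data,
      (∀ {e'}, PT q e' (fun j => s j.i) x' (fun j => x j.i)) →
      (∀ {e'}, PT q e' (fun j => s j.i) x' (fun j => encL unary j.a)) →
      SetPT q (fun _ => 0) (fun j => s j.i) x' (fun j => (T j.i).n) fun j => j.a :=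
    fun x' hx hD => ⟨hD, fun j => (NetPT.comps_lt j.h).1, h.sn.comap _, h.sn.comapLe fun j =>
      length_le_of_nodup (NetPT.comps_lt j.h).2 (NetPT.comps_lt j.h).1⟩
  have hcond := (h.closed hC hB).and (PT.all (ea := fun _ => encL unary)
    (p := fun i D => (L i).contains D) hcomps hcs fun x' hx ha =>
      ((h.via hx).find (hD x' hx ha) (hL.via hx) (hLs.comap _) fun j => hLn j.i).1)
  -- Closedness and the presence of all required tables are known only where the test succeeds;
  -- therefore that branch is analysed on a subtype of the indices.
  refine PT.iteSub hcond.up ?_ (PT.congr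
    (PT.comap (e := fun i => (B i).length) hL.up Subtype.val) fun j => ?_)
  swap
  · rw [Net.attempt, if_neg (by rw [j.2]; exact Bool.false_ne_true)]
  have hid : PT q (fun _ => 0) (fun j : {i // ((T i).closed (C i) (B i) &&
      ((T i).comps ((C i).filter fun v => !(B i).contains v)).all fun D => (L i).contains D) = true} =>
      s j) (fun j => x j) (fun j => x j) := PT.id
  have hmem : ∀ j : {i // ((T i).closed (C i) (B i) &&
      ((T i).comps ((C i).filter fun v => !(B i).contains v)).all fun D => (L i).contains D) = true},
      (T j).closed (C j) (B j) = true ∧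
      ∀ D ∈ (T j).comps ((C j).filter fun v => !(B j).contains v), D ∈ L j := by
    intro j
    have := j.2
    rw [Bool.and_eq_true, List.all_eq_true] at this
    exact ⟨this.1, fun D hD => by simpa using this.2 D hD⟩
  refine PT.congr (PT.cons (PT.cons (hC.pt.via hid).up ((h.via hid).table (hC.via hid) (hB.via hid)
    (fun j => hCn j) (fun j => (hmem j).1) ?_)) (hL.via hid).up) fun j => by
      rw [Net.attempt, if_pos j.2]; rfl
  have hfind := (PT.map (ea := fun _ => encL unary) (eb := fun _ d => d)
    (g := fun i D => if D ∈ L i then (T i).table q D else .nil) hcomps hcs fun x' hx ha =>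
      ((h.via hx).find (hD x' hx ha) (hL.via hx) (hLs.comap _) fun j => hLn j.i).2).via hid
  refine hfind.congr fun j => ?_
  rw [encL_map]
  exact encL_congr fun D hD => if_pos ((hmem j).2 D hD)

/-- The tables of all solved sets. -/
theorem solved (h : WtPT q (fun _ => 0) s x T M) (hS : SepPT q s x (fun i => (T i).n) w S) :
    PT q w s x fun i => encL ((T i).encSolved q) ((T i).solved (S i)) := by
  refine PT.foldLight (ea := fun _ => encP (encL unary) (encL unary))
    (es := fun i => encL ((T i).encSolved q)) (f := fun i => (T i).attempt) (st := fun _ => [])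
    (h.attempts hS).up (.const .nil) (h.smallAttempts hS) fun x' hx hL hp => ?_
  have hm := fun j : FoldIdx fun i => (T i).attempts (S i) => NetPT.mem_attempts j.mem
  have hBlt : ∀ j : FoldIdx fun i => (T i).attempts (S i), ∀ v ∈ j.a.2, v < (T j.i).n := by
    intro j v hv
    rcases (hm j).2.2 with h' | h'
    · exact hS.lt _ _ h' v hv
    · simp [h'] at hv
  have hBle : ∀ j : FoldIdx fun i => (T i).attempts (S i), j.a.2.length ≤ w j.i := by
    intro j
    rcases (hm j).2.2 with h' | h'
    · exact hS.le _ _ h'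
    · simp [h']
  refine ((h.via hx).attempt (C := fun j => j.a.1) (B := fun j => j.a.2)
    (L := fun j => j.pre.foldl (T j.i).attempt [])
    ⟨hp.fst, fun j => (hm j).1, h.sn.comap _, h.sn.comapLe fun j =>
      length_le_of_nodup (hm j).2.1 (hm j).1⟩
    ⟨hp.snd, hBlt, h.sn.comap _, hS.sw.comapLe hBle⟩ (fun j => (hm j).2.1) hL
    ((h.smallAttempts hS).comapLe fun j => ?_) fun j C hC => ?_).mono hBle
  · exact (NetPT.foldl_attempt (T j.i) j.pre).1.trans j.pre_prefix.length_le
  · obtain ⟨p, hp, rfl⟩ := (NetPT.foldl_attempt (T j.i) j.pre).2 C hC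
    have := NetPT.mem_attempts (j.pre_prefix.subset hp)
    exact ⟨this.1, this.2.1⟩

/-- The partition function. -/
theorem partition (h : WtPT q (fun _ => 0) s x T M) (hS : SepPT q s x (fun i => (T i).n) w S)
    (hsol : ∀ i, ∃ L, (T i).solved (S i) = List.range (T i).n :: L) :
    PT q w s x fun i => encNat ((T i).val q (List.range (T i).n) fun _ => 0) := by
  have h0 : PT q w s x fun i => encL unary ((List.range (T i).n).map fun _ => 0) :=
    PT.map (ea := fun _ => unary) (h.n.range h.sn).up (by simpa using h.sn) fun _ _ _ => .const .nil
  -- The last attempt puts the set of all vertices at the head of the list; its table is read at the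
  -- zero colouring.
  refine (PT.lookup ((h.solved hS).hd.tl) h0 (by simpa using h.sn) fun i c hc => ?_).congr
    fun i => ?_
  · obtain ⟨_, _, rfl⟩ := List.mem_map.1 hc
    exact Nat.zero_le _
  · obtain ⟨L, hL⟩ := hsol i
    rw [hL]
    exact Net.lookup_table (h.lt i) _ fun _ => Nat.zero_le _

end WtPT

/-! ### The homomorphism polynomial as a partition function -/

section Homs

variable {q n : ℕ}

/-- A colouring of `Fin n`, extended by `0`. -/
def extendZero {q n : ℕ} (φ : Fin n → Fin (q + 1)) (v : ℕ) : ℕ :=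
  if h : v < n then φ ⟨v, h⟩ else 0

theorem extendZero_apply (φ : Fin n → Fin (q + 1)) (v : Fin n) : extendZero φ v = φ v := by
  simp [extendZero]

theorem sumOver_range (F : (ℕ → ℕ) → ℕ) :
    sumOver q (List.range n) F (fun _ => 0) = ∑ φ : Fin n → Fin (q + 1), F (extendZero φ) := by
  induction n generalizing F with
  | zero =>
    simp only [List.range_zero, sumOver, Finset.univ_unique, Finset.sum_singleton]
    congr 1
  | succ n ih =>
    rw [List.range_succ, sumOver_append, ih, ← (Fin.snocEquiv fun _ => Fin (q + 1)).sum_comp,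
      Fintype.sum_prod_type_right]
    refine Finset.sum_congr rfl fun φ _ => ?_
    simp only [sumOver]
    rw [← List.sum_toFinset _ List.nodup_range, List.toFinset_range, Finset.sum_range]
    refine Finset.sum_congr rfl fun c _ => congrArg F (funext fun v => ?_)
    rcases lt_trichotomy v n with h | rfl | h
    · have h1 : v < n + 1 := by omega
      simp [extendZero, Fin.snoc, Function.update_of_ne h.ne, h, h1]
    · simp [extendZero, Fin.snoc]
    · simp [extendZero, Function.update_of_ne h.ne', show ¬ v < n by omega,
        show ¬ v < n + 1 by omega]

/-- The edges of a graph with adjacency matrix `A`, each once. -/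
def edgeList (n : ℕ) (A : List (List Bool)) : List (ℕ × ℕ) :=
  (List.range n).flatMap fun u => ((List.range n).filter fun v =>
    decide (u < v) && (A.getD u []).getD v false).map fun v => (u, v)

theorem mem_edgeList {A : List (List Bool)} {e : ℕ × ℕ} : e ∈ edgeList n A ↔
    e.1 < e.2 ∧ e.2 < n ∧ (A.getD e.1 []).getD e.2 false = true := by
  obtain ⟨u, v⟩ := e
  simp only [edgeList, List.mem_flatMap, List.mem_map, List.mem_filter, List.mem_range,
    Bool.and_eq_true, decide_eq_true_eq, Prod.mk.injEq]
  constructor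
  · rintro ⟨u', hu, v', hv, rfl, rfl⟩
    exact ⟨hv.2.1, hv.1, hv.2.2⟩
  · rintro ⟨h1, h2, h3⟩
    exact ⟨u, by omega, v, ⟨h2, h1, h3⟩, rfl, rfl⟩

theorem nodup_edgeList {A : List (List Bool)} : (edgeList n A).Nodup := by
  refine List.nodup_flatMap.2 ⟨fun u _ => (List.nodup_range.filter _).map fun _ _ h => by
    simpa using h, List.nodup_range.imp fun {u u'} h => ?_⟩
  simp only [Function.onFun, List.disjoint_left, List.mem_map]
  rintro _ ⟨v, _, rfl⟩ ⟨v', _, h'⟩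
  exact h (Prod.mk.inj h').1.symm

open Classical in
/-- The adjacency matrix. -/
noncomputable def adjMat (G : SimpleGraph (Fin n)) : List (List Bool) :=
  (List.finRange n).map fun i => (List.finRange n).map fun j => decide (G.Adj i j)

theorem getD_finRange {α : Type} (f : Fin n → α) (v : Fin n) (d : α) :
    ((List.finRange n).map f).getD v d = f v := by
  rw [List.getD_eq_getElem _ _ (by simp)]
  simp

theorem adjMat_getD (G : SimpleGraph (Fin n)) (u v : Fin n) :
    ((adjMat G).getD u []).getD v false = true ↔ G.Adj u v := by
  classical
  rw [adjMat, getD_finRange, getD_finRange, decide_eq_true_iff]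

/-- The network of a graph with given weights. -/
noncomputable def netOf (q : ℕ) (W : Var (q + 1) → ℕ) (G : SimpleGraph (Fin n)) : Net where
  n := n
  E := edgeList n (adjMat G)
  X := (List.finRange (q + 1)).map fun i => W (.inl i)
  Y := (List.finRange (q + 1)).map fun i => (List.finRange (q + 1)).map fun j => W (.inr s(i, j))

theorem mem_netOf_E {W : Var (q + 1) → ℕ} {G : SimpleGraph (Fin n)} {e : ℕ × ℕ} :
    e ∈ (netOf q W G).E ↔ ∃ u v : Fin n, u < v ∧ G.Adj u v ∧ e = (↑u, ↑v) := by
  obtain ⟨a, b⟩ := e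
  rw [netOf, mem_edgeList]
  constructor
  · rintro ⟨h1, h2, h3⟩
    exact ⟨⟨a, h1.trans h2⟩, ⟨b, h2⟩, h1, (adjMat_getD G ⟨a, h1.trans h2⟩ ⟨b, h2⟩).1 h3, rfl⟩
  · rintro ⟨u, v, h1, h2, h3⟩
    obtain ⟨rfl, rfl⟩ := Prod.mk.inj h3
    exact ⟨h1, v.2, (adjMat_getD G u v).2 h2⟩

open Classical in
-- The edge list contains each edge once, smaller end first, so an unordered edge corresponds to the
-- pair of its `inf` and `sup`.
theorem prod_edges (G : SimpleGraph (Fin n)) (W : Var (q + 1) → ℕ) (f : Sym2 (Fin n) → ℕ)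
    (g : ℕ × ℕ → ℕ) (h : ∀ u v : Fin n, g (↑u, ↑v) = f s(u, v)) :
    ((netOf q W G).E.map g).prod = ∏ e ∈ G.edgeFinset, f e := by
  rw [← List.prod_toFinset _ (show (netOf q W G).E.Nodup from nodup_edgeList)]
  symm
  refine Finset.prod_bij (fun e _ => ((e.inf : ℕ), (e.sup : ℕ))) ?_ ?_ ?_ ?_
  · intro e he
    induction e with | _ u v => ?_
    rw [SimpleGraph.mem_edgeFinset, SimpleGraph.mem_edgeSet] at he
    rw [List.mem_toFinset, mem_netOf_E]
    exact ⟨_, _, inf_lt_sup.2 he.ne, by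
      rcases le_total u v with h | h <;> simp [h, he, he.symm], rfl⟩
  · intro e _ e' _ h
    have h1 := Fin.ext (Prod.mk.inj h).1
    have h2 := Fin.ext (Prod.mk.inj h).2
    exact Sym2.inf_eq_inf_and_sup_eq_sup.1 ⟨h1, h2⟩
  · intro e he
    obtain ⟨u, v, h1, h2, rfl⟩ := mem_netOf_E.1 (List.mem_toFinset.1 he)
    exact ⟨s(u, v), by simpa using h2, by simp [h1.le]⟩
  · intro e _
    induction e with | _ u v => ?_
    rw [h]
    congr 1
    rcases le_total u v with h | h <;> simp [h, Sym2.eq_swap]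

/-- The partition function of the network of a graph is the value of its homomorphism
polynomial. -/
theorem val_netOf (G : SimpleGraph (Fin n)) (W : Var (q + 1) → ℕ) :
    (netOf q W G).val q (List.range n) (fun _ => 0) =
      MvPolynomial.eval W (homPoly (q + 1) G) := by
  classical
  rw [Net.val, sumOver_range, homPoly, map_sum]
  refine Finset.sum_congr (by ext; simp) fun φ _ => ?_
  rw [map_mul, map_prod, map_prod, Net.wt]
  congr 1
  · rw [← List.prod_toFinset _ List.nodup_range, List.toFinset_range, Finset.prod_range]
    refine Finset.prod_congr rfl fun v _ => ?_
    rw [Net.wX, extendZero_apply, netOf, getD_finRange, MvPolynomial.eval_X]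
  -- Every edge touches the set of all vertices.
  · rw [List.filter_eq_self.2]
    · rw [prod_edges G W (fun e => W (.inr (e.map φ)))]
      · refine Finset.prod_congr (by congr) fun e _ => by rw [MvPolynomial.eval_X]
      · intro u v
        rw [Net.wY, extendZero_apply, extendZero_apply, netOf, getD_finRange, getD_finRange]
        rfl
    · intro e he
      obtain ⟨u, v, _, _, rfl⟩ := mem_netOf_E.1 he
      simp [touches]

end Homs

/-! ### Coefficients and degrees -/

section Degrees

variable {q n : ℕ} (G : SimpleGraph (Fin n))

open Classical in
/-- The exponent vector of the weight of a homomorphism. -/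
noncomputable def homExp (φ : Fin n → Fin q) : Var q →₀ ℕ :=
  ∑ v, Finsupp.single (.inl (φ v)) 1 + ∑ e ∈ G.edgeFinset, Finsupp.single (.inr (e.map φ)) 1

theorem homPoly_eq : homPoly q G = ∑ φ : Fin n → Fin q, MvPolynomial.monomial (homExp G φ) 1 := by
  classical
  rw [homPoly]
  refine Finset.sum_congr (by ext; simp) fun φ _ => ?_
  rw [homExp, ← mul_one (1 : ℕ), ← MvPolynomial.monomial_mul, MvPolynomial.monomial_sum_one,
    MvPolynomial.monomial_sum_one, mul_one]
  rfl

theorem homExp_le (φ : Fin n → Fin q) (v : Var q) :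
    homExp G φ v ≤ n + n ^ 2 := by
  classical
  have h1 : ∀ (α : Type) (S : Finset α) (f : α → Var q),
      (∑ a ∈ S, Finsupp.single (f a) 1) v ≤ S.card := by
    intro α S f
    rw [Finsupp.finsetSum_apply]
    refine (Finset.sum_le_card_nsmul S _ 1 fun a _ => ?_).trans_eq (by simp)
    rw [Finsupp.single_apply]
    split <;> omega
  rw [homExp, Finsupp.add_apply]
  refine Nat.add_le_add ((h1 _ _ _).trans_eq (by simp)) ((h1 _ _ _).trans ?_)
  exact (G.card_edgeFinset_le_card_choose_two.trans (Nat.choose_le_pow _ _)).trans_eq (by simp)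

theorem coeff_homPoly (m : Var q →₀ ℕ) : (homPoly q G).coeff m ≤ q ^ n ∧
    ((homPoly q G).coeff m ≠ 0 → ∀ v, m v ≤ n + n ^ 2) := by
  classical
  rw [homPoly_eq, MvPolynomial.coeff_sum]
  constructor
  · refine (Finset.sum_le_card_nsmul _ _ 1 fun φ _ => ?_).trans_eq (by simp)
    rw [MvPolynomial.coeff_monomial]
    split <;> omega
  · intro h v
    obtain ⟨φ, _, hφ⟩ := Finset.exists_ne_zero_of_sum_ne_zero h
    rw [MvPolynomial.coeff_monomial, ite_ne_right_iff] at hφ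
    rw [← hφ.1]
    exact homExp_le G φ v

end Degrees

/-! ### Recovering a polynomial from one value -/

section Kronecker

/-- The lists of length `m` with elements less than `R`, in the order of the numbers of which they
are the digits to base `R`. -/
def vecs (R : ℕ) : ℕ → List (List ℕ)
  | 0 => [[]]
  | m + 1 => (vecs R m).flatMap fun r => (List.range R).map fun a => a :: r

theorem mem_vecs {R m : ℕ} {e : List ℕ} : e ∈ vecs R m ↔ e.length = m ∧ ∀ a ∈ e, a < R := by
  induction m generalizing e with
  | zero =>
    simp only [vecs, List.mem_singleton, List.length_eq_zero_iff]
    exact ⟨fun h => ⟨h, by simp [h]⟩, fun h => h.1⟩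
  | succ m ih =>
    simp only [vecs, List.mem_flatMap, List.mem_map, List.mem_range, ih]
    constructor
    · rintro ⟨r, ⟨h1, h2⟩, a, ha, rfl⟩
      exact ⟨by simp [h1], by simpa [ha] using h2⟩
    · rintro ⟨h1, h2⟩
      match e, h1 with
      | a :: r, h1 => exact ⟨r, ⟨by simpa using h1, fun b hb => h2 b (by simp [hb])⟩, a,
          h2 a (by simp), rfl⟩

theorem length_vecs (R m : ℕ) : (vecs R m).length = R ^ m := by
  induction m with
  | zero => rfl
  | succ m ih => simp [vecs, List.length_flatMap, ih, pow_succ]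

theorem nodup_vecs (R m : ℕ) : (vecs R m).Nodup := by
  induction m with
  | zero => simp [vecs]
  | succ m ih =>
    refine List.nodup_flatMap.2 ⟨fun r _ => List.nodup_range.map fun _ _ h => by simpa using h,
      ih.imp fun {r r'} h => ?_⟩
    simp only [Function.onFun, List.disjoint_left, List.mem_map]
    rintro _ ⟨v, _, rfl⟩ ⟨v', _, h'⟩
    exact h (List.cons.inj h').2.symm

theorem ofDigits_flatMap {α : Type} (B k : ℕ) (l : List α) (g : α → List ℕ)
    (hg : ∀ a, (g a).length = k) : Nat.ofDigits B (l.flatMap g) =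
      Nat.ofDigits (B ^ k) (l.map fun a => Nat.ofDigits B (g a)) := by
  induction l with
  | nil => simp
  | cons a l ih => rw [List.flatMap_cons, Nat.ofDigits_append, hg, ih, List.map_cons,
      Nat.ofDigits_cons]

theorem ofDigits_map_range (B R : ℕ) (f : ℕ → ℕ) :
    Nat.ofDigits B ((List.range R).map f) = ((List.range R).map fun a => f a * B ^ a).sum := by
  induction R with
  | zero => simp
  | succ R ih =>
    rw [List.range_succ, List.map_append, Nat.ofDigits_append, ih, List.map_append, List.sum_append]
    simp [mul_comm]

theorem sum_flatMap {α : Type} (l : List α) (g : α → List ℕ) :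
    (l.flatMap g).sum = (l.map fun a => (g a).sum).sum := by
  induction l with
  | nil => rfl
  | cons a l ih => simp [ih]

/-- The first entry varies fastest, so a vector stands at the position whose base `R` digits it
lists. In the induction, `R` consecutive digits to base `B` form one digit to base `B ^ R`. -/
theorem ofDigits_vecs (B R m : ℕ) (c : List ℕ → ℕ) : Nat.ofDigits B ((vecs R m).map c) =
    ((vecs R m).map fun e => c e * B ^ Nat.ofDigits R e).sum := by
  induction m generalizing B c with
  | zero => simp [vecs]
  | succ m ih =>
    simp only [vecs, List.map_flatMap, List.map_map, Function.comp_def]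
    rw [ofDigits_flatMap B R _ _ fun a => by simp, ih (B ^ R), sum_flatMap]
    congr 1
    refine List.map_congr_left fun r _ => ?_
    rw [ofDigits_map_range, ← List.sum_map_mul_right]
    congr 1
    refine List.map_congr_left fun a _ => ?_
    rw [Nat.ofDigits_cons, pow_add, ← pow_mul, mul_assoc]

variable {q : ℕ}

theorem mem_varList (v : Var q) : v ∈ varList q := by
  rw [varList, List.mem_append]
  rcases v with i | e
  · exact .inl (List.mem_map.2 ⟨i, List.mem_finRange i, rfl⟩)
  · refine .inr ?_
    induction e with | _ i j => ?_
    simp only [List.mem_flatMap, List.mem_map, List.mem_filter, List.mem_finRange, true_and,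
      decide_eq_true_eq]
    rcases le_total i j with h | h
    · exact ⟨i, j, h, rfl⟩
    · exact ⟨j, i, h, by rw [Sym2.eq_swap]⟩

theorem nodup_varList : (varList q).Nodup := by
  refine List.nodup_append'.2 ⟨(List.nodup_finRange q).map Sum.inl_injective,
    List.nodup_flatMap.2 ⟨fun i _ => ?_, (List.nodup_finRange q).imp fun {i i'} h => ?_⟩, ?_⟩
  · refine ((List.nodup_finRange q).filter _).map fun j j' h => ?_
    rcases Sym2.eq_iff.1 (Sum.inr_injective h) with h | ⟨h, h'⟩
    · exact h.2
    · exact h'.trans h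
  · simp only [Function.onFun, List.disjoint_left, List.mem_map, List.mem_filter,
      decide_eq_true_eq]
    rintro _ ⟨j, ⟨_, hj⟩, rfl⟩ ⟨j', ⟨_, hj'⟩, h'⟩
    rcases Sym2.eq_iff.1 (Sum.inr_injective h') with h1 | ⟨h1, h2⟩
    · exact h h1.1.symm
    · exact h (le_antisymm (hj.trans_eq h1.symm) (hj'.trans_eq h2))
  · simp only [List.disjoint_left, List.mem_map, List.mem_flatMap]
    rintro _ ⟨i, _, rfl⟩ ⟨_, _, _, _, h⟩
    cases h

theorem sum_idxOf {α : Type} [DecidableEq α] (R : ℕ) {l : List α} (hl : l.Nodup) (f : α → ℕ) :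
    (l.map fun v => f v * R ^ l.idxOf v).sum = Nat.ofDigits R (l.map f) := by
  induction l with
  | nil => simp
  | cons a l ih =>
    obtain ⟨h1, h2⟩ := List.nodup_cons.1 hl
    rw [List.map_cons, List.sum_cons, List.map_cons, Nat.ofDigits_cons, ← ih h2,
      ← List.sum_map_mul_left]
    congr 1
    · simp
    · congr 1
      refine List.map_congr_left fun v hv => ?_
      rw [List.idxOf_cons_ne _ (by rintro rfl; exact h1 hv), pow_succ]
      ring

theorem getD_map_idxOf {α : Type} [DecidableEq α] {l : List α} {v : α} (h : v ∈ l) (f : α → ℕ) :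
    (l.map f).getD (l.idxOf v) 0 = f v := by
  have := List.idxOf_lt_length_iff.2 h
  rw [List.getD_eq_getElem _ _ (by simpa using this), List.getElem_map, List.getElem_idxOf]

/-- The position of a variable. -/
def varPos (v : Var q) : ℕ := @List.idxOf _ instBEqOfDecidableEq v (varList q)

/-- The monomial with given exponents. -/
noncomputable def toMon (e : List ℕ) : Var q →₀ ℕ :=
  Finsupp.equivFunOnFinite.symm fun v => e.getD (varPos v) 0

theorem varPos_getElem {k : ℕ} (h : k < (varList q).length) : varPos (varList q)[k] = k :=
  @List.Nodup.idxOf_getElem _ instBEqOfDecidableEq _ _ nodup_varList k h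

theorem map_toMon {e : List ℕ} (he : e.length = (varList q).length) :
    (varList q).map (toMon e) = e := by
  refine List.ext_getElem (by simp [he]) fun k h1 h2 => ?_
  rw [List.getElem_map]
  change e.getD (varPos _) 0 = _
  rw [varPos_getElem, List.getD_eq_getElem]

theorem toMon_map (m : Var q →₀ ℕ) : toMon ((varList q).map m) = m :=
  Finsupp.ext fun v => getD_map_idxOf (mem_varList v) m

/-- The weights of the Kronecker substitution. -/
def kronecker (b R : ℕ) (v : Var q) : ℕ := 2 ^ (b * R ^ varPos v)

/-- A monomial `m` takes the value `2 ^ (b * N)`, where `N` has the exponents of `m` as digits to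
base `R`. As the exponents are below `R`, distinct monomials give distinct `N`. -/
theorem eval_kronecker {P : MvPolynomial (Var q) ℕ} {R : ℕ} (b : ℕ)
    (hP : ∀ m, P.coeff m ≠ 0 → ∀ v, m v < R) : MvPolynomial.eval (kronecker b R) P =
      Nat.ofDigits (2 ^ b) ((vecs R (varList q).length).map fun e => P.coeff (toMon e)) := by
  rw [ofDigits_vecs, MvPolynomial.eval_eq', ← List.sum_toFinset _ (nodup_vecs _ _)]
  refine Finset.sum_bij_ne_zero (fun m _ _ => (varList q).map m) (fun m hm _ => ?_)
    (fun m _ _ m' _ _ h => ?_) (fun e he h => ?_) fun m _ _ => ?_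
  · rw [List.mem_toFinset, mem_vecs]
    refine ⟨by simp, fun a ha => ?_⟩
    obtain ⟨v, _, rfl⟩ := List.mem_map.1 ha
    exact hP m (MvPolynomial.mem_support_iff.1 hm) v
  · rw [← toMon_map m, h, toMon_map]
  · have h1 := (mem_vecs.1 (List.mem_toFinset.1 he)).1
    have h2 := left_ne_zero_of_mul h
    refine ⟨toMon e, MvPolynomial.mem_support_iff.2 h2, mul_ne_zero h2 ?_, map_toMon h1⟩
    exact Finset.prod_ne_zero_iff.2 fun v _ => pow_ne_zero _ (pow_ne_zero _ two_ne_zero)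
  · rw [toMon_map]
    congr 1
    refine Eq.trans ?_ (congrArg _ (sum_idxOf R nodup_varList m))
    rw [← pow_mul, ← List.sum_toFinset _ nodup_varList,
      Finset.mul_sum, ← Finset.prod_pow_eq_pow_sum]
    refine Finset.prod_congr ?_ fun v _ => ?_
    · ext v
      simp [mem_varList]
    · rw [kronecker, ← pow_mul, varPos]
      ring_nf

/-- One step of the decoding: the state consists of the remaining number and of the terms found. -/
def decodeStep (b : ℕ) (st : ℕ × List (List ℕ × ℕ)) (e : List ℕ) : ℕ × List (List ℕ × ℕ) :=
  (st.1 / 2 ^ b, if st.1 % 2 ^ b ≠ 0 then (e, st.1 % 2 ^ b) :: st.2 else st.2)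

/-- Since the coefficients are below the base, they are genuine digits and are recovered by repeated
division with remainder. -/
theorem foldl_decodeStep {b : ℕ} (l : List (List ℕ)) {c : List ℕ → ℕ} (hc : ∀ e, c e < 2 ^ b)
    (acc : List (List ℕ × ℕ)) :
    (l.foldl (decodeStep b) (Nat.ofDigits (2 ^ b) (l.map c), acc)).2 =
      ((l.filter fun e => c e ≠ 0).map fun e => (e, c e)).reverse ++ acc := by
  induction l generalizing acc with
  | nil => simp
  | cons e l ih =>
    have h1 : Nat.ofDigits (2 ^ b) ((e :: l).map c) % 2 ^ b = c e := by
      rw [List.map_cons, Nat.ofDigits_cons, Nat.add_mul_mod_self_left]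
      exact Nat.mod_eq_of_lt (hc e)
    have h2 : Nat.ofDigits (2 ^ b) ((e :: l).map c) / 2 ^ b = Nat.ofDigits (2 ^ b) (l.map c) := by
      rw [List.map_cons, Nat.ofDigits_cons, Nat.add_mul_div_left _ _ (by positivity)]
      rw [show ((c e : ℕ) : ℕ) / 2 ^ b = 0 from Nat.div_eq_of_lt (hc e), zero_add]
    rw [List.foldl_cons, decodeStep, h1, h2, ih]
    by_cases h : c e = 0 <;> simp [h]

/-- The decoded list is the expanded form of the polynomial. -/
theorem exists_expansion {P : MvPolynomial (Var q) ℕ} {R b : ℕ}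
    (hP : ∀ m, P.coeff m ≠ 0 → ∀ v, m v < R) (hb : ∀ m, P.coeff m < 2 ^ b) :
    ∃ L, IsExpansion L P ∧ encTerms L = encL (encP (encL encNat) encNat)
      ((vecs R (varList q).length).foldl (decodeStep b)
        (MvPolynomial.eval (kronecker b R) P, [])).2 := by
  rw [eval_kronecker b hP, foldl_decodeStep _ (fun e => hb (toMon e)), List.append_nil]
  set K := (vecs R (varList q).length).filter fun e => P.coeff (toMon e) ≠ 0 with hK
  have hKm : ∀ e ∈ K, (varList q).map (toMon e) = e := fun e he =>
    map_toMon (mem_vecs.1 (List.mem_filter.1 he).1).1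
  refine ⟨(K.map fun e => (toMon e, P.coeff (toMon e))).reverse, ⟨?_, fun m c => ?_⟩, ?_⟩
  · rw [List.nodup_reverse]
    refine ((nodup_vecs _ _).filter _).map_on fun e he e' he' h => ?_
    rw [← hKm e he, (Prod.mk.inj h).1, hKm e' he']
  · simp only [List.mem_reverse, List.mem_map, Prod.mk.injEq]
    constructor
    · rintro ⟨e, he, rfl, rfl⟩
      exact ⟨rfl, by simpa using (List.mem_filter.1 he).2⟩
    · rintro ⟨rfl, h⟩
      refine ⟨(varList q).map m, List.mem_filter.2 ⟨mem_vecs.2 ⟨by simp, fun a ha => ?_⟩, ?_⟩,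
        toMon_map m, by rw [toMon_map]⟩
      · obtain ⟨v, _, rfl⟩ := List.mem_map.1 ha
        exact hP m h v
      · rw [toMon_map]
        simpa using h
  · rw [encTerms, encL, ← List.map_reverse, ← List.map_reverse, List.map_map, List.map_map]
    congr 1
    refine List.map_congr_left fun e he => ?_
    simp only [Function.comp_apply, encP, encMonomial]
    congr 1
    rw [encL]
    conv_rhs => rw [← hKm e (List.mem_reverse.1 he), List.map_map]
    rfl

end Kronecker

/-! ### The program that computes the homomorphism polynomial -/

namespace PT

variable {q : ℕ} {I : Type} {e s : I → ℕ} {x : I → Data}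

/-- Lists of constant length. -/
theorem ofList {β : Type} (l : List β) {g : I → β → Data}
    (h : ∀ b ∈ l, PT q e s x fun i => g i b) : PT q e s x fun i => encL (g i) l := by
  induction l with
  | nil => exact const .nil
  | cons b l ih => exact (h b (by simp)).cons (ih fun b' hb => h b' (by simp [hb]))

theorem vecs {R : I → ℕ} {ea : ℕ → Data} (hr : PT q e s x fun i => encL ea (List.range (R i)))
    (hs : Small s R) (m : ℕ) : PT q e s x fun i => encL (encL ea) (HomPoly.vecs (R i) m) := by
  induction m with
  | zero => exact (const (encL (encL ea) [[]])).congr fun _ => rfl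
  | succ m ih =>
    have hl : Small s fun i => (List.range (R i)).length := by simpa using hs
    refine flatMap (ea := fun _ => encL ea) ih ((hs.pow m).mono fun i =>
      (length_vecs _ _).le) (hs.comapLe (g := MemIdx.i) fun j => by simp) fun x' hx hr' => ?_
    exact map (ea := fun _ => ea) (hr.via hx) (hl.comap _) fun x'' hx' ha =>
      ha.cons ((hr' (e' := fun j => e j.i)).via hx')

/-- The numbers below a bound, in binary. -/
theorem rangeBin {R : I → ℕ} (hR : PT q e s x fun i => unary (R i)) (hs : Small s R) :
    PT q e s x fun i => encL encNat (List.range (R i)) :=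
  (map (ea := fun _ => unary) (eb := fun _ => encNat) (g := fun _ a => a) (hR.range hs)
    (by simpa using hs) fun x' hx ha => ha.toBin (hs.comapLe fun j =>
      (List.mem_range.1 j.h).le)).congr fun i => by rw [List.map_id']

theorem edgeList {n : I → ℕ} {A : I → List (List Bool)} (hn : PT q e s x fun i => unary (n i))
    (hs : Small s n) (hA : PT q e s x fun i => encL (encL encBool) (A i)) :
    PT q e s x fun i => encL (encP unary unary) (HomPoly.edgeList (n i) (A i)) := by
  have hl : Small s fun i => (List.range (n i)).length := by simpa using hs
  refine flatMap (ea := fun _ => unary) (hn.range hs) hl (hs.comapLe (g := MemIdx.i) fun j => ?_)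
    fun x' hx hu => ?_
  · rw [List.length_map]
    exact (List.length_filter_le _ _).trans_eq List.length_range
  · have hsu : Small (fun j : MemIdx fun i => List.range (n i) => s j.i) fun j => j.a :=
      hs.comapLe fun j => (List.mem_range.1 j.h).le
    refine map (ea := fun _ => unary) (filter (ea := fun _ => unary)
      (l := fun j : MemIdx fun i => List.range (n i) => List.range (n j.i)) ((hn.range hs).via hx)
      (hl.comap _) fun x'' hx' hv => ?_)
      ((hl.comap MemIdx.i).mono fun j => List.length_filter_le _ _)
      fun x'' hx' hv => ((hu (e' := fun j => e j.i)).via hx').cons hv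
    have hsv : Small (fun j : MemIdx fun j : MemIdx fun i => List.range (n i) =>
        List.range (n j.i) => s j.i.i) fun j => j.a :=
      (hs.comap fun j : MemIdx fun j : MemIdx fun i => List.range (n i) =>
        List.range (n j.i) => j.i.i).mono fun j => (List.mem_range.1 j.h).le
    have hu' := (hu (e' := fun j => e j.i)).via hx'
    refine (lt hu' hv (hsu.comap _)).and ?_
    exact getD (ea := fun _ => encBool) (d := false) (fun _ => rfl)
      (getD (ea := fun _ => encL encBool) (d := []) (fun _ => rfl) ((hA.via hx).via hx') hu'
        (hsu.comap _)) hv hsv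

theorem decode {b R z : I → ℕ} (m : ℕ) (hb : PT q (fun _ => 0) s x fun i => unary (b i))
    (hbs : Small s b) (hR : PT q e s x fun i => unary (R i)) (hs : Small s R)
    (hz : PT q e s x fun i => encNat (z i)) :
    PT q e s x fun i => encL (encP (encL encNat) encNat)
      ((HomPoly.vecs (R i) m).foldl (decodeStep (b i)) (z i, [])).2 := by
  refine (foldLight (ea := fun _ => encL encNat)
    (es := fun _ => encP encNat (encL (encP (encL encNat) encNat)))
    (f := fun i => decodeStep (b i)) (st := fun i => (z i, [])) ((hR.rangeBin hs).vecs hs m) (hz.cons (const .nil))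
    ((hs.pow m).mono fun i => (length_vecs _ _).le) fun x' hx hst he => ?_).snd
  have hd := divMod (e := fun j => e j.i) (a := fun j : FoldIdx fun i => HomPoly.vecs (R i) m => (j.pre.foldl (decodeStep (b j.i)) (z j.i, [])).1)
    hst.fst (via (e := e) hb.up hx) (hbs.comap _)
  refine hd.fst.cons (ite (hd.snd.isCons) ((he.cons hd.snd).cons hst.snd) hst.snd ?_ ?_)
  · intro j hj
    rw [isCons_encNat, decide_eq_true_eq] at hj
    rw [decodeStep, if_pos hj]
    rfl
  · intro j hj
    rw [isCons_encNat, decide_eq_false_iff_not] at hj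
    rw [decodeStep, if_neg hj]

end PT

section

variable {q : ℕ} {I : Type} {s w : I → ℕ} {x : I → Data} {n : I → ℕ}
  {G : ∀ i, SimpleGraph (Fin (n i))}

/-- The networks of graphs, with the weights of the Kronecker substitution. -/
theorem wtPT_netOf {b R : I → ℕ} (hn : PT q (fun _ => 0) s x fun i => unary (n i))
    (hs : Small s n) (hA : PT q (fun _ => 0) s x fun i => encL (encL encBool) (adjMat (G i)))
    (hb : PT q (fun _ => 0) s x fun i => unary (b i)) (hbs : Small s b)
    (hR : PT q (fun _ => 0) s x fun i => unary (R i)) (hRs : Small s R) (hR0 : ∀ i, 0 < R i) :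
    WtPT q (fun _ => 0) s x (fun i => netOf q (kronecker (b i) (R i)) (G i))
      fun i => b i * R i ^ (varList (q + 1)).length + 1 := by
  -- The position of a variable depends only on `q`, so the exponent `b * R ^ varPos v` of the power
  -- of two is polynomial in the input size.
  have hW : ∀ v : Var (q + 1), PT q (fun _ => 0) s x fun i => encNat (kronecker (b i) (R i) v) :=
    fun v => (hb.mul (hR.powConst hRs _) hbs (hRs.pow _)).twoPow (hbs.mul (hRs.pow _))
  have hlt : ∀ i (v : Var (q + 1)), kronecker (b i) (R i) v <
      2 ^ (b i * R i ^ (varList (q + 1)).length + 1) := fun i v => by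
    refine Nat.pow_lt_pow_right one_lt_two (Nat.lt_succ_of_le (Nat.mul_le_mul_left _ ?_))
    refine Nat.pow_le_pow_right (hR0 i) ?_
    exact (@List.idxOf_lt_length_iff _ instBEqOfDecidableEq _ _ _ |>.2 (mem_varList v)).le
  refine ⟨⟨hn, hn.edgeList hs hA, hs, ?_, fun i e he => ?_⟩, ?_, ?_, ?_, ?_, ?_⟩
  · refine (hs.mul hs).mono fun i => ?_
    refine (length_flatMap_le (m := n i) fun u _ => ?_).trans_eq (by rw [List.length_range])
    rw [List.length_map]
    exact (List.length_filter_le _ _).trans_eq List.length_range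
  · have := mem_edgeList.1 he
    exact ⟨this.1.trans this.2.1, this.2.1⟩
  · exact (PT.ofList (List.finRange (q + 1)) fun i _ => hW (.inl i)).congr fun i =>
      (encL_map _ _ _).symm
  · exact (PT.ofList (List.finRange (q + 1)) fun i _ => PT.ofList (List.finRange (q + 1))
      fun j _ => hW (.inr s(i, j))).congr fun i => by simp only [netOf, encL_map]
  · exact (hbs.mul (hRs.pow _)).add (.const 1)
  · intro i a ha
    obtain ⟨j, _, rfl⟩ := List.mem_map.1 ha
    exact hlt i _
  · intro i r hr a ha
    obtain ⟨j, _, rfl⟩ := List.mem_map.1 hr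
    obtain ⟨k, _, rfl⟩ := List.mem_map.1 ha
    exact hlt i _

/-- From separators to the homomorphism polynomial. -/
theorem exists_homPoly_PT {S : I → List (List ℕ)}
    (hn : PT q (fun _ => 0) s x fun i => unary (n i)) (hs : Small s n)
    (hA : PT q (fun _ => 0) s x fun i => encL (encL encBool) (adjMat (G i)))
    (hS : SepPT q s x n w S)
    (hsol : ∀ i W, ∃ L, (netOf q W (G i)).solved (S i) = List.range (n i) :: L) :
    ∃ L : ∀ _ : I, List ((Var (q + 1) →₀ ℕ) × ℕ),
      (∀ i, IsExpansion (L i) (homPoly (q + 1) (G i))) ∧ PT q w s x fun i => encTerms (L i) := by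
  -- Coefficients are at most `(q + 1) ^ n ≤ 2 ^ ((q + 1) * n)`, hence below `2 ^ b`, and exponents
  -- are at most `n + n ^ 2`, hence below `R`.
  set b : I → ℕ := fun i => (q + 1) * n i + 1
  set R : I → ℕ := fun i => n i + n i ^ 2 + 1
  have hbs : Small s b := ((Small.const (q + 1)).mul hs).add (.const 1)
  have hRs : Small s R := (hs.add (hs.pow 2)).add (.const 1)
  have hb : PT q (fun _ => 0) s x fun i => unary (b i) :=
    ((PT.const (unary (q + 1))).mul hn (.const _) hs).succ
  have hR : PT q (fun _ => 0) s x fun i => unary (R i) :=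
    (hn.add (hn.powConst hs 2) (hs.pow 2)).succ
  have hZ := (wtPT_netOf (G := G) hn hs hA hb hbs hR hRs fun i => Nat.succ_pos _).partition hS
    fun i => hsol i _
  have hex : ∀ i, _ := fun i => exists_expansion (P := homPoly (q + 1) (G i)) (R := R i) (b := b i)
    (fun m hm v => Nat.lt_succ_of_le ((coeff_homPoly (G i) m).2 hm v)) fun m => by
      refine (coeff_homPoly (G i) m).1.trans_lt (Nat.lt_succ_of_le ?_ |>.trans_le
        (Nat.pow_lt_pow_right one_lt_two (Nat.lt_succ_self _)))
      rw [pow_mul]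
      exact Nat.pow_le_pow_left Nat.lt_two_pow_self.le _
  choose L hL1 hL2 using hex
  refine ⟨L, hL1, ?_⟩
  refine (PT.decode (varList (q + 1)).length hb hbs hR.up hRs hZ).congr fun i => ?_
  rw [hL2]
  simp only [← val_netOf]
  rfl

end

/-! ### Separators from tree decompositions -/

section Tree

variable {U : Type*} {H : SimpleGraph U} {A : Set U}

/-- A walk inside a set. -/
def WalkIn (H : SimpleGraph U) (A : Set U) (a b : U) : Prop :=
  ∃ w : H.Walk a b, ∀ x ∈ w.support, x ∈ A

theorem WalkIn.trans {a b c : U} (h : WalkIn H A a b) (h' : WalkIn H A b c) : WalkIn H A a c := by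
  obtain ⟨w, hw⟩ := h
  obtain ⟨w', hw'⟩ := h'
  exact ⟨w.append w', fun x hx => ((SimpleGraph.Walk.mem_support_append_iff _ _).1 hx).elim (hw x) (hw' x)⟩

theorem WalkIn.symm {a b : U} (h : WalkIn H A a b) : WalkIn H A b a :=
  let ⟨w, hw⟩ := h
  ⟨w.reverse, fun x hx => hw x (by simpa using hx)⟩

theorem WalkIn.mono {A' : Set U} {a b : U} (h : WalkIn H A a b) (hA : A ⊆ A') : WalkIn H A' a b :=
  let ⟨w, hw⟩ := h
  ⟨w, fun x hx => hA (hw x hx)⟩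

theorem walkIn_of_connected (h : (H.induce A).Preconnected) {a b : U} (ha : a ∈ A) (hb : b ∈ A) :
    WalkIn H A a b := by
  obtain ⟨w⟩ := h ⟨a, ha⟩ ⟨b, hb⟩
  refine ⟨w.map (SimpleGraph.Embedding.induce A).toHom, fun x hx => ?_⟩
  obtain ⟨y, _, rfl⟩ := List.mem_map.1
    ((congrArg (x ∈ ·) (SimpleGraph.Walk.support_map _ w)).mp hx)
  exact y.2

theorem WalkIn.exists_path {a b : U} (h : WalkIn H A a b) :
    ∃ w : H.Walk a b, w.IsPath ∧ ∀ x ∈ w.support, x ∈ A := by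
  classical
  obtain ⟨w, hw⟩ := h
  exact ⟨w.bypass, w.bypass_isPath, fun x hx => hw x (w.support_bypass_subset_support hx)⟩

/-- The first vertex in a set on a walk. -/
theorem exists_gate {a b : U} (w : H.Walk a b) (hb : b ∈ A) :
    ∃ l ∈ A, ∃ w' : H.Walk a l, ∀ x ∈ w'.support, x ∈ A → x = l := by
  induction w with
  | nil => exact ⟨_, hb, .nil, fun x hx _ => by simpa using hx⟩
  | @cons a c b h w ih =>
    by_cases ha : a ∈ A
    · exact ⟨a, ha, .nil, fun x hx _ => by simpa using hx⟩
    · obtain ⟨l, hl, w', hw'⟩ := ih hb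
      refine ⟨l, hl, .cons h w', fun x hx hxA => ?_⟩
      rw [SimpleGraph.Walk.support_cons, List.mem_cons] at hx
      rcases hx with rfl | hx
      · exact absurd hxA ha
      · exact hw' x hx hxA

/-- A connected set in a tree has a vertex that lies on all paths from a given vertex to the set. -/
theorem exists_gate_tree (hH : H.IsTree) (hA : ∀ a ∈ A, ∀ b ∈ A, WalkIn H A a b)
    (hne : A.Nonempty) (p : U) :
    ∃ l ∈ A, ∀ B : Set U, ∀ j ∈ A, WalkIn H B p j → l ∈ B := by
  classical
  obtain ⟨b, hb⟩ := hne
  obtain ⟨w⟩ := hH.1 p b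
  obtain ⟨l, hl, w, hw⟩ := exists_gate w hb
  refine ⟨l, hl, fun B j hj hB => ?_⟩
  obtain ⟨r, hr, hrB⟩ := hB.exists_path
  obtain ⟨t, ht, htA⟩ := (hA l hl j hj).exists_path
  -- The path from `p` to `l` meets `A` only in `l`, and the path from `l` to `j` stays in `A`.
  -- Together they form the unique path from `p` to `j` in the tree, so every walk from `p` to `j`
  -- passes through `l`.
  have happ : (w.bypass.append t).IsPath := by
    rw [SimpleGraph.Walk.isPath_def, SimpleGraph.Walk.support_append, List.nodup_append']
    refine ⟨w.bypass_isPath.support_nodup, ht.support_nodup.sublist (List.tail_sublist _), ?_⟩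
    intro x hx hx'
    have hxl := hw x (w.support_bypass_subset_support hx) (htA x (List.mem_of_mem_tail hx'))
    have hnd := ht.support_nodup
    rw [← SimpleGraph.Walk.cons_tail_support, List.nodup_cons] at hnd
    exact hnd.1 (hxl ▸ hx')
  have := congrArg Subtype.val ((hH.2.subsingleton_path p j).elim ⟨_, happ⟩ ⟨r, hr⟩)
  refine hrB l ?_
  rw [← show w.bypass.append t = r from this, SimpleGraph.Walk.mem_support_append_iff]
  exact .inr t.start_mem_support

end Tree

/-- If the neighbours of a connected set lie in a bag, then they lie in a bag that meets the set. -/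
theorem TreeDecomposition.exists_bag {V : Type*} {G : SimpleGraph V} {N : ℕ}
    (D : TreeDecomposition G N) {C : Set V} {u : V} (hu : u ∈ C)
    (hC : ∀ v ∈ C, Relation.ReflTransGen (fun a b => G.Adj a b ∧ b ∈ C) u v) (p : Fin N)
    (hp : ∀ v ∈ C, ∀ v' ∉ C, G.Adj v v' → v' ∈ D.bag p) :
    ∃ l, (∃ v ∈ C, v ∈ D.bag l) ∧ ∀ v ∈ C, ∀ v' ∉ C, G.Adj v v' → v' ∈ D.bag l := by
  -- As `C` is connected, the nodes whose bags meet `C` form a subtree; `l` will be its gate as seen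
  -- from `p`.
  set A : Set (Fin N) := {i | ∃ v ∈ C, v ∈ D.bag i} with hA
  have hsub : ∀ v ∈ C, {i | v ∈ D.bag i} ⊆ A := fun v hv i hi => ⟨v, hv, hi⟩
  have hsame : ∀ v, ∀ i j, v ∈ D.bag i → v ∈ D.bag j → WalkIn D.tree {i | v ∈ D.bag i} i j :=
    fun v i j hi hj => walkIn_of_connected (D.connected v).preconnected hi hj
  obtain ⟨⟨a, ha⟩⟩ := (D.connected u).nonempty
  have key : ∀ v ∈ C, ∀ j, v ∈ D.bag j → WalkIn D.tree A a j := by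
    intro v hv
    have hr := hC v hv
    clear hv
    induction hr with
    | refl => exact fun j hj => (hsame u a j ha hj).mono (hsub u hu)
    | @tail v v' _ h ih =>
      intro j hj
      obtain ⟨i, hi, hi'⟩ := D.edge_mem v v' h.1
      exact (ih i hi).trans ((hsame v' i j hi' hj).mono (hsub v' h.2))
  obtain ⟨l, hl, hl'⟩ := exists_gate_tree D.isTree (A := A) (fun i ⟨v, hv, hi⟩ j ⟨v', hv', hj⟩ =>
    (key v hv i hi).symm.trans (key v' hv' j hj)) ⟨a, u, hu, ha⟩ p
  refine ⟨l, hl, fun v hv v' hv' hvv' => ?_⟩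
  -- The neighbour `v'` lies in the bag at `p` and, because of the edge, in a bag at a node of `A`;
  -- hence the subtree of `v'` contains the gate.
  obtain ⟨j, hj, hj'⟩ := D.edge_mem v v' hvv'
  exact hl' {i | v' ∈ D.bag i} j ⟨v, hv, hj⟩ (hsame v' p j (hp v hv v' hv' hvv') hj')

section Separators

variable {q n N : ℕ} {G : SimpleGraph (Fin n)} {W : Var (q + 1) → ℕ}

theorem adj_netOf {u v : ℕ} : (netOf q W G).adj u v = true ↔
    ∃ a b : Fin n, u = a ∧ v = b ∧ G.Adj a b := by
  rw [Net.adj_iff, mem_netOf_E, mem_netOf_E]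
  constructor
  · rintro (⟨a, b, _, h, h'⟩ | ⟨a, b, _, h, h'⟩)
    · exact ⟨a, b, (Prod.mk.inj h').1, (Prod.mk.inj h').2, h⟩
    · exact ⟨b, a, (Prod.mk.inj h').2, (Prod.mk.inj h').1, h.symm⟩
  · rintro ⟨a, b, rfl, rfl, h⟩
    rcases lt_or_gt_of_ne h.ne with hab | hab
    · exact .inl ⟨a, b, hab, h, rfl⟩
    · exact .inr ⟨b, a, hab, h.symm, rfl⟩

/-- Saturation solves a graph, if all bags of a tree decomposition are among the separators. -/
theorem solved_netOf (D : TreeDecomposition G N) {S : List (List ℕ)} (h0 : [] ∈ S)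
    (hS : ∀ i, (D.bag i).Nonempty → ∃ B ∈ S, ∀ v, v ∈ B ↔ ∃ a ∈ D.bag i, v = ↑a) :
    ∃ L, (netOf q W G).solved S = List.range n :: L := by
  classical
  obtain ⟨p0⟩ := D.isTree.1.nonempty
  have hlt : ∀ e ∈ (netOf q W G).E, e.1 < (netOf q W G).n ∧ e.2 < (netOf q W G).n := by
    intro e he
    obtain ⟨a, b, _, _, rfl⟩ := mem_netOf_E.1 he
    exact ⟨a.2, b.2⟩
  -- Only the separators contained in some bag are kept: their pieces have all neighbours in one
  -- bag, as `TreeDecomposition.exists_bag` requires.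
  refine Net.solved_eq (S' := S.filter fun B => decide (∃ i, ∀ v ∈ B, ∃ a ∈ D.bag i, v = ↑a)) hlt
    List.filter_sublist.subset (List.mem_filter.2 ⟨h0, by simpa using ⟨p0⟩⟩) fun C hC => ?_
  have hCn := hC.lt
  obtain ⟨B, hB, u, hu, rfl⟩ := hC
  obtain ⟨p, hp⟩ := of_decide_eq_true (List.mem_filter.1 hB).2
  have hun := Net.lt_of_mem_off u hu
  have hmem := fun v => Net.mem_reach (v := v) hun hu Net.lt_of_mem_off
  set C := (netOf q W G).reach ((netOf q W G).off B) u with hCdef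
  obtain ⟨l, ⟨v, hv, hvl⟩, hl⟩ : ∃ l, (∃ v ∈ {a : Fin n | (a : ℕ) ∈ C}, v ∈ D.bag l) ∧
      ∀ v ∈ {a : Fin n | (a : ℕ) ∈ C}, ∀ v' ∉ {a : Fin n | (a : ℕ) ∈ C}, G.Adj v v' →
        v' ∈ D.bag l := by
    refine D.exists_bag (u := ⟨u, hun⟩) ((hmem u).2 .refl) (fun v hv => ?_) p
      fun v hv v' hv' hvv' => ?_
    · have hr := (hmem v).1 hv
      have : ∀ w, (netOf q W G).Conn ((netOf q W G).off B) u w → ∀ h : w < n,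
          Relation.ReflTransGen (fun a b : Fin n => G.Adj a b ∧ b ∈ {a : Fin n | ↑a ∈ C})
            ⟨u, hun⟩ ⟨w, h⟩ := by
        intro w hw
        induction hw with
        | refl => exact fun _ => .refl
        | @tail w w' h1 h2 ih =>
          intro h
          obtain ⟨a, b, rfl, rfl, hab⟩ := adj_netOf.1 h2.1
          exact (ih a.2).tail ⟨hab, (hmem _).2 (Relation.ReflTransGen.tail h1 h2)⟩
      exact this v hr v.2
    · by_contra hv'p
      refine hv' ((hmem _).2 (((hmem _).1 hv).tail ⟨adj_netOf.2 ⟨v, v', rfl, rfl, hvv'⟩,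
        Net.mem_off.2 ⟨v'.2, fun hB => hv'p ?_⟩⟩))
      obtain ⟨a, ha, h⟩ := hp _ hB
      rwa [Fin.ext h]
  -- The bag found meets `C`; therefore it suffices that the non-empty bags are represented among
  -- the separators.
  obtain ⟨B', hB', hBl⟩ := hS l ⟨v, hvl⟩
  refine ⟨B', List.mem_filter.2 ⟨hB', ?_⟩, ?_, v, hv, (hBl v).2 ⟨v, hvl, rfl⟩⟩
  · exact decide_eq_true ⟨l, fun v hv => (hBl v).1 hv⟩
  · simp only [Net.closed, List.all_eq_true, Bool.and_eq_true, Bool.or_eq_true,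
      Bool.not_eq_true', List.contains_iff_mem, ← Bool.not_eq_true]
    intro e he
    obtain ⟨a, b, _, hab, rfl⟩ := mem_netOf_E.1 he
    have key : ∀ a b : Fin n, G.Adj a b → ¬ (a : ℕ) ∈ C ∨ (b : ℕ) ∈ C ∨ (b : ℕ) ∈ B' := by
      intro a b hab
      by_cases ha : (a : ℕ) ∈ C
      · by_cases hb : (b : ℕ) ∈ C
        · exact .inr (.inl hb)
        · exact .inr (.inr ((hBl b).2 ⟨b, hl a ha b hb hab, rfl⟩))
      · exact .inl ha
    exact ⟨key a b hab, key b a hab.symm⟩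

end Separators

theorem TreeDecomposition.card_bag_le {V : Type*} {G : SimpleGraph V} {N t : ℕ}
    (D : TreeDecomposition G N) (h : D.width ≤ t) (i : Fin N) : (D.bag i).card ≤ t + 1 := by
  have h1 := Finset.le_sup (f := fun i => (D.bag i).card) (Finset.mem_univ i)
  rw [TreeDecomposition.width] at h
  omega

/-- The infimum of an empty set of natural numbers would be 0. The decomposition with a single node
shows that the set of widths is not empty, so the infimum is attained. -/
theorem exists_treeDecomposition {n t : ℕ} {G : SimpleGraph (Fin n)} (h : treeWidth G ≤ t) :
    ∃ (N : ℕ) (D : TreeDecomposition G N), D.width ≤ t := by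
  have hne : {w | ∃ (N : ℕ) (D : TreeDecomposition G N), D.width = w}.Nonempty := by
    refine ⟨_, 1, ⟨⊥, ?_, fun _ => Finset.univ, fun u v _ => ⟨0, by simp, by simp⟩, fun v => ?_⟩, rfl⟩
    · exact SimpleGraph.IsTree.of_subsingleton
    · have : Nonempty {i : Fin 1 | v ∈ (Finset.univ : Finset (Fin n))} := ⟨⟨0, by simp⟩⟩
      exact SimpleGraph.Connected.of_subsingleton
  obtain ⟨N, D, hD⟩ := Nat.sInf_mem hne
  exact ⟨N, D, hD.trans_le h⟩

/-! ### The two algorithms -/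

theorem encGraph_eq {n : ℕ} (G : SimpleGraph (Fin n)) :
    encGraph G = encL (encL encBool) (adjMat G) := by
  classical
  rw [adjMat, encL_map, encGraph, encL]
  congr 1
  refine List.map_congr_left fun i _ => ?_
  rw [encL_map]
  rfl

theorem length_adjMat {n : ℕ} (G : SimpleGraph (Fin n)) : (adjMat G).length = n := by
  simp [adjMat]

/-- A graph with a tree decomposition. -/
structure DecompInput where
  n : ℕ
  N : ℕ
  G : SimpleGraph (Fin n)
  D : TreeDecomposition G N

namespace DecompInput

/-- The size of the input. -/
def size (i : DecompInput) : ℕ := i.n + i.N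

noncomputable def enc (i : DecompInput) : Data := encGraphWithDecomp i.G i.D

/-- The largest size of a bag. -/
def maxBag (i : DecompInput) : ℕ := Finset.univ.sup fun j => (i.D.bag j).card

/-- The characteristic vectors of the bags. -/
def bagVecs (i : DecompInput) : List (List Bool) :=
  (List.finRange i.N).map fun j => (List.finRange i.n).map fun v => decide (v ∈ i.D.bag j)

/-- The empty set and the bags. -/
def seps (i : DecompInput) : List (List ℕ) :=
  [] :: i.bagVecs.map fun r => (List.range i.n).filter fun v => r.getD v false

theorem mem_bagVec (i : DecompInput) {j : Fin i.N} {v : ℕ} :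
    v ∈ (List.range i.n).filter (fun v =>
      ((List.finRange i.n).map fun v => decide (v ∈ i.D.bag j)).getD v false) ↔
      ∃ a ∈ i.D.bag j, v = ↑a := by
  rw [List.mem_filter, List.mem_range]
  constructor
  · rintro ⟨hv, h⟩
    have := getD_finRange (fun v => decide (v ∈ i.D.bag j)) ⟨v, hv⟩ false
    exact ⟨⟨v, hv⟩, of_decide_eq_true (this.symm.trans h), rfl⟩
  · rintro ⟨a, ha, rfl⟩
    exact ⟨a.2, by rw [getD_finRange]; exact decide_eq_true ha⟩

variable {q : ℕ}

theorem enc_fst : PT q (fun _ => 0) size enc fun i => encL (encL encBool) (adjMat i.G) :=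
  (PT.fst (PT.id.congr fun i => show enc i = _ from rfl)).congr fun i => encGraph_eq i.G

theorem enc_bags : PT q (fun _ => 0) size enc fun i => encL (encL encBool) i.bagVecs :=
  (PT.snd (PT.snd (PT.id.congr fun i => show enc i = _ from rfl))).congr fun i => by
    classical
    rw [bagVecs, encL_map, encL]
    congr 1
    refine List.map_congr_left fun j _ => ?_
    rw [encL_map, encL, encSet]
    congr 1
    refine List.map_congr_left fun v _ => ?_
    simp

theorem small_n : Small size fun i => i.n := Small.self.mono fun _ => Nat.le_add_right _ _

theorem small_N : Small size fun i => i.N := Small.self.mono fun _ => Nat.le_add_left _ _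

theorem enc_n : PT q (fun _ => 0) size enc fun i => unary i.n :=
  (enc_fst.length (small_n.mono fun i => (length_adjMat i.G).le)).congr fun i => by
    rw [length_adjMat]

theorem sepPT : SepPT q size enc n maxBag seps := by
  have hl : Small size fun i => i.bagVecs.length := small_N.mono fun i => by simp [bagVecs]
  refine ⟨(PT.const .nil).cons ?_, ?_, ?_, ?_, ?_⟩
  · refine PT.map (ea := fun _ => encL encBool) enc_bags hl fun x' hx hr => ?_
    refine PT.filter (ea := fun _ => unary)
      (l := fun j : MemIdx bagVecs => List.range j.i.n) ((enc_n.range small_n).via hx)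
      ((small_n.comap MemIdx.i).mono fun j => by simp) fun x'' hx' hv => ?_
    exact PT.getD (ea := fun _ => encBool) (d := false) (fun _ => rfl)
      ((hr (e' := fun _ => 0)).via hx') hv
      ((small_n.comap fun j : MemIdx fun j : MemIdx bagVecs => List.range j.i.n => j.i.i).mono
        fun j => (List.mem_range.1 j.h).le)
  · simpa [seps] using hl.add (.const 1)
  · intro i B hB v hv
    rcases List.mem_cons.1 hB with rfl | hB
    · simp at hv
    · obtain ⟨r, _, rfl⟩ := List.mem_map.1 hB
      exact List.mem_range.1 (List.mem_filter.1 hv).1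
  · exact small_n.mono fun i => Finset.sup_le fun j _ => (Finset.card_le_univ _).trans_eq (by simp)
  · intro i B hB
    rcases List.mem_cons.1 hB with rfl | hB
    · exact Nat.zero_le _
    · obtain ⟨r, hr, rfl⟩ := List.mem_map.1 hB
      obtain ⟨j, _, rfl⟩ := List.mem_map.1 hr
      refine le_trans ?_ (Finset.le_sup (f := fun j => (i.D.bag j).card) (Finset.mem_univ j))
      rw [← List.toFinset_card_of_nodup (List.nodup_range.filter _)]
      refine (Finset.card_le_card (t := (i.D.bag j).image Fin.val) fun v hv => ?_).trans
        Finset.card_image_le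
      obtain ⟨a, ha, rfl⟩ := i.mem_bagVec.1 (List.mem_toFinset.1 hv)
      exact Finset.mem_image_of_mem _ ha

theorem solved_seps (i : DecompInput) (W : Var (q + 1) → ℕ) :
    ∃ L, (netOf q W i.G).solved i.seps = List.range i.n :: L :=
  solved_netOf i.D (by simp [seps]) fun j _ => ⟨_, List.mem_cons_of_mem _ (List.mem_map_of_mem
    (List.mem_map_of_mem (List.mem_finRange j))), fun _ => i.mem_bagVec⟩

end DecompInput

/-- A graph of tree width at most `t`. -/
structure WidthInput (t : ℕ) where
  n : ℕ
  G : SimpleGraph (Fin n)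
  le : treeWidth G ≤ t

namespace WidthInput

variable {q t : ℕ}

noncomputable def enc (i : WidthInput t) : Data := encGraph i.G

/-- The empty set and all tuples of vertices of length `t + 1`. -/
def seps (i : WidthInput t) : List (List ℕ) := [] :: vecs i.n (t + 1)

theorem enc_adj : PT q (fun _ => 0) n enc fun i : WidthInput t =>
    encL (encL encBool) (adjMat i.G) := PT.id.congr fun i => encGraph_eq i.G

theorem enc_n : PT q (fun _ => 0) n enc fun i : WidthInput t => unary i.n :=
  (enc_adj.length (Small.self.mono fun i => (length_adjMat i.G).le)).congr fun i => by
    rw [length_adjMat]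

theorem sepPT : SepPT q n enc n (fun _ : WidthInput t => t + 1) seps := by
  refine ⟨(PT.const .nil).cons ((enc_n.range .self).vecs .self (t + 1)), ?_, ?_, .const _, ?_⟩
  · simpa [seps, length_vecs] using (Small.self.pow (t + 1)).add (.const 1)
  · intro i B hB v hv
    rcases List.mem_cons.1 hB with rfl | hB
    · simp at hv
    · exact (mem_vecs.1 hB).2 v hv
  · intro i B hB
    rcases List.mem_cons.1 hB with rfl | hB
    · exact Nat.zero_le _
    · exact (mem_vecs.1 hB).1.le

/-- A non-empty bag becomes a tuple of length exactly `t + 1` by repeating one of its elements. -/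
theorem solved_seps (i : WidthInput t) (W : Var (q + 1) → ℕ) :
    ∃ L, (netOf q W i.G).solved i.seps = List.range i.n :: L := by
  obtain ⟨N, D, hD⟩ := exists_treeDecomposition i.le
  refine solved_netOf D (by simp [seps]) fun j ⟨a, ha⟩ => ?_
  have hc := D.card_bag_le hD j
  refine ⟨(D.bag j).toList.map Fin.val ++ List.replicate (t + 1 - (D.bag j).card) a.val,
    List.mem_cons_of_mem _ (mem_vecs.2 ⟨?_, fun v hv => ?_⟩), fun v => ?_⟩
  · simp
    omega
  · rcases List.mem_append.1 hv with h | h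
    · obtain ⟨b, _, rfl⟩ := List.mem_map.1 h
      exact b.2
    · rw [List.eq_of_mem_replicate h]
      exact a.2
  · rw [List.mem_append, List.mem_map]
    constructor
    · rintro (⟨b, hb, rfl⟩ | h)
      · exact ⟨b, Finset.mem_toList.1 hb, rfl⟩
      · exact ⟨a, ha, List.eq_of_mem_replicate h⟩
    · rintro ⟨b, hb, rfl⟩
      exact .inl ⟨b, Finset.mem_toList.2 hb, rfl⟩

end WidthInput

/-- Separators of `t + 1` vertices cost `(q + 1) ^ (t + 1)`. The surplus factor is at most `b ^ (q +
1)`, because `b ≥ 2`, so the constant 1 is enough. -/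
theorem pow_bound {q t e s b c : ℕ} (he : e ≤ t + 1) (hs : 2 ≤ b) (hb : s + 2 ≤ b ^ 2) :
    (q + 1) ^ e * (s + 2) ^ c ≤ 1 * (q + 1) ^ t * b ^ (q + 1 + 2 * c) := by
  have h1 : q + 1 ≤ b ^ (q + 1) :=
    Nat.lt_two_pow_self.le.trans (Nat.pow_le_pow_left hs _)
  calc (q + 1) ^ e * (s + 2) ^ c ≤ (q + 1) ^ (t + 1) * (b ^ 2) ^ c :=
        Nat.mul_le_mul (Nat.pow_le_pow_right (by omega) he) (Nat.pow_le_pow_left hb c)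
    _ = (q + 1) ^ t * ((q + 1) * b ^ (2 * c)) := by rw [pow_succ, pow_mul, mul_assoc]
    _ ≤ (q + 1) ^ t * (b ^ (q + 1) * b ^ (2 * c)) :=
        Nat.mul_le_mul_left _ (Nat.mul_le_mul_right _ h1)
    _ = _ := by rw [one_mul, pow_add b (q + 1)]

end HomPoly

theorem mainTheorem10 :
    ∃ C : ℕ, ∀ q : ℕ, 1 ≤ q →
      -- dynamic programming over a given tree decomposition, one program for all widths
      (∃ (k : ℕ) (A : HomPoly.Prog), ∀ (t n N : ℕ) (G : SimpleGraph (Fin n))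
        (D : HomPoly.TreeDecomposition G N), D.width ≤ t →
          HomPoly.ComputesWithin A (HomPoly.encGraphWithDecomp G D) (HomPoly.homPoly q G)
            (C * q ^ t * (n + N + 1) ^ k)) ∧
      -- graphs of tree width at most `t`, given without a decomposition
      (∀ t : ℕ, ∃ (k : ℕ) (A : HomPoly.Prog), ∀ (n : ℕ) (G : SimpleGraph (Fin n)),
        HomPoly.treeWidth G ≤ t →
          HomPoly.ComputesWithin A (HomPoly.encGraph G) (HomPoly.homPoly q G)
            (C * q ^ t * (n + 2) ^ k)) := by
  refine ⟨1, fun q hq => ?_⟩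
  obtain ⟨q, rfl⟩ := Nat.exists_eq_add_of_le' hq
  constructor
  · obtain ⟨L, hL, p, c, hp⟩ := HomPoly.exists_homPoly_PT (q := q) HomPoly.DecompInput.enc_n HomPoly.DecompInput.small_n
      HomPoly.DecompInput.enc_fst HomPoly.DecompInput.sepPT HomPoly.DecompInput.solved_seps
    refine ⟨q + 1 + 2 * c, p, fun t n N G D hD => ?_⟩
    obtain ⟨k, hk, hr⟩ := hp ⟨n, N, G, D⟩
    -- A tree has a node, so the base `n + N + 1` is at least 2 even if `n = 0`.
    obtain ⟨j⟩ := D.isTree.1.nonempty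
    have := j.pos
    refine ⟨_, k, hL ⟨n, N, G, D⟩, hk.trans (HomPoly.pow_bound ?_ (by omega) ?_), hr⟩
    · exact Finset.sup_le fun j _ => D.card_bag_le hD j
    · simp only [HomPoly.DecompInput.size]
      nlinarith
  · intro t
    obtain ⟨L, hL, p, c, hp⟩ := HomPoly.exists_homPoly_PT (q := q) (HomPoly.WidthInput.enc_n (t := t)) .self
      HomPoly.WidthInput.enc_adj HomPoly.WidthInput.sepPT HomPoly.WidthInput.solved_seps
    refine ⟨q + 1 + 2 * c, p, fun n G hG => ?_⟩
    obtain ⟨k, hk, hr⟩ := hp ⟨n, G, hG⟩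
    refine ⟨_, k, hL ⟨n, G, hG⟩, hk.trans (HomPoly.pow_bound le_rfl (by omega) ?_), hr⟩
    dsimp only
    nlinarith
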